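/- Let $M$ be a connected smooth manifold without boundary (finite-dimensional, Hausdorff, second countable), let $X_0,X_1,\dots,X_k$ be smooth vector fields on $M$ and let $L:M\times\mathbb R^k\to\mathbb R$ be a smooth Lagrangian. An admissible pair is a bounded measurable control $u:[0,1]\to\mathbb R^k$ together with a Lipschitz path $x:[0,1]\to M$ such that $$\dot x(t)=F(x(t),u(t)):=X_0(x(t))+\sum_{i=1}^k u_i(t)X_i(x(t))\quad\text{for a.e. }t\in[0,1].$$ For $a,b\in M$ let $c(a,b)$ be the infimum of $\int_0^1L(x(t),u(t))\,dt$ over all admissible pairs with $x(0)=a$, $x(1)=b$ ($+\infty$ if there are none); the path of an admissible pair achieving this infimum is called a minimizer joining $a$ to $b$. Assume that the Hamiltonian $H:T^*M\to\mathbb R$, $H(p_x)=\max_{u\in\mathbb R^k}\big(p_x(F(x,u))-L(x,u)\big)$, is well defined (the maximum is attained) and of class $C^2$. A minimizer $x(\cdot)$ is normal if there is a trajectory $p:[0,1]\to T^*M$ of the Hamiltonian vector field of $H$ that projects to $x(\cdot)$; a minimizer that is not normal is called strictly abnormal. Assume that the cost $c$ is complete (any two points of $M$ are joined by a minimizer;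 in particular $c$ is finite), continuous on $M\times M$ and bounded below. Let $\mu,\nu$ be Borel probability measures on $M$ such that $\operatorname{supp}\mu$ is the closure of its interior and such that $C(\mu,\nu):=\inf_{\Pi}\int_{M\times M}c\,d\Pi<\infty$, where $\Pi$ ranges over all measures on $M\times M$ with marginals $\mu$ and $\nu$. A measure $\Pi$ with marginals $\mu,\nu$ is optimal if $\int c\,d\Pi=C(\mu,\nu)$. Then: 1. If $\varphi:M\to M$ is continuous and $(\mathrm{id}\times\varphi)_*\mu$ is optimal, then the set of those $x\in\operatorname{supp}\mu$ for which $x$ and $\varphi(x)$ are joined by a normal minimizer is dense in $\operatorname{supp}\mu$. 2. Let $\Phi_t$, $t\in[0,1]$, be a continuous local flow defined on an open set $W\supseteq\operatorname{supp}\mu$ all of whose trajectories $t\mapsto\Phi_t(x)$, $t\in[0,1]$, $x\in W$, are strictly abnormal minimizers. Then $(\mathrm{id}\times\Phi_1)_*\mu$ is not optimal, i.e. the time-one map $\Phi_1$ does not induce an optimal plan between $\mu$ and $\nu$. -/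

import Mathlib

open MeasureTheory Set Filter Topology
open scoped Manifold ContDiff NNReal ENNReal

namespace OptimalControl

/-- The cotangent bundle `T*M` of a manifold `M` modelled on `E`. -/
abbrev CotangentBundle (E : Type*) [NormedAddCommGroup E] [NormedSpace ℝ E]
    (M : Type*) [TopologicalSpace M] [ChartedSpace E M] : Type _ :=
  Bundle.TotalSpace (E →L[ℝ] ℝ) (fun x : M => TangentSpace 𝓘(ℝ, E) x →L[ℝ] ℝ)

section Cotangent

variable {E : Type*} [NormedAddCommGroup E] [NormedSpace ℝ E]
  {M : Type*} [TopologicalSpace M] [ChartedSpace E M] [IsManifold 𝓘(ℝ, E) ∞ M]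

/-- The canonical symplectic form `ω = -dθ = ∑ dqⁱ ∧ dpᵢ` on `T*M` (`θ = p dq` is the tautological
form), evaluated on `w, w' ∈ T_p(T*M)`. Tangent vectors of a manifold at a point are written by
Mathlib in the preferred chart at that point. The preferred chart of `T*M` at `p` is the cotangent
lift `(q, p)` of the preferred chart of `M` at `π(p)`, so the two components of `w ∈ E × E*` are its
`q`-part and its `p`-part in canonical coordinates. -/
noncomputable def symplecticForm (p : CotangentBundle E M)
    (w w' : TangentSpace (𝓘(ℝ, E).prod 𝓘(ℝ, E →L[ℝ] ℝ)) p) : ℝ :=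
  let v : E × (E →L[ℝ] ℝ) := w
  let v' : E × (E →L[ℝ] ℝ) := w'
  v'.2 v.1 - v.2 v'.1

/-- `w` is the value at `p` of the Hamiltonian vector field of `H : T*M → ℝ`, that is,
`ω_p(w, ·) = dH_p`; in canonical coordinates `w = (∂H/∂p, -∂H/∂q)`. -/
def IsHamiltonianVector (H : CotangentBundle E M → ℝ) (p : CotangentBundle E M)
    (w : TangentSpace (𝓘(ℝ, E).prod 𝓘(ℝ, E →L[ℝ] ℝ)) p) : Prop :=
  ∀ w' : TangentSpace (𝓘(ℝ, E).prod 𝓘(ℝ, E →L[ℝ] ℝ)) p,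
    symplecticForm p w w' =
      (mfderiv (𝓘(ℝ, E).prod 𝓘(ℝ, E →L[ℝ] ℝ)) 𝓘(ℝ, ℝ) H p w' : ℝ)

/-- The curve `p : [0,1] → T*M` is a trajectory of the Hamiltonian vector field of `H`. -/
def IsHamiltonianTrajectory (H : CotangentBundle E M → ℝ) (p : ℝ → CotangentBundle E M) : Prop :=
  ∀ t ∈ Icc (0 : ℝ) 1, ∃ w : TangentSpace (𝓘(ℝ, E).prod 𝓘(ℝ, E →L[ℝ] ℝ)) (p t),
    IsHamiltonianVector H (p t) w ∧
    HasMFDerivWithinAt 𝓘(ℝ, ℝ) (𝓘(ℝ, E).prod 𝓘(ℝ, E →L[ℝ] ℝ)) p (Icc 0 1) t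
      ((1 : ℝ →L[ℝ] ℝ).smulRight w)

end Cotangent

/-- Data of a control-affine optimal control problem on `M` with control set `ℝᵏ`:
smooth vector fields `X₀, X₁, …, X_k` and a smooth Lagrangian `L : M × ℝᵏ → ℝ`. -/
structure Problem (E : Type*) [NormedAddCommGroup E] [NormedSpace ℝ E]
    (M : Type*) [TopologicalSpace M] [ChartedSpace E M] [IsManifold 𝓘(ℝ, E) ∞ M] (k : ℕ) where
  /-- the drift `X₀` -/
  drift : (x : M) → TangentSpace 𝓘(ℝ, E) x
  /-- the controlled vector fields `X₁, …, X_k` -/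
  field : Fin k → (x : M) → TangentSpace 𝓘(ℝ, E) x
  /-- the Lagrangian `L` -/
  lagrangian : M × EuclideanSpace ℝ (Fin k) → ℝ
  smooth_drift : ContMDiff 𝓘(ℝ, E) 𝓘(ℝ, E).tangent ∞
    (fun x => (⟨x, drift x⟩ : TangentBundle 𝓘(ℝ, E) M))
  smooth_field : ∀ i, ContMDiff 𝓘(ℝ, E) 𝓘(ℝ, E).tangent ∞
    (fun x => (⟨x, field i x⟩ : TangentBundle 𝓘(ℝ, E) M))
  smooth_lagrangian :
    ContMDiff (𝓘(ℝ, E).prod 𝓘(ℝ, EuclideanSpace ℝ (Fin k))) 𝓘(ℝ, ℝ) ∞ lagrangian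

namespace Problem

variable {E : Type*} [NormedAddCommGroup E] [NormedSpace ℝ E]
  {M : Type*} [TopologicalSpace M] [ChartedSpace E M] [IsManifold 𝓘(ℝ, E) ∞ M] {k : ℕ}

/-- The right-hand side `F(x,u) = X₀(x) + ∑ uᵢ Xᵢ(x)` of the control system. -/
noncomputable def velocity (P : Problem E M k) (x : M) (u : EuclideanSpace ℝ (Fin k)) : TangentSpace 𝓘(ℝ, E) x :=
  P.drift x + ∑ i, u i • P.field i x

/-- `(x(·), u(·))` is an admissible pair on `[0,1]`: the control `u` is bounded and (Lebesgue)
measurable, the path `x` is Lipschitz in charts, and `ẋ(t) = F(x(t), u(t))` for almost every `t`.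
Values of `x` and `u` outside `[0,1]` play no role. -/
structure IsAdmissible (P : Problem E M k) (x : ℝ → M) (u : ℝ → EuclideanSpace ℝ (Fin k)) :
    Prop where
  measurable_control : AEMeasurable u (volume.restrict (Icc 0 1))
  bounded_control : ∃ R : ℝ, ∀ t ∈ Icc (0 : ℝ) 1, ‖u t‖ ≤ R
  continuous_path : ContinuousOn x (Icc 0 1)
  lipschitz_path : ∀ t ∈ Icc (0 : ℝ) 1, ∃ K : ℝ≥0, ∃ s ∈ 𝓝[Icc 0 1] t,
    LipschitzOnWith K (fun r => extChartAt 𝓘(ℝ, E) (x t) (x r)) s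
  dynamics : ∀ᵐ t ∂(volume.restrict (Icc (0 : ℝ) 1)),
    HasMFDerivWithinAt 𝓘(ℝ, ℝ) 𝓘(ℝ, E) x (Icc 0 1) t
      ((1 : ℝ →L[ℝ] ℝ).smulRight (P.velocity (x t) (u t)))

/-- The action `∫₀¹ L(x(t), u(t)) dt`. -/
noncomputable def action (P : Problem E M k) (x : ℝ → M) (u : ℝ → EuclideanSpace ℝ (Fin k)) : ℝ :=
  ∫ t in (0 : ℝ)..1, P.lagrangian (x t, u t)

/-- The optimal control cost `c(a,b)`: the infimum of the action over all admissible pairs whose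
path goes from `a` to `b`, and `+∞` if there is no such pair. -/
noncomputable def cost (P : Problem E M k) (a b : M) : EReal :=
  ⨅ (x : ℝ → M) (u : ℝ → EuclideanSpace ℝ (Fin k))
    (_ : P.IsAdmissible x u ∧ x 0 = a ∧ x 1 = b), ((P.action x u : ℝ) : EReal)

/-- The path `x` is a minimizer joining `a` to `b`. -/
def IsMinimizer (P : Problem E M k) (x : ℝ → M) (a b : M) : Prop :=
  x 0 = a ∧ x 1 = b ∧
    ∃ u : ℝ → EuclideanSpace ℝ (Fin k), P.IsAdmissible x u ∧ ((P.action x u : ℝ) : EReal) = P.cost a b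

/-- The cost is complete: any two points are joined by a minimizer. -/
def CompleteCost (P : Problem E M k) : Prop :=
  ∀ a b : M, ∃ x : ℝ → M, P.IsMinimizer x a b

/-- The function `u ↦ p(F(π(p), u)) - L(π(p), u)`. -/
noncomputable def preHamiltonian (P : Problem E M k) (p : CotangentBundle E M)
    (u : EuclideanSpace ℝ (Fin k)) : ℝ :=
  p.2 (P.velocity p.1 u) - P.lagrangian (p.1, u)

/-- The Hamiltonian `H(p) = max_u (p(F(π(p), u)) - L(π(p), u))`. -/
noncomputable def hamiltonian (P : Problem E M k) (p : CotangentBundle E M) : ℝ :=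
  ⨆ u, P.preHamiltonian p u

/-- The Hamiltonian is well defined (the maximum over `u` is attained) and of class `C²` on
`T*M`. -/
def HamiltonianIsC2 (P : Problem E M k) : Prop :=
  (∀ p : CotangentBundle E M, ∃ u₀, ∀ u, P.preHamiltonian p u ≤ P.preHamiltonian p u₀) ∧
  ContMDiff (𝓘(ℝ, E).prod 𝓘(ℝ, E →L[ℝ] ℝ)) 𝓘(ℝ, ℝ) 2 P.hamiltonian

/-- A minimizer is normal if it lifts to a trajectory `p : [0,1] → T*M` of the Hamiltonian vector
field of `H`. -/
def IsNormalMinimizer (P : Problem E M k) (x : ℝ → M) (a b : M) : Prop :=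
  P.IsMinimizer x a b ∧
    ∃ p : ℝ → CotangentBundle E M, (∀ t ∈ Icc (0 : ℝ) 1, (p t).1 = x t) ∧
      IsHamiltonianTrajectory P.hamiltonian p

/-- A minimizer is strictly abnormal if it is not normal. -/
def IsStrictlyAbnormalMinimizer (P : Problem E M k) (x : ℝ → M) (a b : M) : Prop :=
  P.IsMinimizer x a b ∧ ¬ P.IsNormalMinimizer x a b

/-- `Φ` is a (continuous) local flow, defined for times in `[0,1]` on the open set `W`, whose
trajectories `t ↦ Φ_t(x)`, `t ∈ [0,1]`, are all strictly abnormal minimizers. -/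
structure IsStrictlyAbnormalFlow (P : Problem E M k) (W : Set M) (Φ : ℝ → M → M) : Prop where
  isOpen : IsOpen W
  continuous : ContinuousOn (fun z : ℝ × M => Φ z.1 z.2) (Icc 0 1 ×ˢ W)
  zero : ∀ x ∈ W, Φ 0 x = x
  add : ∀ x ∈ W, ∀ s t : ℝ, 0 ≤ s → 0 ≤ t → s + t ≤ 1 → Φ t x ∈ W → Φ (s + t) x = Φ s (Φ t x)
  strictlyAbnormal : ∀ x ∈ W, P.IsStrictlyAbnormalMinimizer (fun t => Φ t x) x (Φ 1 x)

end Problem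

section Transport

variable {M : Type*} [MeasurableSpace M]

/-- The integral `∫ c dγ = ∫ c⁺ dγ - ∫ c⁻ dγ` in `[-∞,+∞]` of an extended real function.
The second integral is finite when `c` is bounded below and `γ` is a probability measure. -/
noncomputable def planCost (c : M → M → EReal) (γ : Measure (M × M)) : EReal :=
  ((∫⁻ z, (c z.1 z.2).toENNReal ∂γ : ℝ≥0∞) : EReal) -
    ((∫⁻ z, (-(c z.1 z.2)).toENNReal ∂γ : ℝ≥0∞) : EReal)

/-- `γ` is a joint measure with marginals `μ` and `ν`. -/
def IsPlan (μ ν : Measure M) (γ : Measure (M × M)) : Prop :=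
  γ.map Prod.fst = μ ∧ γ.map Prod.snd = ν

/-- The Kantorovich infimum `C(μ,ν) = inf_γ ∫ c dγ`. -/
noncomputable def kantorovichCost (c : M → M → EReal) (μ ν : Measure M) : EReal :=
  ⨅ (γ : Measure (M × M)) (_ : IsPlan μ ν γ), planCost c γ

/-- `γ` achieves the infimum in the Kantorovich problem for `μ` and `ν`. -/
def IsOptimalPlan (c : M → M → EReal) (μ ν : Measure M) (γ : Measure (M × M)) : Prop :=
  IsPlan μ ν γ ∧ planCost c γ = kantorovichCost c μ ν

end Transport

end OptimalControl

/-! The proof joins an argument from optimal transport with a Pontryagin principle that has no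
abnormal case.

Transport side. If a finite family of points in the support of an optimal plan could be rematched at
lower total cost, moving a little mass near these points would improve the plan, since `c` is
continuous (`sum_le_sum_perm_of_optimal`). Nonnegativity of the resulting cycles yields a function
`f` with `f z - f x ≤ c(z, φ x) - c(x, φ x)` on the support, and this inequality also makes `f`
continuous there (`exists_kantorovich_potential`). Near any interior point of the support, a
continuous function is touched from below by a differentiable function `ψ` at some point `x`
(`exists_touching`). Hence `ψ` also supports `c(·, φ x)` from below at `x`. Such points `x` are
dense, because the support is the closure of its interior.

Control side. Suppose that `ψ` supports `c(·, z)` from below at the start of a minimizer, and put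
`p(0) = -dψ`. Letting neighbouring initial points follow the minimizer's own control shows that the
solution `p` of the adjoint equation keeps `-p(t)` a subgradient of the optimal cost to go
(`hasFDerivAt_transport`). A needle variation may then displace the starting point and keep the end
point fixed. The subgradient controls the price of the displacement, so no multiplier for an end
point constraint appears, and `p(t)` satisfies the maximality condition (`maximality_of_needle`). An
envelope argument turns maximality into Hamilton's equations for almost every time
(`fderiv_eq_of_maximality`); their right-hand side is continuous in time, so they hold for all
times. This is done in charts on short intervals and then glued (`exists_hamiltonian_lift`).

Together, `support_subset_closure_normal` shows that for a dense set of `x` every minimizer from `x`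
to `φ x` is normal. The first claim then follows from completeness. For the second, a strictly
abnormal trajectory starting at one of these points is a contradiction. -/

namespace OptimalControl

/-! ### Bounded measurable functions and their Lipschitz primitives -/

/-- `c` is bounded and measurable on `[a,b]`. -/
def BddMeasOn {Z : Type*} [NormedAddCommGroup Z] (c : ℝ → Z) (a b : ℝ) : Prop :=
  AEStronglyMeasurable c (volume.restrict (Icc a b)) ∧ ∃ R : ℝ, ∀ t ∈ Icc a b, ‖c t‖ ≤ R

namespace BddMeasOn

variable {Z Z' : Type*} [NormedAddCommGroup Z] [NormedAddCommGroup Z'] {a b a' b' : ℝ} {c : ℝ → Z}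

theorem mono (h : BddMeasOn c a b) (ha : a ≤ a') (hb : b' ≤ b) : BddMeasOn c a' b' :=
  ⟨h.1.mono_measure (Measure.restrict_mono (Icc_subset_Icc ha hb) le_rfl),
    h.2.imp fun _ hR t ht => hR t (Icc_subset_Icc ha hb ht)⟩

theorem of_continuousOn (h : ContinuousOn c (Icc a b)) : BddMeasOn c a b :=
  ⟨h.aestronglyMeasurable_of_isCompact isCompact_Icc measurableSet_Icc,
    isCompact_Icc.exists_bound_of_continuousOn h⟩

theorem prodMk {c' : ℝ → Z'} (h : BddMeasOn c a b) (h' : BddMeasOn c' a b) :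
    BddMeasOn (fun t => (c t, c' t)) a b := by
  obtain ⟨R, hR⟩ := h.2
  obtain ⟨R', hR'⟩ := h'.2
  exact ⟨h.1.prodMk h'.1, max R R', fun t ht =>
    max_le_max (hR t ht) (hR' t ht)⟩

theorem comp [ProperSpace Z] {g : Z → Z'} (hg : Continuous g) (h : BddMeasOn c a b) :
    BddMeasOn (fun t => g (c t)) a b := by
  obtain ⟨R, hR⟩ := h.2
  obtain ⟨B, hB⟩ := (isCompact_closedBall (0 : Z) R).exists_bound_of_continuousOn hg.continuousOn
  exact ⟨hg.comp_aestronglyMeasurable h.1, B, fun t ht => hB _ (by simpa using hR t ht)⟩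

theorem integrableOn (h : BddMeasOn c a b) : IntegrableOn c (Icc a b) := by
  obtain ⟨R, hR⟩ := h.2
  exact IntegrableOn.of_bound (by simp) h.1 R
    ((ae_restrict_iff' measurableSet_Icc).2 (Eventually.of_forall hR))

theorem intervalIntegrable (h : BddMeasOn c a b) {s t : ℝ} (hs : s ∈ Icc a b) (ht : t ∈ Icc a b) :
    IntervalIntegrable c volume s t := by
  rw [intervalIntegrable_iff]
  refine h.integrableOn.mono_set fun r hr => ?_
  have := uIoc_subset_uIcc hr
  exact (uIcc_subset_Icc hs ht) this

end BddMeasOn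

/-- `y` is a primitive of `φ` on `[a,b]`. -/
def IsPrimitiveOn {X : Type*} [NormedAddCommGroup X] [NormedSpace ℝ X] (y φ : ℝ → X)
    (a b : ℝ) : Prop :=
  ∀ t ∈ Icc a b, y t = y a + ∫ s in a..t, φ s

namespace IsPrimitiveOn

variable {X : Type*} [NormedAddCommGroup X] [NormedSpace ℝ X] {y φ : ℝ → X} {a b : ℝ}

theorem eq_add (h : IsPrimitiveOn y φ a b) (hφ : BddMeasOn φ a b) {s t : ℝ} (hs : s ∈ Icc a b)
    (ht : t ∈ Icc a b) : y t = y s + ∫ r in s..t, φ r := by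
  have ha : a ∈ Icc a b := ⟨le_rfl, hs.1.trans hs.2⟩
  rw [h t ht, h s hs, add_assoc, intervalIntegral.integral_add_adjacent_intervals
    (hφ.intervalIntegrable ha hs) (hφ.intervalIntegrable hs ht)]

theorem mono (h : IsPrimitiveOn y φ a b) (hφ : BddMeasOn φ a b) {a' b' : ℝ} (ha : a ≤ a')
    (hab : a' ≤ b') (hb : b' ≤ b) : IsPrimitiveOn y φ a' b' := fun _ ht =>
  h.eq_add hφ ⟨ha, hab.trans hb⟩ ⟨ha.trans ht.1, ht.2.trans hb⟩

theorem norm_sub_le (h : IsPrimitiveOn y φ a b) (hφ : BddMeasOn φ a b) {B : ℝ}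
    (hB : ∀ t ∈ Icc a b, ‖φ t‖ ≤ B) {s t : ℝ} (hs : s ∈ Icc a b) (ht : t ∈ Icc a b) :
    ‖y t - y s‖ ≤ B * |t - s| := by
  rw [h.eq_add hφ hs ht, add_sub_cancel_left]
  exact intervalIntegral.norm_integral_le_of_norm_le_const fun r hr =>
    hB r (uIcc_subset_Icc hs ht (uIoc_subset_uIcc hr))

theorem exists_lipschitzOnWith (h : IsPrimitiveOn y φ a b) (hφ : BddMeasOn φ a b) :
    ∃ K : ℝ≥0, LipschitzOnWith K y (Icc a b) := by
  obtain ⟨B, hB⟩ := hφ.2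
  refine ⟨B.toNNReal, LipschitzOnWith.of_dist_le_mul fun t ht s hs => ?_⟩
  rw [dist_eq_norm, Real.dist_eq]
  exact (h.norm_sub_le hφ hB hs ht).trans (by gcongr; exact Real.le_coe_toNNReal B)

theorem continuousOn (h : IsPrimitiveOn y φ a b) (hφ : BddMeasOn φ a b) :
    ContinuousOn y (Icc a b) :=
  (h.exists_lipschitzOnWith hφ).choose_spec.continuousOn

theorem ae_hasDerivAt [CompleteSpace X] (h : IsPrimitiveOn y φ a b) (hφ : BddMeasOn φ a b) :
    ∀ᵐ t, t ∈ Ioo a b → HasDerivAt y (φ t) t := by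
  rcases lt_or_ge b a with hab | hab
  · simp [Ioo_eq_empty_of_le hab.le]
  have ha : a ∈ Icc a b := ⟨le_rfl, hab⟩
  filter_upwards [(hφ.intervalIntegrable ha ⟨hab, le_rfl⟩).ae_hasDerivAt_integral] with t ht hts
  have h1 := (ht (by rw [uIcc_of_le hab]; exact Ioo_subset_Icc_self hts) a (by simp)).const_add (y a)
  refine h1.congr_of_eventuallyEq ?_
  filter_upwards [Icc_mem_nhds hts.1 hts.2] with s hs using h s hs

/-- Integrals ignore null sets. This is how an integrand containing the merely measurable control is
traded for a continuous one, after which the primitive is differentiable at every time. -/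
theorem congr_ae {φ' : ℝ → X} (h : IsPrimitiveOn y φ a b)
    (hφ : ∀ᵐ t, t ∈ Ioo a b → φ t = φ' t) : IsPrimitiveOn y φ' a b := fun t ht => by
  rw [h t ht]
  congr 1
  apply intervalIntegral.integral_congr_ae
  have hb : ∀ᵐ s : ℝ, s ≠ b := by simp [ae_iff, measure_singleton]
  filter_upwards [hφ, hb] with s hs hsb hst
  rw [uIoc_of_le ht.1] at hst
  exact hs ⟨hst.1, lt_of_le_of_ne (hst.2.trans ht.2) hsb⟩

/-- A primitive of a continuous function is differentiable everywhere. -/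
theorem hasDerivWithinAt [CompleteSpace X] (h : IsPrimitiveOn y φ a b)
    (hφ : ContinuousOn φ (Icc a b))
    {t : ℝ} (ht : t ∈ Icc a b) : HasDerivWithinAt y (φ t) (Icc a b) t := by
  have : Fact (t ∈ Icc a b) := ⟨ht⟩
  have ha : a ∈ Icc a b := ⟨le_rfl, ht.1.trans ht.2⟩
  have h1 : HasDerivWithinAt (fun s => ∫ r in a..s, φ r) (φ t) (Icc a b) t :=
    intervalIntegral.integral_hasDerivWithinAt_right
      ((BddMeasOn.of_continuousOn hφ).intervalIntegrable ha ht)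
      (hφ.stronglyMeasurableAtFilter_nhdsWithin measurableSet_Icc t) (hφ t ht)
  exact (h1.const_add (y a)).congr (fun s hs => h s hs) (h t ht)

end IsPrimitiveOn

theorem isPrimitiveOn_integral {X : Type*} [NormedAddCommGroup X] [NormedSpace ℝ X]
    (φ : ℝ → X) (a b : ℝ) : IsPrimitiveOn (fun t => ∫ s in a..t, φ s) φ a b := fun t _ => by simp

/-- A Lipschitz function with almost everywhere derivative `φ` is a primitive of `φ`. -/
theorem isPrimitiveOn_of_lipschitzOnWith {X : Type*} [NormedAddCommGroup X] [NormedSpace ℝ X]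
    [CompleteSpace X] {f φ : ℝ → X} {a b : ℝ} {K : ℝ≥0} (hf : LipschitzOnWith K f (Icc a b))
    (hφ : BddMeasOn φ a b) (hd : ∀ᵐ t, t ∈ Ioo a b → HasDerivAt f (φ t) t) :
    IsPrimitiveOn f φ a b := by
  intro t ht
  have hab : a ≤ b := ht.1.trans ht.2
  have h0 := isPrimitiveOn_integral φ a b
  obtain ⟨K', hK'⟩ := h0.exists_lipschitzOnWith hφ
  have hac : AbsolutelyContinuousOnInterval (fun t => f t - ∫ s in a..t, φ s) a b := by
    refine LipschitzOnWith.absolutelyContinuousOnInterval (K := K + K') ?_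
    rw [uIcc_of_le hab]
    exact hf.sub hK'
  have hna : ∀ᵐ s : ℝ, s ≠ a := by simp [ae_iff, measure_singleton]
  have hnb : ∀ᵐ s : ℝ, s ≠ b := by simp [ae_iff, measure_singleton]
  obtain ⟨C, hC⟩ := hac.const_of_ae_hasDerivAt_zero (by
    filter_upwards [hd, h0.ae_hasDerivAt hφ, hna, hnb] with s h1 h2 h3 h4 hs
    rw [uIcc_of_le hab] at hs
    have hs' : s ∈ Ioo a b := ⟨lt_of_le_of_ne hs.1 (Ne.symm h3), lt_of_le_of_ne hs.2 h4⟩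
    have h5 := (h1 hs').fun_sub (h2 hs')
    rwa [sub_self] at h5)
  rw [uIcc_of_le hab] at hC
  have h1 := hC t ht
  have h2 := hC a ⟨le_rfl, hab⟩
  simp only [intervalIntegral.integral_same, sub_zero] at h1 h2
  rw [h2, ← h1]
  abel

/-- Mean value inequality for real Lipschitz functions with almost everywhere bounded
derivative. -/
theorem abs_sub_le_of_ae_hasDerivAt {h : ℝ → ℝ} {a b C : ℝ} {K : ℝ≥0} (hab : a ≤ b)
    (hh : LipschitzOnWith K h (Icc a b))
    (hd : ∀ᵐ t, t ∈ Ioo a b → ∃ d, HasDerivAt h d t ∧ |d| ≤ C) : |h b - h a| ≤ C * (b - a) := by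
  have hac : AbsolutelyContinuousOnInterval h a b :=
    LipschitzOnWith.absolutelyContinuousOnInterval (K := K) (by rwa [uIcc_of_le hab])
  rw [← hac.integral_deriv_eq_sub, ← Real.norm_eq_abs, ← abs_of_nonneg (sub_nonneg.2 hab)]
  apply intervalIntegral.norm_integral_le_of_norm_le_const_ae
  have hnb : ∀ᵐ s : ℝ, s ≠ b := by simp [ae_iff, measure_singleton]
  filter_upwards [hd, hnb] with t ht htb hts
  rw [uIoc_of_le hab] at hts
  obtain ⟨d, h1, h2⟩ := ht ⟨hts.1, lt_of_le_of_ne hts.2 htb⟩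
  rwa [h1.deriv]

/-! ### Ordinary differential equations with measurable time dependence -/

section Caratheodory

variable {X Z : Type*} [NormedAddCommGroup X] [NormedSpace ℝ X] [ProperSpace X]
  [NormedAddCommGroup Z] [ProperSpace Z] {a b K R : ℝ} {G : X × Z → X} {c : ℝ → Z}

/-- Two solutions of an ordinary differential equation on a short interval. -/
theorem norm_sub_le_of_isPrimitiveOn (hG : Continuous G) (hc : BddMeasOn c a b)
    (hR : ∀ t ∈ Icc a b, ‖c t‖ ≤ R) (hK0 : 0 ≤ K)
    (hK : ∀ z, ‖z‖ ≤ R → ∀ y y', ‖G (y, z) - G (y', z)‖ ≤ K * ‖y - y'‖)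
    (hshort : K * (b - a) ≤ 1 / 2) {t₀ : ℝ} (ht₀ : t₀ ∈ Icc a b) {y y' : ℝ → X}
    (hyc : ContinuousOn y (Icc a b)) (hy'c : ContinuousOn y' (Icc a b))
    (hy : IsPrimitiveOn y (fun t => G (y t, c t)) a b)
    (hy' : IsPrimitiveOn y' (fun t => G (y' t, c t)) a b) {t : ℝ} (ht : t ∈ Icc a b) :
    ‖y t - y' t‖ ≤ 2 * ‖y t₀ - y' t₀‖ := by
  have hφ := ((BddMeasOn.of_continuousOn hyc).prodMk hc).comp hG
  have hφ' := ((BddMeasOn.of_continuousOn hy'c).prodMk hc).comp hG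
  -- At the maximum of the difference the integral term is at most half of that maximum, so it can
  -- be absorbed; on a short interval this replaces Gronwall's inequality.
  obtain ⟨s, hs, hmax⟩ := isCompact_Icc.exists_isMaxOn ⟨t₀, ht₀⟩ (hyc.sub hy'c).norm
  have hmax' : ∀ r ∈ Icc a b, ‖y r - y' r‖ ≤ ‖y s - y' s‖ := fun r hr => hmax hr
  have key : ‖y s - y' s‖ ≤ ‖y t₀ - y' t₀‖ + K * ‖y s - y' s‖ * |s - t₀| := by
    have e : y s - y' s = (y t₀ - y' t₀) + ∫ r in t₀..s, (G (y r, c r) - G (y' r, c r)) := by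
      rw [intervalIntegral.integral_sub (hφ.intervalIntegrable ht₀ hs)
        (hφ'.intervalIntegrable ht₀ hs), hy.eq_add hφ ht₀ hs, hy'.eq_add hφ' ht₀ hs]
      abel
    conv_lhs => rw [e]
    refine (norm_add_le _ _).trans ?_
    gcongr
    refine intervalIntegral.norm_integral_le_of_norm_le_const fun r hr => ?_
    have hr' := uIcc_subset_Icc ht₀ hs (uIoc_subset_uIcc hr)
    exact (hK _ (hR r hr') _ _).trans (by gcongr; exact hmax' r hr')
  have h2 : |s - t₀| ≤ b - a := by
    rw [abs_le]; constructor <;> linarith [hs.1, hs.2, ht₀.1, ht₀.2]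
  have h3 : K * ‖y s - y' s‖ * |s - t₀| ≤ 1 / 2 * ‖y s - y' s‖ := by
    calc K * ‖y s - y' s‖ * |s - t₀| ≤ K * ‖y s - y' s‖ * (b - a) := by gcongr
      _ = (K * (b - a)) * ‖y s - y' s‖ := by ring
      _ ≤ _ := by gcongr
  linarith [hmax' t ht]

/-- Existence of solutions of ordinary differential equations with measurable time dependence on
short intervals. -/
theorem exists_isPrimitiveOn (hG : Continuous G) (hc : BddMeasOn c a b)
    (hR : ∀ t ∈ Icc a b, ‖c t‖ ≤ R) (hK0 : 0 ≤ K)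
    (hK : ∀ z, ‖z‖ ≤ R → ∀ y y', ‖G (y, z) - G (y', z)‖ ≤ K * ‖y - y'‖)
    (hshort : K * (b - a) ≤ 1 / 2) {t₀ : ℝ} (ht₀ : t₀ ∈ Icc a b) (w : X) :
    ∃ y : ℝ → X, Continuous y ∧ y t₀ = w ∧ IsPrimitiveOn y (fun t => G (y t, c t)) a b := by
  have hab : a ≤ b := ht₀.1.trans ht₀.2
  have hφ : ∀ y : C(Icc a b, X), BddMeasOn (fun s => G (IccExtend hab y s, c s)) a b := fun y =>
    ((BddMeasOn.of_continuousOn (y.continuous.Icc_extend' (h := hab)).continuousOn).prodMk hc).comp hG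
  have hcont : ∀ y : C(Icc a b, X),
      Continuous fun t : Icc a b => w + ∫ s in t₀..t, G (IccExtend hab y s, c s) := fun y => by
    refine continuous_const.add ?_
    have h1 := ((isPrimitiveOn_integral (fun s => G (IccExtend hab y s, c s)) a b).continuousOn
      (hφ y)).domRestrict
    have h2 : (fun t : Icc a b => ∫ s in t₀..t, G (IccExtend hab y s, c s)) = fun t : Icc a b =>
        (∫ s in a..t, G (IccExtend hab y s, c s)) - ∫ s in a..t₀, G (IccExtend hab y s, c s) := by
      funext t
      rw [← intervalIntegral.integral_interval_sub_left
        ((hφ y).intervalIntegrable ⟨le_rfl, hab⟩ t.2)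
        ((hφ y).intervalIntegrable ⟨le_rfl, hab⟩ ht₀)]
    rw [h2]
    exact h1.sub continuous_const
  let T : C(Icc a b, X) → C(Icc a b, X) := fun y => ⟨_, hcont y⟩
  -- The Picard operator contracts by `1 / 2` in the sup norm because `K * (b - a) ≤ 1 / 2`.
  have hT : ContractingWith (1 / 2) T := by
    refine ⟨by rw [← NNReal.coe_lt_coe]; norm_num, LipschitzWith.of_dist_le_mul fun y y' => ?_⟩
    rw [ContinuousMap.dist_le (by positivity)]
    intro t
    have e : T y t - T y' t = ∫ s in t₀..t, (G (IccExtend hab y s, c s) -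
        G (IccExtend hab y' s, c s)) := by
      rw [intervalIntegral.integral_sub ((hφ y).intervalIntegrable ht₀ t.2)
        ((hφ y').intervalIntegrable ht₀ t.2)]
      simp [T]
    rw [dist_eq_norm, e]
    have h2 : |(t : ℝ) - t₀| ≤ b - a := by
      rw [abs_le]; constructor <;> linarith [t.2.1, t.2.2, ht₀.1, ht₀.2]
    calc _ ≤ K * dist y y' * |(t : ℝ) - t₀| := by
          refine intervalIntegral.norm_integral_le_of_norm_le_const fun r hr => ?_
          have hr' := uIcc_subset_Icc ht₀ t.2 (uIoc_subset_uIcc hr)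
          refine (hK _ (hR r hr') _ _).trans ?_
          gcongr
          rw [IccExtend_of_mem hab _ hr', IccExtend_of_mem hab _ hr', ← dist_eq_norm]
          exact ContinuousMap.dist_apply_le_dist _
      _ ≤ K * dist y y' * (b - a) := by gcongr
      _ = (K * (b - a)) * dist y y' := by ring
      _ ≤ _ := by
          refine (mul_le_mul_of_nonneg_right hshort dist_nonneg).trans ?_
          simp
  have hne : Nonempty C(Icc a b, X) := ⟨ContinuousMap.const _ 0⟩
  let y := ContractingWith.fixedPoint T hT
  have hy : T y = y := ContractingWith.fixedPoint_isFixedPt hT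
  have hy' : ∀ t ∈ Icc a b, IccExtend hab y t = w + ∫ s in t₀..t, G (IccExtend hab y s, c s) := by
    intro t ht
    rw [IccExtend_of_mem hab _ ht]
    conv_lhs => rw [← hy]
    rfl
  have ha : a ∈ Icc a b := ⟨le_rfl, hab⟩
  refine ⟨IccExtend hab y, y.continuous.Icc_extend', by simp [hy' t₀ ht₀], fun t ht => ?_⟩
  rw [hy' t ht, hy' a ha, add_assoc, intervalIntegral.integral_add_adjacent_intervals
    ((hφ y).intervalIntegrable ht₀ ha) ((hφ y).intervalIntegrable ha ht)]

end Caratheodory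

end OptimalControl

/-! ### The adjoint equation and transport of derivatives -/

namespace OptimalControl

/-- A `C¹` map is differentiable uniformly on compact sets. -/
theorem exists_forall_norm_sub_fderiv_le {V G : Type*} [NormedAddCommGroup V] [NormedSpace ℝ V]
    [NormedAddCommGroup G] [NormedSpace ℝ G] {g : V → G} (hg : ContDiff ℝ 1 g) {S : Set V}
    (hS : IsCompact S) {ε : ℝ} (hε : 0 < ε) :
    ∃ δ > 0, ∀ z ∈ S, ∀ z', ‖z' - z‖ < δ →
      ‖g z' - g z - fderiv ℝ g z (z' - z)‖ ≤ ε * ‖z' - z‖ := by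
  have hc : Continuous (fderiv ℝ g) := hg.continuous_fderiv one_ne_zero
  have h1 := hS.uniformContinuousAt_of_continuousAt (fderiv ℝ g) (fun z _ => hc.continuousAt)
    (Metric.dist_mem_uniformity hε)
  obtain ⟨δ, hδ, h2⟩ := Metric.mem_uniformity_dist.1 h1
  refine ⟨δ, hδ, fun z hz z' hz' => ?_⟩
  refine (convex_ball z δ).norm_image_sub_le_of_norm_hasFDerivWithin_le' (f' := fderiv ℝ g)
    (fun y _ => ((hg.differentiable one_ne_zero) y).hasFDerivAt.hasFDerivWithinAt)
    (fun y hy => ?_) (Metric.mem_ball_self hδ) (by rwa [Metric.mem_ball, dist_eq_norm])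
  have h3 := h2 (a := z) (b := y) (by rwa [dist_comm]) hz
  rw [← dist_eq_norm, dist_comm]
  exact le_of_lt h3

section Adjoint

variable {E U : Type*} [NormedAddCommGroup E] [NormedSpace ℝ E] [NormedAddCommGroup U]
  [NormedSpace ℝ U]

/-- The right-hand side `-p ∘ D_y F + D_y l` of the adjoint equation of a control system. -/
noncomputable def adjointField (F : E × U → E) (l : E × U → ℝ)
    (q : (E →L[ℝ] ℝ) × (E × U)) : E →L[ℝ] ℝ :=
  fderiv ℝ l q.2 ∘L ContinuousLinearMap.inl ℝ E U -
    q.1 ∘L (fderiv ℝ F q.2 ∘L ContinuousLinearMap.inl ℝ E U)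

theorem continuous_adjointField {F : E × U → E} {l : E × U → ℝ} (hF : ContDiff ℝ 1 F)
    (hl : ContDiff ℝ 1 l) : Continuous (adjointField F l) := by
  have hF' := hF.continuous_fderiv one_ne_zero
  have hl' := hl.continuous_fderiv one_ne_zero
  unfold adjointField
  fun_prop

theorem norm_fderiv_comp_inl_le {F : E × U → E} {K : ℝ} (hK0 : 0 ≤ K) {v : U} (hF : ContDiff ℝ 1 F)
    (hK : ∀ y y', ‖F (y, v) - F (y', v)‖ ≤ K * ‖y - y'‖) (y : E) :
    ‖fderiv ℝ F (y, v) ∘L ContinuousLinearMap.inl ℝ E U‖ ≤ K := by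
  have h1 : HasFDerivAt (fun y => F (y, v)) (fderiv ℝ F (y, v) ∘L ContinuousLinearMap.inl ℝ E U) y :=
    ((hF.differentiable one_ne_zero) (y, v)).hasFDerivAt.comp y (hasFDerivAt_prodMk_left y v)
  have h2 : LipschitzWith K.toNNReal (fun y => F (y, v)) := LipschitzWith.of_dist_le_mul fun y y' => by
    rw [dist_eq_norm, dist_eq_norm, Real.coe_toNNReal K hK0]
    exact hK y y'
  simpa [Real.coe_toNNReal K hK0] using h1.le_of_lipschitz h2

/-- The adjoint field is affine in `p`, with linear part bounded by the Lipschitz constant of `F`.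
The same shortness condition therefore serves both the control system and its adjoint equation. -/
theorem norm_adjointField_sub_le {F : E × U → E} {l : E × U → ℝ} {K : ℝ} (hK0 : 0 ≤ K) {v : U}
    (hF : ContDiff ℝ 1 F) (hK : ∀ y y', ‖F (y, v) - F (y', v)‖ ≤ K * ‖y - y'‖) (y : E)
    (p p' : E →L[ℝ] ℝ) :
    ‖adjointField F l (p, (y, v)) - adjointField F l (p', (y, v))‖ ≤ K * ‖p - p'‖ := by
  have e : adjointField F l (p, (y, v)) - adjointField F l (p', (y, v)) =
      -((p - p') ∘L (fderiv ℝ F (y, v) ∘L ContinuousLinearMap.inl ℝ E U)) := by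
    ext; simp [adjointField]
  rw [e, norm_neg, mul_comm]
  exact (ContinuousLinearMap.opNorm_comp_le _ _).trans
    (by gcongr; exact norm_fderiv_comp_inl_le hK0 hF hK y)

end Adjoint

/-- Both factors are bounded on a compact interval, so their pairing is again Lipschitz. This makes
`abs_sub_le_of_ae_hasDerivAt` applicable to a covector curve paired with the deviation of two paths.
-/
theorem exists_lipschitzOnWith_apply {E : Type*} [NormedAddCommGroup E] [NormedSpace ℝ E]
    {p : ℝ → E →L[ℝ] ℝ} {e : ℝ → E} {a b : ℝ} {K K' : ℝ≥0} (hp : LipschitzOnWith K p (Icc a b))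
    (he : LipschitzOnWith K' e (Icc a b)) :
    ∃ K'' : ℝ≥0, LipschitzOnWith K'' (fun t => p t (e t)) (Icc a b) := by
  obtain ⟨A, hA⟩ := isCompact_Icc.exists_bound_of_continuousOn hp.continuousOn
  obtain ⟨B, hB⟩ := isCompact_Icc.exists_bound_of_continuousOn he.continuousOn
  refine ⟨(K * |B| + |A| * K').toNNReal, LipschitzOnWith.of_dist_le_mul fun t ht s hs => ?_⟩
  rw [Real.coe_toNNReal _ (by positivity), dist_eq_norm]
  have e1 : p t (e t) - p s (e s) = (p t - p s) (e t) + p s (e t - e s) := by simp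
  have h1 := hp.dist_le_mul t ht s hs
  have h2 := he.dist_le_mul t ht s hs
  rw [dist_eq_norm] at h1 h2
  rw [e1]
  calc _ ≤ ‖(p t - p s) (e t)‖ + ‖p s (e t - e s)‖ := norm_add_le _ _
    _ ≤ ‖p t - p s‖ * ‖e t‖ + ‖p s‖ * ‖e t - e s‖ := by
        gcongr <;> exact ContinuousLinearMap.le_opNorm _ _
    _ ≤ (K * dist t s) * |B| + |A| * (K' * dist t s) := by
        gcongr
        · exact (hB t ht).trans (le_abs_self _)
        · exact (hA s hs).trans (le_abs_self _)
    _ = _ := by ring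

section Transport

variable {E U : Type*} [NormedAddCommGroup E] [NormedSpace ℝ E] [ProperSpace E]
  [FiniteDimensional ℝ E] [NormedAddCommGroup U] [NormedSpace ℝ U] [ProperSpace U]
  {F : E × U → E} {l : E × U → ℝ} {a b K R : ℝ} {u : ℝ → U} {x : ℝ → E} {p : ℝ → E →L[ℝ] ℝ}

/-- A derivative `-p(a)` of a value function is transported backwards by the control system to
`-p(b)` along a solution `p` of the adjoint equation. -/
theorem hasFDerivAt_transport (hF : ContDiff ℝ 1 F) (hl : ContDiff ℝ 1 l) (hab : a ≤ b)
    (hu : BddMeasOn u a b) (hR : ∀ t ∈ Icc a b, ‖u t‖ ≤ R) (hK0 : 0 ≤ K)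
    (hK : ∀ v, ‖v‖ ≤ R → ∀ y y', ‖F (y, v) - F (y', v)‖ ≤ K * ‖y - y'‖)
    (hshort : K * (b - a) ≤ 1 / 2) (hxc : ContinuousOn x (Icc a b))
    (hx : IsPrimitiveOn x (fun t => F (x t, u t)) a b) (hpc : ContinuousOn p (Icc a b))
    (hp : IsPrimitiveOn p (fun t => adjointField F l (p t, (x t, u t))) a b)
    {Y : E → ℝ → E} (hYc : ∀ w, Continuous (Y w)) (hYb : ∀ w, Y w b = w)
    (hY : ∀ w, IsPrimitiveOn (Y w) (fun s => F (Y w s, u s)) a b) {ψ : E → ℝ}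
    (hψ : HasFDerivAt ψ (-(p a)) (x a)) :
    HasFDerivAt (fun w => ψ (Y w a) - ∫ s in a..b, l (Y w s, u s)) (-(p b)) (x b) := by
  have hb : b ∈ Icc a b := ⟨hab, le_rfl⟩
  have ha : a ∈ Icc a b := ⟨le_rfl, hab⟩
  have hYcl : ∀ w, ∀ t ∈ Icc a b, ‖Y w t - x t‖ ≤ 2 * ‖w - x b‖ := fun w t ht => by
    have := norm_sub_le_of_isPrimitiveOn (G := F) hF.continuous hu hR hK0 hK hshort hb
      (hYc w).continuousOn hxc (hY w) hx ht
    rwa [hYb] at this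
  have hYx : ∀ t ∈ Icc a b, Y (x b) t = x t := fun t ht => by
    have := hYcl (x b) t ht
    simpa [sub_eq_zero] using this
  have hxu : BddMeasOn (fun t => (x t, u t)) a b := (BddMeasOn.of_continuousOn hxc).prodMk hu
  have hYu : ∀ w, BddMeasOn (fun t => (Y w t, u t)) a b := fun w =>
    (BddMeasOn.of_continuousOn (hYc w).continuousOn).prodMk hu
  obtain ⟨Q, hQ⟩ := hxu.2
  obtain ⟨B, hB⟩ := isCompact_Icc.exists_bound_of_continuousOn hpc
  have hB0 : 0 ≤ B := (norm_nonneg _).trans (hB a ha)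
  obtain ⟨Kx, hKx⟩ := hx.exists_lipschitzOnWith (hxu.comp hF.continuous)
  have hpb : BddMeasOn (fun t => adjointField F l (p t, (x t, u t))) a b :=
    ((BddMeasOn.of_continuousOn hpc).prodMk hxu).comp (continuous_adjointField hF hl)
  obtain ⟨Kp, hKp⟩ := hp.exists_lipschitzOnWith hpb
  rw [hasFDerivAt_iff_isLittleO]
  refine Asymptotics.IsLittleO.of_bound fun c hc => ?_
  -- With this value the remainders of `F` and `l` contribute at most `c / 2` per unit of `‖w - x
  -- b‖`; the remainder of `ψ` contributes the other half. The summand `1` in `b - a + 1` covers `a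
  -- = b`.
  have hη : 0 < c / (4 * (B + 1) * (b - a + 1)) := by
    have : 0 < b - a + 1 := by linarith
    positivity
  set η := c / (4 * (B + 1) * (b - a + 1)) with hηdef
  obtain ⟨δ, hδ, hδF⟩ := exists_forall_norm_sub_fderiv_le hF (isCompact_closedBall (0 : E × U) Q) hη
  obtain ⟨δ', hδ', hδl⟩ := exists_forall_norm_sub_fderiv_le hl (isCompact_closedBall (0 : E × U) Q) hη
  have htend : Tendsto (fun w => Y w a) (𝓝 (x b)) (𝓝 (x a)) := by
    rw [tendsto_iff_norm_sub_tendsto_zero]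
    refine squeeze_zero (fun _ => norm_nonneg _) (fun w => hYcl w a ha) ?_
    have : Tendsto (fun w => 2 * ‖w - x b‖) (𝓝 (x b)) (𝓝 (2 * ‖x b - x b‖)) := by
      apply Continuous.tendsto; fun_prop
    simpa using this
  have hψ' := htend.eventually ((hasFDerivAt_iff_isLittleO.1 hψ).def (show 0 < c / 4 by positivity))
  -- The radius is halved because `Y w` may deviate from `x` by twice `‖w - x b‖`.
  filter_upwards [hψ', Metric.ball_mem_nhds (x b) (show 0 < min δ δ' / 2 by positivity)] with w h1 hw
  rw [Metric.mem_ball, dist_eq_norm] at hw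
  have hnear : ∀ t ∈ Icc a b, ‖Y w t - x t‖ < δ ∧ ‖Y w t - x t‖ < δ' := fun t ht => by
    have := hYcl w t ht
    constructor <;> linarith [min_le_left δ δ', min_le_right δ δ']
  obtain ⟨Ky, hKy⟩ := (hY w).exists_lipschitzOnWith ((hYu w).comp hF.continuous)
  have hlY := (hYu w).comp hl.continuous
  have hlx := hxu.comp hl.continuous
  obtain ⟨K1, hK1⟩ := exists_lipschitzOnWith_apply hKp (hKy.sub hKx)
  obtain ⟨K2, hK2⟩ := (isPrimitiveOn_integral (fun s => l (Y w s, u s)) a b).exists_lipschitzOnWith hlY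
  obtain ⟨K3, hK3⟩ := (isPrimitiveOn_integral (fun s => l (x s, u s)) a b).exists_lipschitzOnWith hlx
  have key := abs_sub_le_of_ae_hasDerivAt (h := fun r => p r (Y w r - x r) -
      ((∫ s in a..r, l (Y w s, u s)) - ∫ s in a..r, l (x s, u s)))
      (C := (B + 1) * (η * (2 * ‖w - x b‖))) hab (hK1.sub (hK2.sub hK3)) (by
    filter_upwards [(hY w).ae_hasDerivAt ((hYu w).comp hF.continuous),
      hx.ae_hasDerivAt (hxu.comp hF.continuous), hp.ae_hasDerivAt hpb,
      (isPrimitiveOn_integral (fun s => l (Y w s, u s)) a b).ae_hasDerivAt hlY,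
      (isPrimitiveOn_integral (fun s => l (x s, u s)) a b).ae_hasDerivAt hlx] with t h1 h2 h3 h4 h5 ht
    have ht' : t ∈ Icc a b := Ioo_subset_Icc_self ht
    refine ⟨_, ((h3 ht).clm_apply ((h1 ht).sub (h2 ht))).fun_sub ((h4 ht).fun_sub (h5 ht)), ?_⟩
    have hz : (x t, u t) ∈ Metric.closedBall (0 : E × U) Q := by simpa using hQ t ht'
    have e0 : (Y w t, u t) - (x t, u t) = (Y w t - x t, (0 : U)) := by simp
    have n0 : ‖(Y w t, u t) - (x t, u t)‖ = ‖Y w t - x t‖ := by rw [e0]; simp [Prod.norm_def]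
    have hF1 := hδF _ hz (Y w t, u t) (by rw [n0]; exact (hnear t ht').1)
    have hl1 := hδl _ hz (Y w t, u t) (by rw [n0]; exact (hnear t ht').2)
    rw [n0, e0] at hF1 hl1
    -- The adjoint equation is designed for this cancellation: the terms linear in `Y w t - x t`
    -- drop out and only the Taylor remainders of `F` and `l` survive.
    have e1 : adjointField F l (p t, x t, u t) ((Y w - x) t) + p t (F (Y w t, u t) - F (x t, u t)) -
        (l (Y w t, u t) - l (x t, u t)) =
        p t (F (Y w t, u t) - F (x t, u t) - fderiv ℝ F (x t, u t) (Y w t - x t, 0)) -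
        (l (Y w t, u t) - l (x t, u t) - fderiv ℝ l (x t, u t) (Y w t - x t, 0)) := by
      simp only [adjointField, sub_apply, ContinuousLinearMap.comp_apply,
        ContinuousLinearMap.inl_apply, Pi.sub_apply]
      rw [map_sub (p t) (F (Y w t, u t) - F (x t, u t))]
      ring
    rw [e1]
    have h6 := hYcl w t ht'
    calc _ ≤ ‖p t (F (Y w t, u t) - F (x t, u t) - fderiv ℝ F (x t, u t) (Y w t - x t, 0))‖ +
          ‖(l (Y w t, u t) - l (x t, u t) - fderiv ℝ l (x t, u t) (Y w t - x t, 0))‖ :=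
          norm_sub_le _ _
      _ ≤ B * (η * (2 * ‖w - x b‖)) + η * (2 * ‖w - x b‖) := by
          gcongr
          · refine (ContinuousLinearMap.le_opNorm _ _).trans ?_
            gcongr
            · exact hB t ht'
            · exact hF1.trans (by gcongr)
          · exact hl1.trans (by gcongr)
      _ = _ := by ring)
  have hI : ∫ s in a..b, l (Y (x b) s, u s) = ∫ s in a..b, l (x s, u s) :=
    intervalIntegral.integral_congr fun s hs => by
      rw [uIcc_of_le hab] at hs
      rw [hYx s hs]
  simp only [hYb, intervalIntegral.integral_same, sub_zero] at key
  rw [hYx a ha, hI]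
  have e2 : ψ (Y w a) - (∫ s in a..b, l (Y w s, u s)) - (ψ (x a) - ∫ s in a..b, l (x s, u s)) -
      (-(p b)) (w - x b) = (ψ (Y w a) - ψ (x a) - (-(p a)) (Y w a - x a)) +
      (p b (w - x b) - ((∫ s in a..b, l (Y w s, u s)) - ∫ s in a..b, l (x s, u s)) -
        p a (Y w a - x a)) := by
    simp only [neg_apply]; ring
  rw [e2]
  have hw0 := norm_nonneg (w - x b)
  calc _ ≤ ‖ψ (Y w a) - ψ (x a) - (-(p a)) (Y w a - x a)‖ + _ := norm_add_le _ _
    _ ≤ c / 4 * (2 * ‖w - x b‖) + (B + 1) * (η * (2 * ‖w - x b‖)) * (b - a) := by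
        gcongr
        · exact h1.trans (by gcongr; exact hYcl w a ha)
        · exact key
    _ ≤ c / 4 * (2 * ‖w - x b‖) + (B + 1) * (η * (2 * ‖w - x b‖)) * (b - a + 1) := by
        gcongr; linarith
    _ = c * ‖w - x b‖ := by
        have : 0 < b - a + 1 := by linarith
        rw [hηdef]; field_simp; ring

end Transport

end OptimalControl

/-! ### Needle variations and the maximality condition -/

namespace OptimalControl

/-- On an interval of length `h` all values `Z h r` are close to `x₀`, so the integrand differs from
`φ x₀` by less than any prescribed constant. -/
theorem isLittleO_integral_sub_smul {E G : Type*} [NormedAddCommGroup E] [NormedAddCommGroup G]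
    [NormedSpace ℝ G] [CompleteSpace G] {φ : E → G} (hφ : Continuous φ) {Z : ℝ → ℝ → E}
    {s : ℝ} {x₀ : E} (hZc : ∀ᶠ h in 𝓝[>] (0 : ℝ), Continuous (Z h))
    (hZ : ∀ δ > 0, ∀ᶠ h in 𝓝[>] (0 : ℝ), ∀ r ∈ Icc s (s + h), ‖Z h r - x₀‖ < δ) :
    (fun h => (∫ r in s..(s + h), φ (Z h r)) - h • φ x₀) =o[𝓝[>] 0] (fun h : ℝ => h) := by
  refine Asymptotics.IsLittleO.of_bound fun c hc => ?_
  obtain ⟨δ, hδ, h1⟩ := Metric.continuousAt_iff.1 (hφ.continuousAt (x := x₀)) c hc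
  filter_upwards [hZ δ hδ, hZc, self_mem_nhdsWithin] with h h2 h3 (h4 : 0 < h)
  have e : (∫ r in s..(s + h), φ (Z h r)) - h • φ x₀ = ∫ r in s..(s + h), (φ (Z h r) - φ x₀) := by
    have h6 : Continuous fun r => φ (Z h r) := hφ.comp h3
    rw [intervalIntegral.integral_sub (h6.intervalIntegrable _ _) intervalIntegrable_const]
    simp
  rw [e]
  have h5 : ‖∫ r in s..(s + h), (φ (Z h r) - φ x₀)‖ ≤ c * |s + h - s| := by
    refine intervalIntegral.norm_integral_le_of_norm_le_const fun r hr => ?_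
    rw [uIoc_of_le (by linarith)] at hr
    have := h1 (x := Z h r) (by rw [dist_eq_norm]; exact h2 r ⟨hr.1.le, hr.2⟩)
    rw [dist_eq_norm] at this
    exact this.le
  simpa using h5

section Needle

variable {E U : Type*} [NormedAddCommGroup E] [NormedSpace ℝ E] [ProperSpace E]
  [NormedAddCommGroup U]

/-- The maximality condition of the Pontryagin principle, obtained from needle variations which
keep the right end point fixed. -/
theorem maximality_of_needle {F : E × U → E} {l : E × U → ℝ} (hF : Continuous F)
    (hl : Continuous l) {v : U} {K B : ℝ} (hK0 : 0 ≤ K)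
    (hK : ∀ y y', ‖F (y, v) - F (y', v)‖ ≤ K * ‖y - y'‖) (hB : ∀ y, ‖F (y, v)‖ ≤ B)
    {x : ℝ → E} {s : ℝ} {f₀ : E} {l₀ : ℝ} {J : ℝ → ℝ} (hx : HasDerivAt x f₀ s)
    (hJ : HasDerivAt J l₀ s) {ψ : E → ℝ} {q : E →L[ℝ] ℝ} (hψ : HasFDerivAt ψ (-q) (x s))
    {ρ : ℝ} (hρ : 0 < ρ)
    (H : ∀ᶠ h in 𝓝[>] (0 : ℝ), ∀ z : ℝ → E, Continuous z → z (s + h) = x (s + h) →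
      IsPrimitiveOn z (fun r => F (z r, v)) s (s + h) → (∀ r ∈ Icc s (s + h), ‖z r - x s‖ < ρ) →
      ψ (z s) - ψ (x s) ≤ (∫ r in s..(s + h), l (z r, v)) - (J (s + h) - J s)) :
    q (F (x s, v)) - l (x s, v) ≤ q f₀ - l₀ := by
  have hB0 : 0 ≤ B := (norm_nonneg _).trans (hB 0)
  have hFv : Continuous fun y => F (y, v) := by fun_prop
  have hlv : Continuous fun y => l (y, v) := by fun_prop
  -- The needle is solved backwards from `x (s + h)`, so it rejoins the path at its right end and
  -- displaces the left one. For other `h` an irrelevant value is taken, so that `Z` is defined for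
  -- all `h`.
  have hex : ∀ h : ℝ, ∃ z : ℝ → E, 0 < h → K * h ≤ 1 / 2 → Continuous z ∧ z (s + h) = x (s + h) ∧
      IsPrimitiveOn z (fun r => F (z r, v)) s (s + h) := by
    intro h
    by_cases hh : 0 < h ∧ K * h ≤ 1 / 2
    -- The control is frozen at `v`, so the time-dependent parameter is the dummy constant `0`.
    · obtain ⟨z, h1⟩ := exists_isPrimitiveOn (G := fun q : E × ℝ => F (q.1, v)) (a := s) (b := s + h)
        (c := fun _ => 0) (R := 0) (K := K) (t₀ := s + h) (by fun_prop)
        (BddMeasOn.of_continuousOn continuousOn_const) (by simp) hK0 (fun _ _ => hK)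
        (by simpa using hh.2) ⟨by linarith [hh.1], le_rfl⟩ (x (s + h))
      exact ⟨z, fun _ _ => h1⟩
    · exact ⟨0, fun h1 h2 => absurd ⟨h1, h2⟩ hh⟩
  choose Z hZ using hex
  have hsmall : ∀ᶠ h in 𝓝[>] (0 : ℝ), 0 < h ∧ K * h ≤ 1 / 2 := by
    have h1 : ∀ᶠ h in 𝓝 (0 : ℝ), K * h < 1 / 2 := by
      have : Tendsto (fun h : ℝ => K * h) (𝓝 0) (𝓝 (K * 0)) := by
        apply Continuous.tendsto; fun_prop
      exact this.eventually_lt_const (by norm_num)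
    filter_upwards [nhdsWithin_le_nhds h1, self_mem_nhdsWithin] with h h2 h3 using ⟨h3, h2.le⟩
  have hxo := (hasDerivAt_iff_isLittleO_nhds_zero.1 hx).mono (nhdsWithin_le_nhds (s := Ioi (0 : ℝ)))
  have hJo := (hasDerivAt_iff_isLittleO_nhds_zero.1 hJ).mono (nhdsWithin_le_nhds (s := Ioi (0 : ℝ)))
  have hZb : ∀ δ > 0, ∀ᶠ h in 𝓝[>] (0 : ℝ), ∀ r ∈ Icc s (s + h), ‖Z h r - x s‖ < δ := by
    intro δ hδ
    have ht : Tendsto (fun h : ℝ => B * h + ‖x (s + h) - x s‖) (𝓝 0) (𝓝 0) := by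
      have h1 : Tendsto (fun h : ℝ => x (s + h)) (𝓝 0) (𝓝 (x s)) := by
        have h2 : Tendsto (fun h : ℝ => s + h) (𝓝 0) (𝓝 s) := by
          simpa using (continuous_const_add s).tendsto 0
        exact hx.continuousAt.tendsto.comp h2
      have h3 : Tendsto (fun h : ℝ => B * h) (𝓝 0) (𝓝 (B * 0)) := by
        apply Continuous.tendsto; fun_prop
      simpa using h3.add (tendsto_iff_norm_sub_tendsto_zero.1 h1)
    filter_upwards [hsmall, nhdsWithin_le_nhds (ht.eventually_lt_const hδ)] with h h1 h2 r hr
    obtain ⟨hzc, hze, hzp⟩ := hZ h h1.1 h1.2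
    have hbm : BddMeasOn (fun r => F (Z h r, v)) s (s + h) :=
      BddMeasOn.of_continuousOn (hFv.comp hzc).continuousOn
    have h3 := hzp.norm_sub_le hbm (fun t _ => hB _) (s := s + h) (t := r)
      ⟨by linarith [h1.1], le_rfl⟩ hr
    rw [hze] at h3
    have h4 : |r - (s + h)| ≤ h := by rw [abs_le]; constructor <;> linarith [hr.1, hr.2, h1.1]
    calc ‖Z h r - x s‖ ≤ ‖Z h r - x (s + h)‖ + ‖x (s + h) - x s‖ := norm_sub_le_norm_sub_add_norm_sub _ _ _
      _ ≤ B * h + ‖x (s + h) - x s‖ := by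
        gcongr; exact h3.trans (by gcongr)
      _ < δ := h2
  have hZc : ∀ᶠ h in 𝓝[>] (0 : ℝ), Continuous (Z h) :=
    hsmall.mono fun h h1 => (hZ h h1.1 h1.2).1
  have a1 := isLittleO_integral_sub_smul hFv hZc hZb
  have a2 := isLittleO_integral_sub_smul hlv hZc hZb
  -- Going forward along `x` with velocity `f₀` and back with velocity `F (x s, v)` displaces the
  -- start by `h • (f₀ - F (x s, v))` to first order.
  have e1 : (fun h => Z h s - x s - h • (f₀ - F (x s, v))) =o[𝓝[>] 0] (fun h : ℝ => h) := by
    refine (hxo.sub a1).congr' ?_ EventuallyEq.rfl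
    filter_upwards [hsmall] with h h1
    obtain ⟨-, hze, hzp⟩ := hZ h h1.1 h1.2
    have h2 := hzp (s + h) ⟨by linarith [h1.1], le_rfl⟩
    rw [← hze, h2, smul_sub]
    abel
  have e1' : (fun h => Z h s - x s) =O[𝓝[>] 0] (fun h : ℝ => h) := by
    have h2 : (fun h : ℝ => h • (f₀ - F (x s, v))) =O[𝓝[>] 0] (fun h : ℝ => h) := by
      refine Asymptotics.IsBigO.of_bound ‖f₀ - F (x s, v)‖ (Eventually.of_forall fun h => ?_)
      rw [norm_smul, mul_comm]
    simpa using e1.isBigO.add h2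
  have hZs : Tendsto (fun h => Z h s) (𝓝[>] 0) (𝓝 (x s)) := by
    rw [Metric.tendsto_nhds]
    intro δ hδ
    filter_upwards [hZb δ hδ, hsmall] with h h1 h2
    rw [dist_eq_norm]
    exact h1 s ⟨le_rfl, by linarith [h2.1]⟩
  have e4 := ((hasFDerivAt_iff_isLittleO.1 hψ).comp_tendsto hZs).trans_isBigO e1'
  have e5 : (fun h => q (Z h s - x s - h • (f₀ - F (x s, v)))) =o[𝓝[>] 0] (fun h : ℝ => h) :=
    (q.isBigO_comp _ _).trans_isLittleO e1
  -- The terms combine to say that the slack in the inequality of `H` equals `A * h + o(h)`, with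
  -- `A` as set below. Slack is nonnegative, so `A < 0` is impossible.
  have D := ((a2.sub hJo).sub e4).add e5
  by_contra hcon
  push Not at hcon
  set A := l (x s, v) - l₀ + q (f₀ - F (x s, v)) with hA
  have hA0 : A < 0 := by rw [hA, map_sub]; linarith
  obtain ⟨h, hD, hH, hs⟩ := ((D.def (show 0 < -A / 2 by linarith)).and (H.and (hsmall.and (hZb ρ hρ)))).exists
  obtain ⟨hzc, hze, hzp⟩ := hZ h hs.1.1 hs.1.2
  have h1 := hH (Z h) hzc hze hzp hs.2
  have h2 := hs.1.1
  simp only [smul_eq_mul, Function.comp_apply, neg_apply, Real.norm_eq_abs, abs_of_pos h2,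
    map_sub, map_smul] at hD
  rw [map_sub] at hA
  have h3 := (abs_le.1 hD).1
  have h4 := (abs_le.1 hD).2
  have h5 : A * h < 0 := mul_neg_of_neg_of_pos hA0 h2
  have h6 : A * h = l (x s, v) * h - l₀ * h + (q f₀ - q (F (x s, v))) * h := by rw [hA]; ring
  linarith

end Needle

/-! ### From maximality to Hamilton's equations -/

section Hamiltonian

variable {E U : Type*} [NormedAddCommGroup E] [NormedSpace ℝ E]
  [NormedAddCommGroup U] [NormedSpace ℝ U]
  {F : E × U → E} {l : E × U → ℝ} {Hc : E × (E →L[ℝ] ℝ) → ℝ}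

/-- Envelope argument: with the control frozen at `v`, the gap between `Hc` and the pre-Hamiltonian
is nonnegative near `(y, p)` and zero there, so its derivative vanishes. No regularity of a
maximizing control in `(y, p)` is required. -/
theorem fderiv_eq_of_maximality (hF : ContDiff ℝ 1 F) (hl : ContDiff ℝ 1 l) {y : E}
    {p : E →L[ℝ] ℝ} {v : U} (hd : DifferentiableAt ℝ Hc (y, p))
    (hle : ∀ᶠ z in 𝓝 (y, p), z.2 (F (z.1, v)) - l (z.1, v) ≤ Hc z)
    (heq : Hc (y, p) = p (F (y, v)) - l (y, v)) (w : E) (π : E →L[ℝ] ℝ) :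
    fderiv ℝ Hc (y, p) (w, π) = π (F (y, v)) - adjointField F l (p, (y, v)) w := by
  have hF1 : HasFDerivAt (fun z : E × (E →L[ℝ] ℝ) => F (z.1, v))
      ((fderiv ℝ F (y, v) ∘L ContinuousLinearMap.inl ℝ E U) ∘L
        ContinuousLinearMap.fst ℝ E (E →L[ℝ] ℝ)) (y, p) :=
    HasFDerivAt.comp (y, p) (g := fun y => F (y, v))
      (((hF.differentiable one_ne_zero) (y, v)).hasFDerivAt.comp y (hasFDerivAt_prodMk_left y v))
      hasFDerivAt_fst
  have hl1 : HasFDerivAt (fun z : E × (E →L[ℝ] ℝ) => l (z.1, v))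
      ((fderiv ℝ l (y, v) ∘L ContinuousLinearMap.inl ℝ E U) ∘L
        ContinuousLinearMap.fst ℝ E (E →L[ℝ] ℝ)) (y, p) :=
    HasFDerivAt.comp (y, p) (g := fun y => l (y, v))
      (((hl.differentiable one_ne_zero) (y, v)).hasFDerivAt.comp y (hasFDerivAt_prodMk_left y v))
      hasFDerivAt_fst
  have h1 := (((hasFDerivAt_snd (𝕜 := ℝ) (p := (y, p))).clm_apply hF1).fun_sub hl1)
  have hmin : IsLocalMin (fun z => Hc z - (z.2 (F (z.1, v)) - l (z.1, v))) (y, p) := by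
    filter_upwards [hle] with z hz
    simp only [heq, sub_self]
    linarith
  have h2 := hmin.hasFDerivAt_eq_zero (hd.hasFDerivAt.fun_sub h1)
  have h3 := DFunLike.congr_fun h2 (w, π)
  simp [adjointField] at h3 ⊢
  linarith

/-- If the Hamilton equations hold almost everywhere, they hold everywhere. -/
theorem exists_hasDerivWithinAt_hamilton [FiniteDimensional ℝ E] {a b : ℝ} {u : ℝ → U} {x : ℝ → E}
    {p : ℝ → E →L[ℝ] ℝ} (hx : IsPrimitiveOn x (fun t => F (x t, u t)) a b)
    (hp : IsPrimitiveOn p (fun t => adjointField F l (p t, (x t, u t))) a b)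
    (hc : ContinuousOn (fun t => fderiv ℝ Hc (x t, p t)) (Icc a b))
    (hae : ∀ᵐ t, t ∈ Ioo a b → ∀ w π, fderiv ℝ Hc (x t, p t) (w, π) =
      π (F (x t, u t)) - adjointField F l (p t, (x t, u t)) w) {t : ℝ} (ht : t ∈ Icc a b) :
    ∃ w π, HasDerivWithinAt x w (Icc a b) t ∧ HasDerivWithinAt p π (Icc a b) t ∧
      ∀ w' π', fderiv ℝ Hc (x t, p t) (w', π') = π' w - π w' := by
  -- The partial derivative of `Hc` in `p` is an element of the bidual of `E`; a finite basis turns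
  -- it into a vector.
  let β := Module.finBasis ℝ E
  let cf : Fin (Module.finrank ℝ E) → E →L[ℝ] ℝ := fun i => LinearMap.toContinuousLinearMap (β.coord i)
  have hcf : ∀ e : E, ∑ i, cf i e • β i = e := fun e => β.sum_repr e
  have hcf' : ∀ π : E →L[ℝ] ℝ, ∑ i, π (β i) • cf i = π := fun π => by
    ext e
    conv_rhs => rw [← hcf e]
    simp [mul_comm]
  -- Written through `fderiv ℝ Hc`, the velocities no longer mention `u` and are continuous in time.
  have hx' : IsPrimitiveOn x (fun t => ∑ i, fderiv ℝ Hc (x t, p t) (0, cf i) • β i) a b := by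
    refine hx.congr_ae ?_
    filter_upwards [hae] with s hs hs'
    rw [← hcf (F (x s, u s))]
    refine Finset.sum_congr rfl fun i _ => ?_
    rw [hs hs', map_zero, sub_zero]
  have hp' : IsPrimitiveOn p
      (fun t => -(fderiv ℝ Hc (x t, p t) ∘L ContinuousLinearMap.inl ℝ E (E →L[ℝ] ℝ))) a b := by
    refine hp.congr_ae ?_
    filter_upwards [hae] with s hs hs'
    ext w
    simp [hs hs']
  refine ⟨_, _, hx'.hasDerivWithinAt ?_ ht, hp'.hasDerivWithinAt ?_ ht, fun w' π' => ?_⟩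
  · exact continuousOn_finsetSum _ fun i _ => (hc.clm_apply continuousOn_const).smul continuousOn_const
  · exact (hc.clm_comp continuousOn_const).neg
  · have h1 : fderiv ℝ Hc (x t, p t) (0, π') =
        π' (∑ i, fderiv ℝ Hc (x t, p t) (0, cf i) • β i) := by
      conv_lhs => rw [← hcf' π']
      have : ((0 : E), ∑ i, π' (β i) • cf i) = ∑ i, π' (β i) • ((0 : E), cf i) := by
        simp [Prod.ext_iff, Prod.fst_sum, Prod.snd_sum]
      simp only [this, map_sum, map_smul, smul_eq_mul, mul_comm]
    rw [← h1]
    have h2 : (w', π') = (0, π') + (w', (0 : E →L[ℝ] ℝ)) := by simp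
    rw [h2, map_add]
    simp

end Hamiltonian

end OptimalControl

/-! ### Canonical coordinates on the cotangent bundle -/

namespace OptimalControl

theorem two_le_infty : (2 : WithTop ℕ∞) ≤ ((⊤ : ℕ∞) : WithTop ℕ∞) :=
  (WithTop.coe_le_coe.2 le_top : ((2 : ℕ∞) : WithTop ℕ∞) ≤ ((⊤ : ℕ∞) : WithTop ℕ∞))

section Coordinates

variable {E : Type*} [NormedAddCommGroup E] [NormedSpace ℝ E]
  {M : Type*} [TopologicalSpace M] [ChartedSpace E M] [IsManifold 𝓘(ℝ, E) ∞ M]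

theorem contDiffAt_coordChange (x₀ x₁ : M) {x : M} (h0 : x ∈ (extChartAt 𝓘(ℝ, E) x₀).source)
    (h1 : x ∈ (extChartAt 𝓘(ℝ, E) x₁).source) :
    ContDiffAt ℝ ∞ (extChartAt 𝓘(ℝ, E) x₁ ∘ (extChartAt 𝓘(ℝ, E) x₀).symm)
      (extChartAt 𝓘(ℝ, E) x₀ x) := by
  rw [← contMDiffAt_iff_contDiffAt]
  have h2 := (extChartAt 𝓘(ℝ, E) x₀).map_source h0
  have h3 := (contMDiffOn_extChartAt_symm (I := 𝓘(ℝ, E)) (n := ∞) x₀).contMDiffAt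
    ((isOpen_extChartAt_target x₀).mem_nhds h2)
  refine ContMDiffAt.comp _ ?_ h3
  rw [(extChartAt 𝓘(ℝ, E) x₀).left_inv h0]
  exact contMDiffAt_extChartAt' (by rwa [extChartAt_source] at h1)

theorem hasFDerivAt_coordChange (x₀ x₁ : M) {x : M} (h0 : x ∈ (extChartAt 𝓘(ℝ, E) x₀).source)
    (h1 : x ∈ (extChartAt 𝓘(ℝ, E) x₁).source) :
    HasFDerivAt (extChartAt 𝓘(ℝ, E) x₁ ∘ (extChartAt 𝓘(ℝ, E) x₀).symm)
      (tangentCoordChange 𝓘(ℝ, E) x₀ x₁ x) (extChartAt 𝓘(ℝ, E) x₀ x) := by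
  have := hasFDerivWithinAt_tangentCoordChange (I := 𝓘(ℝ, E)) (x := x₀) (y := x₁) ⟨h0, h1⟩
  rwa [modelWithCornersSelf_coe, range_id, hasFDerivWithinAt_univ] at this

theorem tangentCoordChange_comp_tangentCoordChange {x₀ x₁ x₂ x : M}
    (h0 : x ∈ (extChartAt 𝓘(ℝ, E) x₀).source) (h1 : x ∈ (extChartAt 𝓘(ℝ, E) x₁).source)
    (h2 : x ∈ (extChartAt 𝓘(ℝ, E) x₂).source) :
    tangentCoordChange 𝓘(ℝ, E) x₁ x₂ x ∘L tangentCoordChange 𝓘(ℝ, E) x₀ x₁ x =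
      tangentCoordChange 𝓘(ℝ, E) x₀ x₂ x := by
  ext v
  exact tangentCoordChange_comp ⟨⟨h0, h1⟩, h2⟩

theorem tangentCoordChange_comp_inverse {x₀ x₁ x : M}
    (h0 : x ∈ (extChartAt 𝓘(ℝ, E) x₀).source) (h1 : x ∈ (extChartAt 𝓘(ℝ, E) x₁).source) :
    tangentCoordChange 𝓘(ℝ, E) x₁ x₀ x ∘L tangentCoordChange 𝓘(ℝ, E) x₀ x₁ x =
      ContinuousLinearMap.id ℝ E := by
  rw [tangentCoordChange_comp_tangentCoordChange h0 h1 h0]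
  ext v
  exact tangentCoordChange_self h0

/-- The canonical coordinates `(q, p)` on `T*M` given by the chart at `x₀`. -/
noncomputable def cotangentCoord (x₀ : M) (p : CotangentBundle E M) : E × (E →L[ℝ] ℝ) :=
  (extChartAt 𝓘(ℝ, E) x₀ p.1,
    (show E →L[ℝ] ℝ from p.2) ∘L tangentCoordChange 𝓘(ℝ, E) x₀ p.1 p.1)

/-- The inverse of the canonical coordinates on `T*M` given by the chart at `x₀`. -/
noncomputable def cotangentLift (x₀ : M) (z : E × (E →L[ℝ] ℝ)) : CotangentBundle E M :=
  ⟨(extChartAt 𝓘(ℝ, E) x₀).symm z.1, (z.2 ∘L tangentCoordChange 𝓘(ℝ, E)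
    ((extChartAt 𝓘(ℝ, E) x₀).symm z.1) x₀ ((extChartAt 𝓘(ℝ, E) x₀).symm z.1) : E →L[ℝ] ℝ)⟩

/-- The trivialization of the bundle of covectors precomposes with the tangent coordinate change.
Identifying the preferred chart in this way reduces later computations to the cocycle rules for
`tangentCoordChange`. -/
theorem extChartAt_cotangent (p₀ p : CotangentBundle E M)
    (h : p.1 ∈ (extChartAt 𝓘(ℝ, E) p₀.1).source) :
    extChartAt (𝓘(ℝ, E).prod 𝓘(ℝ, E →L[ℝ] ℝ)) p₀ p = cotangentCoord p₀.1 p := by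
  rw [extChartAt_source] at h
  rw [extChartAt_coe, Function.comp_apply, hom_chart]
  refine Prod.ext rfl ?_
  ext v
  simp only [ContinuousLinearMap.inCoordinates, TangentBundle.symmL_trivializationAt_eq_core h]
  simp [cotangentCoord]
  rfl

theorem cotangentLift_coord {x₀ : M} {p : CotangentBundle E M}
    (h : p.1 ∈ (extChartAt 𝓘(ℝ, E) x₀).source) : cotangentLift x₀ (cotangentCoord x₀ p) = p := by
  obtain ⟨x, q⟩ := p
  have e : (extChartAt 𝓘(ℝ, E) x₀).symm (extChartAt 𝓘(ℝ, E) x₀ x) = x :=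
    (extChartAt 𝓘(ℝ, E) x₀).left_inv h
  simp only [cotangentLift, cotangentCoord]
  rw [e]
  congr 1
  refine ContinuousLinearMap.ext fun v => congrArg q ?_
  exact DFunLike.congr_fun (tangentCoordChange_comp_inverse (mem_extChartAt_source x) h) v

theorem cotangentCoord_lift (x₀ x₁ : M) {z : E × (E →L[ℝ] ℝ)}
    (h : z.1 ∈ (extChartAt 𝓘(ℝ, E) x₀).target)
    (h1 : (extChartAt 𝓘(ℝ, E) x₀).symm z.1 ∈ (extChartAt 𝓘(ℝ, E) x₁).source) :
    cotangentCoord x₁ (cotangentLift x₀ z) =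
      ((extChartAt 𝓘(ℝ, E) x₁ ∘ (extChartAt 𝓘(ℝ, E) x₀).symm) z.1,
        z.2 ∘L tangentCoordChange 𝓘(ℝ, E) x₁ x₀ ((extChartAt 𝓘(ℝ, E) x₀).symm z.1)) := by
  refine Prod.ext rfl ?_
  simp only [cotangentLift, cotangentCoord]
  exact (ContinuousLinearMap.comp_assoc _ _ _).trans (congrArg _
    (tangentCoordChange_comp_tangentCoordChange h1 (mem_extChartAt_source _)
      ((extChartAt 𝓘(ℝ, E) x₀).map_target h)))

theorem extChartAt_cotangent_target (p₀ : CotangentBundle E M) :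
    (extChartAt (𝓘(ℝ, E).prod 𝓘(ℝ, E →L[ℝ] ℝ)) p₀).target =
      (extChartAt 𝓘(ℝ, E) p₀.1).target ×ˢ univ := by
  rw [FiberBundle.extChartAt_target]
  congr 1
  refine inter_eq_left.2 fun z hz => ?_
  have := (extChartAt 𝓘(ℝ, E) p₀.1).map_target hz
  rw [extChartAt_source] at this
  simp [hom_trivializationAt_baseSet]
  exact this

theorem extChartAt_cotangent_symm (p₀ : CotangentBundle E M) {z : E × (E →L[ℝ] ℝ)}
    (h : z.1 ∈ (extChartAt 𝓘(ℝ, E) p₀.1).target) :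
    (extChartAt (𝓘(ℝ, E).prod 𝓘(ℝ, E →L[ℝ] ℝ)) p₀).symm z = cotangentLift p₀.1 z := by
  set c := extChartAt (𝓘(ℝ, E).prod 𝓘(ℝ, E →L[ℝ] ℝ)) p₀ with hc
  have hz : z ∈ c.target := by
    rw [hc, extChartAt_cotangent_target]; exact ⟨h, trivial⟩
  have h1 := c.map_target hz
  have h2 : (c.symm z).1 ∈ (extChartAt 𝓘(ℝ, E) p₀.1).source := by
    rw [hc, extChartAt_source, FiberBundle.chartedSpace_chartAt] at h1
    simp at h1
    rw [extChartAt_source]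
    exact h1.1
  have h3 : cotangentCoord p₀.1 (c.symm z) = z := by
    rw [← extChartAt_cotangent _ _ h2]
    exact c.right_inv hz
  rw [← cotangentLift_coord h2, h3]

theorem contMDiffOn_cotangentLift (x₀ : M) :
    ContMDiffOn 𝓘(ℝ, E × (E →L[ℝ] ℝ)) (𝓘(ℝ, E).prod 𝓘(ℝ, E →L[ℝ] ℝ)) 2 (cotangentLift x₀)
      ((extChartAt 𝓘(ℝ, E) x₀).target ×ˢ univ) := by
  have h1 := contMDiffOn_extChartAt_symm (I := 𝓘(ℝ, E).prod 𝓘(ℝ, E →L[ℝ] ℝ)) (n := 2)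
    (⟨x₀, 0⟩ : CotangentBundle E M)
  rw [extChartAt_cotangent_target] at h1
  exact h1.congr fun z hz => (extChartAt_cotangent_symm _ hz.1).symm

/-- Covectors are transformed by a Jacobian taken at the moving base point. Differentiating that
Jacobian along the base produces the second-derivative term. -/
theorem exists_hasFDerivAt_cotangentCoord_lift (x₀ x₁ : M) {z : E × (E →L[ℝ] ℝ)}
    (h : z.1 ∈ (extChartAt 𝓘(ℝ, E) x₀).target)
    (h1 : (extChartAt 𝓘(ℝ, E) x₀).symm z.1 ∈ (extChartAt 𝓘(ℝ, E) x₁).source) :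
    ∃ T : (E × (E →L[ℝ] ℝ)) →L[ℝ] (E × (E →L[ℝ] ℝ)),
      HasFDerivAt (fun z => cotangentCoord x₁ (cotangentLift x₀ z)) T z ∧
      ∀ v ϖ, T (v, ϖ) =
        (tangentCoordChange 𝓘(ℝ, E) x₀ x₁ ((extChartAt 𝓘(ℝ, E) x₀).symm z.1) v,
        ϖ ∘L tangentCoordChange 𝓘(ℝ, E) x₁ x₀ ((extChartAt 𝓘(ℝ, E) x₀).symm z.1) +
        z.2 ∘L (fderiv ℝ (fderiv ℝ (extChartAt 𝓘(ℝ, E) x₀ ∘ (extChartAt 𝓘(ℝ, E) x₁).symm))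
          (extChartAt 𝓘(ℝ, E) x₁ ((extChartAt 𝓘(ℝ, E) x₀).symm z.1))
          (tangentCoordChange 𝓘(ℝ, E) x₀ x₁ ((extChartAt 𝓘(ℝ, E) x₀).symm z.1) v))) := by
  set σ := extChartAt 𝓘(ℝ, E) x₀ ∘ (extChartAt 𝓘(ℝ, E) x₁).symm with hσ
  set τ := extChartAt 𝓘(ℝ, E) x₁ ∘ (extChartAt 𝓘(ℝ, E) x₀).symm with hτ
  set x := (extChartAt 𝓘(ℝ, E) x₀).symm z.1 with hx
  have h0 : x ∈ (extChartAt 𝓘(ℝ, E) x₀).source := (extChartAt 𝓘(ℝ, E) x₀).map_target h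
  have e0 : extChartAt 𝓘(ℝ, E) x₀ x = z.1 := (extChartAt 𝓘(ℝ, E) x₀).right_inv h
  have hτ1 : HasFDerivAt τ (tangentCoordChange 𝓘(ℝ, E) x₀ x₁ x) z.1 := by
    rw [← e0]; exact hasFDerivAt_coordChange x₀ x₁ h0 h1
  have hσ2 : HasFDerivAt (fderiv ℝ σ) (fderiv ℝ (fderiv ℝ σ) (extChartAt 𝓘(ℝ, E) x₁ x))
      (τ z.1) := by
    have h2 : ContDiffAt ℝ ∞ σ (extChartAt 𝓘(ℝ, E) x₁ x) := contDiffAt_coordChange x₁ x₀ h1 h0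
    have h3 : ContDiffAt ℝ 1 (fderiv ℝ σ) (extChartAt 𝓘(ℝ, E) x₁ x) :=
      h2.fderiv_right (by
        exact (one_add_one_eq_two (R := WithTop ℕ∞)).trans_le two_le_infty)
    exact (h3.differentiableAt one_ne_zero).hasFDerivAt
  have hσ1 : ∀ y ∈ (extChartAt 𝓘(ℝ, E) x₀).target,
      (extChartAt 𝓘(ℝ, E) x₀).symm y ∈ (extChartAt 𝓘(ℝ, E) x₁).source →
      fderiv ℝ σ (τ y) = tangentCoordChange 𝓘(ℝ, E) x₁ x₀ ((extChartAt 𝓘(ℝ, E) x₀).symm y) :=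
    fun y hy hy' => (hasFDerivAt_coordChange x₁ x₀ hy' ((extChartAt 𝓘(ℝ, E) x₀).map_target hy)).fderiv
  have hfst : HasFDerivAt (fun z : E × (E →L[ℝ] ℝ) => τ z.1)
      (tangentCoordChange 𝓘(ℝ, E) x₀ x₁ x ∘L ContinuousLinearMap.fst ℝ E (E →L[ℝ] ℝ)) z :=
    hτ1.comp z hasFDerivAt_fst
  have hsnd : HasFDerivAt (fun z : E × (E →L[ℝ] ℝ) => fderiv ℝ σ (τ z.1)) _ z := hσ2.comp z hfst
  refine ⟨_, (hfst.prodMk ((hasFDerivAt_snd (𝕜 := ℝ) (p := z)).clm_comp hsnd)).congr_of_eventuallyEq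
    ?_, fun v ϖ => ?_⟩
  · have h4 : ∀ᶠ y in 𝓝 z.1, y ∈ (extChartAt 𝓘(ℝ, E) x₀).target ∧
        (extChartAt 𝓘(ℝ, E) x₀).symm y ∈ (extChartAt 𝓘(ℝ, E) x₁).source :=
      ((isOpen_extChartAt_target x₀).eventually_mem h).and ((continuousAt_extChartAt_symm'' h).preimage_mem_nhds
        ((isOpen_extChartAt_source x₁).mem_nhds h1))
    filter_upwards [continuousAt_fst.eventually h4] with y hy
    rw [cotangentCoord_lift x₀ x₁ hy.1 hy.2, hσ1 _ hy.1 hy.2]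
  · refine Prod.ext (by simp) ?_
    have := hσ1 z.1 h h1
    ext e
    simp [this, hx]
    ring

/-- The Hamilton equations in the canonical coordinates given by any chart yield a Hamiltonian
vector. -/
theorem exists_isHamiltonianVector {H : CotangentBundle E M → ℝ}
    (hH : MDifferentiable (𝓘(ℝ, E).prod 𝓘(ℝ, E →L[ℝ] ℝ)) 𝓘(ℝ, ℝ) H) {x₀ : M}
    {p : ℝ → CotangentBundle E M} {c : ℝ → E × (E →L[ℝ] ℝ)} {s : Set ℝ} {t : ℝ} {w : E}
    {ϖ : E →L[ℝ] ℝ} (hc : HasDerivWithinAt c (w, ϖ) s t) (ht : t ∈ s)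
    (hsrc : (c t).1 ∈ (extChartAt 𝓘(ℝ, E) x₀).target)
    (hp : ∀ r ∈ s, p r = cotangentLift x₀ (c r))
    (hw : ∀ w' ϖ', fderiv ℝ (fun z => H (cotangentLift x₀ z)) (c t) (w', ϖ') = ϖ' w - ϖ w') :
    ∃ W : TangentSpace (𝓘(ℝ, E).prod 𝓘(ℝ, E →L[ℝ] ℝ)) (p t), IsHamiltonianVector H (p t) W ∧
      HasMFDerivWithinAt 𝓘(ℝ, ℝ) (𝓘(ℝ, E).prod 𝓘(ℝ, E →L[ℝ] ℝ)) p s t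
        ((1 : ℝ →L[ℝ] ℝ).smulRight W) := by
  set z := c t with hz
  set x := (extChartAt 𝓘(ℝ, E) x₀).symm z.1 with hx
  have h0 : x ∈ (extChartAt 𝓘(ℝ, E) x₀).source := (extChartAt 𝓘(ℝ, E) x₀).map_target hsrc
  have h1 : x ∈ (extChartAt 𝓘(ℝ, E) x).source := mem_extChartAt_source x
  obtain ⟨T, hT, hTe⟩ := exists_hasFDerivAt_cotangentCoord_lift x₀ x hsrc h1
  have hpt : p t = cotangentLift x₀ z := hp t ht
  have hcont : ContinuousAt (cotangentLift x₀) z :=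
    ((contMDiffOn_cotangentLift x₀).continuousOn).continuousAt
      (((isOpen_extChartAt_target x₀).prod isOpen_univ).mem_nhds ⟨hsrc, trivial⟩)
  have hnear : ∀ᶠ y in 𝓝 z, (cotangentLift x₀ y).1 ∈ (extChartAt 𝓘(ℝ, E) x).source := by
    have h2 : ∀ᶠ y in 𝓝 z.1, (extChartAt 𝓘(ℝ, E) x₀).symm y ∈ (extChartAt 𝓘(ℝ, E) x).source :=
      (continuousAt_extChartAt_symm'' hsrc).preimage_mem_nhds
        ((isOpen_extChartAt_source x).mem_nhds h1)
    exact continuousAt_fst.eventually h2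
  have hΛ : HasMFDerivAt 𝓘(ℝ, E × (E →L[ℝ] ℝ)) (𝓘(ℝ, E).prod 𝓘(ℝ, E →L[ℝ] ℝ)) (cotangentLift x₀)
      z T := by
    refine ⟨hcont, ?_⟩
    refine HasFDerivAt.hasFDerivWithinAt (hT.congr_of_eventuallyEq ?_)
    filter_upwards [hnear] with y hy
    exact extChartAt_cotangent _ _ hy
  have hd : HasMFDerivWithinAt 𝓘(ℝ, ℝ) 𝓘(ℝ, E × (E →L[ℝ] ℝ)) c s t
      ((1 : ℝ →L[ℝ] ℝ).smulRight (w, ϖ)) := hc.hasFDerivWithinAt.hasMFDerivWithinAt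
  have hcomp := (hΛ.comp_hasMFDerivWithinAt t hd).congr_of_eventuallyEq
    (eventually_of_mem self_mem_nhdsWithin hp) hpt
  let dH : (E × (E →L[ℝ] ℝ)) →L[ℝ] ℝ :=
    mfderiv (𝓘(ℝ, E).prod 𝓘(ℝ, E →L[ℝ] ℝ)) 𝓘(ℝ, ℝ) H (cotangentLift x₀ z)
  have hHd : HasFDerivAt (fun z => H (cotangentLift x₀ z)) (dH ∘L T) z :=
    ((hH (cotangentLift x₀ z)).hasMFDerivAt.comp z hΛ).hasFDerivAt
  rw [hHd.fderiv] at hw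
  rw [hpt]
  refine ⟨T (w, ϖ), fun W' => ?_, ?_⟩
  · obtain ⟨v', ϖ'⟩ : E × (E →L[ℝ] ℝ) := W'
    set A := tangentCoordChange 𝓘(ℝ, E) x₀ x x with hA
    set B := tangentCoordChange 𝓘(ℝ, E) x x₀ x with hB
    set S := fderiv ℝ (fderiv ℝ (extChartAt 𝓘(ℝ, E) x₀ ∘ (extChartAt 𝓘(ℝ, E) x).symm))
          (extChartAt 𝓘(ℝ, E) x x) with hS
    have hAB : ∀ e, A (B e) = e := fun e =>
      DFunLike.congr_fun (tangentCoordChange_comp_inverse h1 h0) e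
    have hBA : ∀ e, B (A e) = e := fun e =>
      DFunLike.congr_fun (tangentCoordChange_comp_inverse h0 h1) e
    -- Symmetry of the second derivative cancels the correction terms in the symplectic form: the
    -- lifted change of chart is symplectic.
    have hsymm : ∀ e e', S e e' = S e' e := fun e e' =>
      ((contDiffAt_coordChange x x₀ h1 h0).isSymmSndFDerivAt (by simpa using two_le_infty)).eq e e'
    -- This is the preimage of the test vector under `T`, so Hamilton's equations in the chart at
    -- `x₀` can be evaluated against it.
    have hsurj : T (B v', (ϖ' - z.2 ∘L S v') ∘L A) = (v', ϖ') := by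
      rw [hTe]
      refine Prod.ext (hAB v') ?_
      ext e
      simp [hAB]
    have h3 := hw (B v') ((ϖ' - z.2 ∘L S v') ∘L A)
    rw [ContinuousLinearMap.comp_apply, hsurj] at h3
    refine Eq.trans ?_ h3.symm
    rw [hTe]
    simp [symplecticForm]
    rw [hsymm (A w) v']
    ring
  · refine hcomp.congr_mfderiv ?_
    have hsm : ∀ r : ℝ, T (r • (w, ϖ)) = r • T (w, ϖ) := fun r => map_smul T r _
    exact ContinuousLinearMap.ext fun r => hsm r

end Coordinates
end OptimalControl

/-! ### Restriction and concatenation of admissible pairs -/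

namespace OptimalControl

theorem BddMeasOn.congr {Z : Type*} [NormedAddCommGroup Z] {c c' : ℝ → Z} {a b : ℝ}
    (h : BddMeasOn c a b) (hc : ∀ t ∈ Icc a b, c' t = c t) : BddMeasOn c' a b := by
  obtain ⟨R, hR⟩ := h.2
  refine ⟨h.1.congr ?_, R, fun t ht => by rw [hc t ht]; exact hR t ht⟩
  exact (ae_restrict_iff' measurableSet_Icc).2 (Eventually.of_forall fun t ht => (hc t ht).symm)

theorem BddMeasOn.union {Z : Type*} [NormedAddCommGroup Z] {c : ℝ → Z} {a b d : ℝ}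
    (hab : a ≤ b) (hbd : b ≤ d) (h : BddMeasOn c a b) (h' : BddMeasOn c b d) :
    BddMeasOn c a d := by
  obtain ⟨R, hR⟩ := h.2
  obtain ⟨R', hR'⟩ := h'.2
  refine ⟨?_, max R R', fun t ht => ?_⟩
  · rw [← Icc_union_Icc_eq_Icc hab hbd]
    exact aestronglyMeasurable_union_iff.2 ⟨h.1, h'.1⟩
  · rcases le_total t b with htb | htb
    · exact (hR t ⟨ht.1, htb⟩).trans (le_max_left _ _)
    · exact (hR' t ⟨htb, ht.2⟩).trans (le_max_right _ _)

theorem BddMeasOn.glue {Z : Type*} [NormedAddCommGroup Z] {c c' : ℝ → Z} {a b d : ℝ}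
    (hab : a ≤ b) (hbd : b ≤ d) (h : BddMeasOn c a b) (h' : BddMeasOn c' b d) :
    BddMeasOn (fun t => if t ≤ b then c t else c' t) a d := by
  refine BddMeasOn.union hab hbd (h.congr fun t ht => if_pos ht.2) ?_
  obtain ⟨R', hR'⟩ := h'.2
  -- At `b` itself the glued function takes the value `c b`: irrelevant for measurability, but it
  -- has to enter the bound.
  refine ⟨h'.1.congr ?_, max ‖c b‖ R', fun t ht => ?_⟩
  · have hb : ∀ᵐ s : ℝ, s ≠ b := by simp [ae_iff, measure_singleton]
    refine (ae_restrict_iff' measurableSet_Icc).2 ?_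
    filter_upwards [hb] with t htb ht
    rw [if_neg]
    exact not_le.2 (lt_of_le_of_ne ht.1 (Ne.symm htb))
  · rcases ht.1.eq_or_lt with rfl | hlt
    · simp
    · simp only [if_neg (not_le.2 hlt)]
      exact (hR' t ht).trans (le_max_right _ _)

/-- Distances on the line add up through `b`, which belongs to both pieces, so the larger constant
works across the junction. -/
theorem LipschitzOnWith.union_of_mem {X : Type*} [PseudoMetricSpace X] {f : ℝ → X} {K K' : ℝ≥0}
    {s s' : Set ℝ} {b : ℝ} (h : LipschitzOnWith K f s) (h' : LipschitzOnWith K' f s')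
    (hs : ∀ t ∈ s, t ≤ b) (hs' : ∀ t ∈ s', b ≤ t) (hb : b ∈ s) (hb' : b ∈ s') :
    LipschitzOnWith (max K K') f (s ∪ s') := by
  have h1 : LipschitzOnWith (max K K') f s := h.weaken (le_max_left _ _)
  have h2 : LipschitzOnWith (max K K') f s' := h'.weaken (le_max_right _ _)
  have key : ∀ t ∈ s, ∀ t' ∈ s', dist (f t) (f t') ≤ (max K K' : ℝ≥0) * dist t t' := by
    intro t ht t' ht'
    have e : dist t t' = dist t b + dist b t' := by
      rw [Real.dist_eq, Real.dist_eq, Real.dist_eq, abs_of_nonpos (by linarith [hs t ht, hs' t' ht']),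
        abs_of_nonpos (by linarith [hs t ht]), abs_of_nonpos (by linarith [hs' t' ht'])]
      ring
    rw [e, mul_add]
    exact (dist_triangle _ (f b) _).trans
      (add_le_add (h1.dist_le_mul t ht b hb) (h2.dist_le_mul b hb' t' ht'))
  refine LipschitzOnWith.of_dist_le_mul fun t ht t' ht' => ?_
  rcases ht with ht | ht <;> rcases ht' with ht' | ht'
  · exact h1.dist_le_mul t ht t' ht'
  · exact key t ht t' ht'
  · rw [dist_comm, dist_comm t]; exact key t' ht' t ht
  · exact h2.dist_le_mul t ht t' ht'

namespace Problem

variable {E : Type*} [NormedAddCommGroup E] [NormedSpace ℝ E]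
  {M : Type*} [TopologicalSpace M] [ChartedSpace E M] [IsManifold 𝓘(ℝ, E) ∞ M] {k : ℕ}

/-- The velocity `F(x,u)` as a vector of the model space, through the preferred chart at `x`. -/
noncomputable def velocityVec (P : Problem E M k) (x : M) (u : EuclideanSpace ℝ (Fin k)) : E :=
  P.velocity x u

/-- `(x(·), u(·))` is an admissible pair on `[a,b]`. The dynamics are expressed in the preferred
charts along the path. -/
structure AdmissibleOn (P : Problem E M k) (a b : ℝ) (x : ℝ → M)
    (u : ℝ → EuclideanSpace ℝ (Fin k)) : Prop where
  control : BddMeasOn u a b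
  continuous_path : ContinuousOn x (Icc a b)
  lipschitz_path : ∀ t ∈ Icc a b, ∃ K : ℝ≥0, ∃ s ∈ 𝓝[Icc a b] t,
    LipschitzOnWith K (fun r => extChartAt 𝓘(ℝ, E) (x t) (x r)) s
  dynamics : ∀ᵐ t, t ∈ Ioo a b →
    HasDerivAt (fun r => extChartAt 𝓘(ℝ, E) (x t) (x r)) (P.velocityVec (x t) (u t)) t

theorem hasMFDerivWithinAt_iff_hasDerivAt {x : ℝ → M} {t a b : ℝ} (ht : t ∈ Ioo a b)
    (hx : ContinuousWithinAt x (Icc a b) t) (w : E) :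
    HasMFDerivWithinAt 𝓘(ℝ, ℝ) 𝓘(ℝ, E) x (Icc a b) t
      ((1 : ℝ →L[ℝ] ℝ).smulRight (show TangentSpace 𝓘(ℝ, E) (x t) from w)) ↔
    HasDerivAt (fun r => extChartAt 𝓘(ℝ, E) (x t) (x r)) w t := by
  have hn : Icc a b ∈ 𝓝 t := Icc_mem_nhds ht.1 ht.2
  have e : HasMFDerivWithinAt 𝓘(ℝ, ℝ) 𝓘(ℝ, E) x (Icc a b) t
      ((1 : ℝ →L[ℝ] ℝ).smulRight (show TangentSpace 𝓘(ℝ, E) (x t) from w)) ↔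
    HasFDerivWithinAt (fun r => extChartAt 𝓘(ℝ, E) (x t) (x r)) ((1 : ℝ →L[ℝ] ℝ).smulRight w)
      (Icc a b ∩ univ) t := by
    unfold HasMFDerivWithinAt
    rw [and_iff_right hx]
    simp only [modelWithCornersSelf_coe, range_id]
    rfl
  rw [e, inter_univ]
  exact ⟨fun h => HasDerivWithinAt.hasDerivAt (hasDerivWithinAt_iff_hasFDerivWithinAt.2 h) hn,
    fun h => hasDerivWithinAt_iff_hasFDerivWithinAt.1 h.hasDerivWithinAt⟩

/-- The end points are a null set, and at interior times a derivative within the interval is a full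
one. Unlike the original definition, the new form is available on every `[a, b]`, so it can be
restricted and concatenated. -/
theorem isAdmissible_iff (P : Problem E M k) {x : ℝ → M} {u : ℝ → EuclideanSpace ℝ (Fin k)} :
    P.IsAdmissible x u ↔ P.AdmissibleOn 0 1 x u := by
  have hn0 : ∀ᵐ s : ℝ, s ≠ 0 := by simp [ae_iff, measure_singleton]
  have hn1 : ∀ᵐ s : ℝ, s ≠ 1 := by simp [ae_iff, measure_singleton]
  constructor
  · intro h
    refine ⟨⟨h.measurable_control.aestronglyMeasurable, h.bounded_control⟩, h.continuous_path,
      h.lipschitz_path, ?_⟩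
    filter_upwards [(ae_restrict_iff' measurableSet_Icc).1 h.dynamics] with t h1 ht
    have ht' := Ioo_subset_Icc_self ht
    exact (hasMFDerivWithinAt_iff_hasDerivAt ht (h.continuous_path t ht') _).1 (h1 ht')
  · intro h
    refine ⟨h.control.1.aemeasurable, h.control.2, h.continuous_path, h.lipschitz_path, ?_⟩
    refine (ae_restrict_iff' measurableSet_Icc).2 ?_
    filter_upwards [h.dynamics, hn0, hn1] with t h1 h2 h3 ht
    have ht' : t ∈ Ioo (0 : ℝ) 1 := ⟨lt_of_le_of_ne ht.1 (Ne.symm h2), lt_of_le_of_ne ht.2 h3⟩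
    exact (hasMFDerivWithinAt_iff_hasDerivAt ht' (h.continuous_path t ht) _).2 (h1 ht')

namespace AdmissibleOn

variable {P : Problem E M k} {x x' : ℝ → M} {u u' : ℝ → EuclideanSpace ℝ (Fin k)} {a b d : ℝ}

theorem mono (h : P.AdmissibleOn a b x u) {a' b' : ℝ} (ha : a ≤ a') (hb : b' ≤ b) :
    P.AdmissibleOn a' b' x u := by
  have hs : Icc a' b' ⊆ Icc a b := Icc_subset_Icc ha hb
  refine ⟨h.control.mono ha hb, h.continuous_path.mono hs, fun t ht => ?_, ?_⟩
  · obtain ⟨K, s, h1, h2⟩ := h.lipschitz_path t (hs ht)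
    exact ⟨K, s, nhdsWithin_mono t hs h1, h2⟩
  · filter_upwards [h.dynamics] with t h1 ht using h1 (Ioo_subset_Ioo ha hb ht)

/-- Concatenation of admissible pairs. -/
theorem glue (hab : a ≤ b) (hbd : b ≤ d) (h : P.AdmissibleOn a b x u)
    (h' : P.AdmissibleOn b d x' u') (hb : x b = x' b) :
    P.AdmissibleOn a d (fun t => if t ≤ b then x t else x' t)
      (fun t => if t ≤ b then u t else u' t) := by
  set z : ℝ → M := fun t => if t ≤ b then x t else x' t with hz
  have hzl : ∀ t, t ≤ b → z t = x t := fun t ht => if_pos ht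
  have hzr : ∀ t, b ≤ t → z t = x' t := fun t ht => by
    rcases ht.eq_or_lt with rfl | hlt
    · rw [hzl _ le_rfl, hb]
    · exact if_neg (not_le.2 hlt)
  have hU : Icc a d = Icc a b ∪ Icc b d := (Icc_union_Icc_eq_Icc hab hbd).symm
  refine ⟨h.control.glue hab hbd h'.control, ?_, fun t ht => ?_, ?_⟩
  · rw [hU]
    exact (h.continuous_path.congr fun t ht => hzl t ht.2).union_of_isClosed
      (h'.continuous_path.congr fun t ht => hzr t ht.1) isClosed_Icc isClosed_Icc
  · rcases lt_trichotomy t b with htb | rfl | htb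
    · obtain ⟨K, s, h1, h2⟩ := h.lipschitz_path t ⟨ht.1, htb.le⟩
      refine ⟨K, s ∩ Iio b, ?_, ?_⟩
      · have e : 𝓝[Icc a d] t = 𝓝[Icc a b] t :=
          nhdsWithin_eq_nhdsWithin (s := Iio b) htb isOpen_Iio (by
            ext r; simp only [mem_inter_iff, mem_Icc, mem_Iio]
            exact ⟨fun h => ⟨⟨h.1.1, h.2.le⟩, h.2⟩, fun h => ⟨⟨h.1.1, h.1.2.trans hbd⟩, h.2⟩⟩)
        rw [e]
        exact inter_mem h1 (mem_nhdsWithin_of_mem_nhds (Iio_mem_nhds htb))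
      · rw [hzl t htb.le]
        intro r hr r' hr'
        simp only [hzl r (le_of_lt hr.2), hzl r' (le_of_lt hr'.2)]
        exact h2 hr.1 hr'.1
    -- At the junction both pieces are Lipschitz in the same chart, since `x b = x' b`.
    · obtain ⟨K, s, h1, h2⟩ := h.lipschitz_path t ⟨hab, le_rfl⟩
      obtain ⟨K', s', h1', h2'⟩ := h'.lipschitz_path t ⟨le_rfl, hbd⟩
      refine ⟨max K K', (s ∩ Icc a t) ∪ (s' ∩ Icc t d), ?_, ?_⟩
      · rw [hU, nhdsWithin_union]
        exact mem_sup.2 ⟨mem_of_superset (inter_mem h1 self_mem_nhdsWithin) subset_union_left,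
          mem_of_superset (inter_mem h1' self_mem_nhdsWithin) subset_union_right⟩
      · refine LipschitzOnWith.union_of_mem (b := t) ?_ ?_ (fun r hr => hr.2.2)
          (fun r hr => hr.2.1)
          ⟨mem_of_mem_nhdsWithin (show t ∈ Icc a t from ⟨hab, le_rfl⟩) h1, ⟨hab, le_rfl⟩⟩
          ⟨mem_of_mem_nhdsWithin (show t ∈ Icc t d from ⟨le_rfl, hbd⟩) h1', ⟨le_rfl, hbd⟩⟩
        · rw [hzl t le_rfl]
          intro r hr r' hr'
          simp only [hzl r hr.2.2, hzl r' hr'.2.2]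
          exact h2 hr.1 hr'.1
        · rw [hzr t le_rfl]
          intro r hr r' hr'
          simp only [hzr r hr.2.1, hzr r' hr'.2.1]
          exact h2' hr.1 hr'.1
    · obtain ⟨K, s, h1, h2⟩ := h'.lipschitz_path t ⟨htb.le, ht.2⟩
      refine ⟨K, s ∩ Ioi b, ?_, ?_⟩
      · have e : 𝓝[Icc a d] t = 𝓝[Icc b d] t :=
          nhdsWithin_eq_nhdsWithin (s := Ioi b) htb isOpen_Ioi (by
            ext r; simp only [mem_inter_iff, mem_Icc, mem_Ioi]
            exact ⟨fun h => ⟨⟨h.2.le, h.1.2⟩, h.2⟩, fun h => ⟨⟨hab.trans h.1.1, h.1.2⟩, h.2⟩⟩)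
        rw [e]
        exact inter_mem h1 (mem_nhdsWithin_of_mem_nhds (Ioi_mem_nhds htb))
      · rw [hzr t htb.le]
        intro r hr r' hr'
        simp only [hzr r (le_of_lt hr.2), hzr r' (le_of_lt hr'.2)]
        exact h2 hr.1 hr'.1
  · have hnb : ∀ᵐ s : ℝ, s ≠ b := by simp [ae_iff, measure_singleton]
    filter_upwards [h.dynamics, h'.dynamics, hnb] with t h1 h2 h3 ht
    rcases lt_or_gt_of_ne h3 with htb | htb
    · simp only [if_pos htb.le, hzl t htb.le]
      refine (h1 ⟨ht.1, htb⟩).congr_of_eventuallyEq ?_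
      filter_upwards [Iio_mem_nhds htb] with r hr
      rw [hzl r (le_of_lt hr)]
    · simp only [if_neg (not_le.2 htb), hzr t htb.le]
      refine (h2 ⟨htb, ht.2⟩).congr_of_eventuallyEq ?_
      filter_upwards [Ioi_mem_nhds htb] with r hr
      rw [hzr r (le_of_lt hr)]

theorem bddMeasOn_lagrangian [SecondCountableTopology M]
    (h : P.AdmissibleOn a b x u) : BddMeasOn (fun t => P.lagrangian (x t, u t)) a b := by
  borelize M
  have hL : Continuous P.lagrangian := P.smooth_lagrangian.continuous
  obtain ⟨R, hR⟩ := h.control.2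
  constructor
  · have h1 : AEMeasurable (fun t => (x t, u t)) (volume.restrict (Icc a b)) :=
      (h.continuous_path.aemeasurable measurableSet_Icc).prodMk h.control.1.aemeasurable
    exact (hL.measurable.comp_aemeasurable h1).aestronglyMeasurable
  · have hc : IsCompact ((x '' Icc a b) ×ˢ Metric.closedBall (0 : EuclideanSpace ℝ (Fin k)) R) :=
      (isCompact_Icc.image_of_continuousOn h.continuous_path).prod (isCompact_closedBall _ _)
    obtain ⟨C, hC⟩ := hc.exists_bound_of_continuousOn hL.continuousOn
    exact ⟨C, fun t ht => hC _ ⟨mem_image_of_mem x ht, by simpa using hR t ht⟩⟩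

theorem integral_glue [SecondCountableTopology M] (hab : a ≤ b) (hbd : b ≤ d)
    (h : P.AdmissibleOn a b x u) (h' : P.AdmissibleOn b d x' u') (hb : x b = x' b) :
    ∫ t in a..d, P.lagrangian (if t ≤ b then x t else x' t, if t ≤ b then u t else u' t) =
      (∫ t in a..b, P.lagrangian (x t, u t)) + ∫ t in b..d, P.lagrangian (x' t, u' t) := by
  have hg := (glue hab hbd h h' hb).bddMeasOn_lagrangian
  rw [← intervalIntegral.integral_add_adjacent_intervals
    (hg.intervalIntegrable ⟨le_rfl, hab.trans hbd⟩ ⟨hab, hbd⟩)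
    (hg.intervalIntegrable ⟨hab, hbd⟩ ⟨hab.trans hbd, le_rfl⟩)]
  congr 1
  · refine intervalIntegral.integral_congr fun t ht => ?_
    rw [uIcc_of_le hab] at ht
    simp only [if_pos ht.2]
  · refine intervalIntegral.integral_congr_ae (Eventually.of_forall fun t ht => ?_)
    rw [uIoc_of_le hbd] at ht
    simp only [if_neg (not_le.2 ht.1)]

end AdmissibleOn

end Problem

end OptimalControl

/-! ### Localization of the control problem in a chart -/

namespace OptimalControl

section Coordinates

variable {E : Type*} [NormedAddCommGroup E] [NormedSpace ℝ E]
  {M : Type*} [TopologicalSpace M] [ChartedSpace E M] [IsManifold 𝓘(ℝ, E) ∞ M]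

theorem hasMFDerivAt_extChartAt_coord (x₀ : M) {x : M} (h : x ∈ (extChartAt 𝓘(ℝ, E) x₀).source) :
    HasMFDerivAt 𝓘(ℝ, E) 𝓘(ℝ, E) (extChartAt 𝓘(ℝ, E) x₀) x
      (tangentCoordChange 𝓘(ℝ, E) x x₀ x : E →L[ℝ] E) := by
  refine ⟨continuousAt_extChartAt' h, ?_⟩
  have h2 : HasFDerivWithinAt _ _ (range 𝓘(ℝ, E)) _ :=
    (hasFDerivAt_coordChange x x₀ (mem_extChartAt_source x) h).hasFDerivWithinAt
  exact h2

theorem hasMFDerivAt_extChartAt_symm_coord (x₀ : M) {z : E}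
    (h : z ∈ (extChartAt 𝓘(ℝ, E) x₀).target) :
    HasMFDerivAt 𝓘(ℝ, E) 𝓘(ℝ, E) (extChartAt 𝓘(ℝ, E) x₀).symm z
      (tangentCoordChange 𝓘(ℝ, E) x₀ ((extChartAt 𝓘(ℝ, E) x₀).symm z)
        ((extChartAt 𝓘(ℝ, E) x₀).symm z) : E →L[ℝ] E) := by
  refine ⟨continuousAt_extChartAt_symm'' h, ?_⟩
  have := hasFDerivAt_coordChange x₀ ((extChartAt 𝓘(ℝ, E) x₀).symm z)
    ((extChartAt 𝓘(ℝ, E) x₀).map_target h) (mem_extChartAt_source _)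
  rw [(extChartAt 𝓘(ℝ, E) x₀).right_inv h] at this
  have h2 : HasFDerivWithinAt _ _ (range 𝓘(ℝ, E)) _ := this.hasFDerivWithinAt
  exact h2

/-- The coordinate expression of a vector field in the chart at `x₀`. -/
noncomputable def coordVectorField (x₀ : M) (X : (x : M) → TangentSpace 𝓘(ℝ, E) x) (y : E) : E :=
  tangentCoordChange 𝓘(ℝ, E) ((extChartAt 𝓘(ℝ, E) x₀).symm y) x₀
    ((extChartAt 𝓘(ℝ, E) x₀).symm y) (X ((extChartAt 𝓘(ℝ, E) x₀).symm y))

theorem contDiffOn_coordVectorField (x₀ : M) {X : (x : M) → TangentSpace 𝓘(ℝ, E) x}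
    (hX : ContMDiff 𝓘(ℝ, E) 𝓘(ℝ, E).tangent ∞ (fun x => (⟨x, X x⟩ : TangentBundle 𝓘(ℝ, E) M))) :
    ContDiffOn ℝ ∞ (coordVectorField x₀ X) (extChartAt 𝓘(ℝ, E) x₀).target := by
  intro y hy
  set x := (extChartAt 𝓘(ℝ, E) x₀).symm y with hx
  have hxs : x ∈ (extChartAt 𝓘(ℝ, E) x₀).source := (extChartAt 𝓘(ℝ, E) x₀).map_target hy
  have h1 : ContMDiffAt 𝓘(ℝ, E) 𝓘(ℝ, E) ∞
      (fun x => (trivializationAt E (TangentSpace 𝓘(ℝ, E)) x₀ ⟨x, X x⟩).2) x := by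
    refine (Bundle.Trivialization.contMDiffAt_section_iff
      (e := trivializationAt E (TangentSpace 𝓘(ℝ, E)) x₀) ?_).1 (hX x)
    rw [extChartAt_source] at hxs
    exact hxs
  have h2 := (contMDiffOn_extChartAt_symm (I := 𝓘(ℝ, E)) (n := ∞) x₀).contMDiffAt
    ((isOpen_extChartAt_target x₀).mem_nhds hy)
  have h3 := (h1.comp y h2).contDiffAt
  exact h3.contDiffWithinAt

theorem ContDiffOn.bump_smul [FiniteDimensional ℝ E] {G : Type*} [NormedAddCommGroup G]
    [NormedSpace ℝ G] {V : Type*} [NormedAddCommGroup V] [NormedSpace ℝ V] {c : E}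
    (f : ContDiffBump c) {s : Set E} (hs : IsOpen s) (hf : Metric.closedBall c f.rOut ⊆ s)
    {g : E × V → G} (hg : ContDiffOn ℝ ∞ g (s ×ˢ univ)) :
    ContDiff ℝ ∞ (fun z : E × V => f z.1 • g z) := by
  rw [contDiff_iff_contDiffAt]
  rintro ⟨y, v⟩
  by_cases hy : y ∈ s
  · have h1 : ContDiffAt ℝ ∞ g (y, v) :=
      hg.contDiffAt ((hs.prod isOpen_univ).mem_nhds ⟨hy, trivial⟩)
    have h2 : ContDiff ℝ ∞ (fun z : E × V => f z.1) := f.contDiff.comp contDiff_fst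
    exact h2.contDiffAt.smul h1
  · have hn : ∀ᶠ z : E × V in 𝓝 (y, v), z.1 ∈ (Metric.closedBall c f.rOut)ᶜ :=
      continuousAt_fst.eventually
        (Metric.isClosed_closedBall.isOpen_compl.mem_nhds fun h => hy (hf h))
    refine (contDiffAt_const (c := (0 : G))).congr_of_eventuallyEq ?_
    filter_upwards [hn] with z hz
    rw [f.zero_of_le_dist (le_of_lt (by simpa using hz)), zero_smul]

end Coordinates

namespace Problem

variable {E : Type*} [NormedAddCommGroup E] [NormedSpace ℝ E]
  {M : Type*} [TopologicalSpace M] [ChartedSpace E M] [IsManifold 𝓘(ℝ, E) ∞ M] {k : ℕ}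

/-- The dynamics in the chart at `x₀`. -/
noncomputable def coordVelocity (P : Problem E M k) (x₀ : M)
    (z : E × EuclideanSpace ℝ (Fin k)) : E :=
  tangentCoordChange 𝓘(ℝ, E) ((extChartAt 𝓘(ℝ, E) x₀).symm z.1) x₀
    ((extChartAt 𝓘(ℝ, E) x₀).symm z.1) (P.velocityVec ((extChartAt 𝓘(ℝ, E) x₀).symm z.1) z.2)

/-- The Lagrangian in the chart at `x₀`. -/
noncomputable def coordLagrangian (P : Problem E M k) (x₀ : M)
    (z : E × EuclideanSpace ℝ (Fin k)) : ℝ :=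
  P.lagrangian ((extChartAt 𝓘(ℝ, E) x₀).symm z.1, z.2)

theorem coordVelocity_eq (P : Problem E M k) (x₀ : M) (z : E × EuclideanSpace ℝ (Fin k)) :
    P.coordVelocity x₀ z =
      coordVectorField x₀ P.drift z.1 + ∑ i, z.2 i • coordVectorField x₀ (P.field i) z.1 := by
  set A := tangentCoordChange 𝓘(ℝ, E) ((extChartAt 𝓘(ℝ, E) x₀).symm z.1) x₀
    ((extChartAt 𝓘(ℝ, E) x₀).symm z.1) with hA
  have h := map_add A (P.drift ((extChartAt 𝓘(ℝ, E) x₀).symm z.1))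
    (∑ i, z.2 i • P.field i ((extChartAt 𝓘(ℝ, E) x₀).symm z.1) : E)
  refine Eq.trans h ?_
  congr 1
  have h2 : ∀ V : Fin k → E, A (∑ i, z.2 i • V i) = ∑ i, z.2 i • A (V i) := fun V => by simp
  exact h2 fun i => P.field i ((extChartAt 𝓘(ℝ, E) x₀).symm z.1)

theorem contDiffOn_coordLagrangian (P : Problem E M k) (x₀ : M) :
    ContDiffOn ℝ ∞ (P.coordLagrangian x₀) ((extChartAt 𝓘(ℝ, E) x₀).target ×ˢ univ) := by
  rw [← contMDiffOn_iff_contDiffOn]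
  have h1 : ContMDiffOn 𝓘(ℝ, E × EuclideanSpace ℝ (Fin k)) 𝓘(ℝ, E) ∞
      (fun z : E × EuclideanSpace ℝ (Fin k) => (extChartAt 𝓘(ℝ, E) x₀).symm z.1)
      ((extChartAt 𝓘(ℝ, E) x₀).target ×ˢ univ) :=
    (contMDiffOn_extChartAt_symm (I := 𝓘(ℝ, E)) (n := ∞) x₀).comp
      (contDiff_fst.contMDiff.contMDiffOn) (fun z hz => hz.1)
  have h2 : ContMDiffOn 𝓘(ℝ, E × EuclideanSpace ℝ (Fin k)) 𝓘(ℝ, EuclideanSpace ℝ (Fin k)) ∞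
      (fun z : E × EuclideanSpace ℝ (Fin k) => z.2)
      ((extChartAt 𝓘(ℝ, E) x₀).target ×ˢ univ) := contDiff_snd.contMDiff.contMDiffOn
  exact P.smooth_lagrangian.comp_contMDiffOn (h1.prodMk h2)

/-- Near `x₀` the problem coincides in coordinates with the problem on the model space given by
the dynamics `F` and the Lagrangian `l`, where `F` is globally Lipschitz. -/
structure IsLocalization (P : Problem E M k) (x₀ : M) (ρ : ℝ)
    (F : E × EuclideanSpace ℝ (Fin k) → E) (l : E × EuclideanSpace ℝ (Fin k) → ℝ) : Prop where
  pos : 0 < ρ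
  contDiff_F : ContDiff ℝ 1 F
  contDiff_l : ContDiff ℝ 1 l
  lipschitz : ∀ R, ∃ K, 0 ≤ K ∧ ∀ v, ‖v‖ ≤ R → ∀ y y', ‖F (y, v) - F (y', v)‖ ≤ K * ‖y - y'‖
  bounded : ∀ v, ∃ B, ∀ y, ‖F (y, v)‖ ≤ B
  ball_subset : Metric.ball (extChartAt 𝓘(ℝ, E) x₀ x₀) ρ ⊆ (extChartAt 𝓘(ℝ, E) x₀).target
  eq_F : ∀ y ∈ Metric.ball (extChartAt 𝓘(ℝ, E) x₀ x₀) ρ, ∀ v,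
    F (y, v) = P.coordVelocity x₀ (y, v)
  eq_l : ∀ y ∈ Metric.ball (extChartAt 𝓘(ℝ, E) x₀ x₀) ρ, ∀ v,
    l (y, v) = P.coordLagrangian x₀ (y, v)

/-- Cut off by a bump function, the vector fields become compactly supported, hence globally bounded
and Lipschitz, as the existence theorem for the differential equation demands. Since the control
enters affinely, one Lipschitz constant serves all controls in a given ball. -/
theorem exists_isLocalization [FiniteDimensional ℝ E] (P : Problem E M k) (x₀ : M) :
    ∃ ρ F l, P.IsLocalization x₀ ρ F l := by
  obtain ⟨r, hr, hrs⟩ := Metric.isOpen_iff.1 (isOpen_extChartAt_target (I := 𝓘(ℝ, E)) x₀) _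
    (mem_extChartAt_target x₀)
  -- The bump equals `1` on the ball of radius `r / 4`, which becomes the localization radius, and
  -- vanishes outside radius `r / 2`, inside the chart.
  let f : ContDiffBump (extChartAt 𝓘(ℝ, E) x₀ x₀) := ⟨r / 4, r / 2, by positivity, by linarith⟩
  have hf : Metric.closedBall (extChartAt 𝓘(ℝ, E) x₀ x₀) f.rOut ⊆ (extChartAt 𝓘(ℝ, E) x₀).target :=
    (Metric.closedBall_subset_ball (by change r / 2 < r; linarith)).trans hrs
  have hopen := isOpen_extChartAt_target (I := 𝓘(ℝ, E)) x₀
  have hX : ∀ {X : (x : M) → TangentSpace 𝓘(ℝ, E) x},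
      ContMDiff 𝓘(ℝ, E) 𝓘(ℝ, E).tangent ∞ (fun x => (⟨x, X x⟩ : TangentBundle 𝓘(ℝ, E) M)) →
      ContDiff ℝ ∞ (fun y => f y • coordVectorField x₀ X y) ∧
      HasCompactSupport (fun y => f y • coordVectorField x₀ X y) := fun {X} h => by
    -- A dummy real variable lets the bump lemma, stated for products, be used for a function of `y`
    -- alone.
    have h1 : ContDiffOn ℝ ∞ (fun z : E × ℝ => coordVectorField x₀ X z.1)
      ((extChartAt 𝓘(ℝ, E) x₀).target ×ˢ univ) :=
      (contDiffOn_coordVectorField x₀ h).comp contDiff_fst.contDiffOn (fun z hz => hz.1)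
    have h2 := ContDiffOn.bump_smul f hopen hf h1
    exact ⟨h2.comp (contDiff_id.prodMk (contDiff_const (c := (0 : ℝ)))), f.hasCompactSupport.smul_right⟩
  have h0 := hX P.smooth_drift
  have hi := fun i => hX (P.smooth_field i)
  have hLip : ∀ {g : E → E}, ContDiff ℝ ∞ g → HasCompactSupport g →
      ∃ K : ℝ, 0 ≤ K ∧ ∀ y y', ‖g y - g y'‖ ≤ K * ‖y - y'‖ := fun {g} h1 h2 => by
    obtain ⟨K, hK⟩ := h1.lipschitzWith_of_hasCompactSupport h2 (by simp)
    exact ⟨K, K.2, fun y y' => by simpa [dist_eq_norm] using hK.dist_le_mul y y'⟩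
  obtain ⟨K0, hK00, hK0⟩ := hLip h0.1 h0.2
  choose K hK0' hK using fun i => hLip (hi i).1 (hi i).2
  obtain ⟨B0, hB0⟩ := h0.2.exists_bound_of_continuous h0.1.continuous
  choose B hB using fun i => (hi i).2.exists_bound_of_continuous (hi i).1.continuous
  have hone : (1 : WithTop ℕ∞) ≤ ((⊤ : ℕ∞) : WithTop ℕ∞) := one_le_two.trans two_le_infty
  refine ⟨r / 4, fun z => f z.1 • coordVectorField x₀ P.drift z.1 +
    ∑ i, z.2 i • (f z.1 • coordVectorField x₀ (P.field i) z.1), fun z => f z.1 • P.coordLagrangian x₀ z,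
    by positivity, ?_, ?_, ?_, ?_, ?_, ?_, ?_⟩
  · have e0 := h0.1.comp (contDiff_fst (E := E) (F := EuclideanSpace ℝ (Fin k)))
    have ei := fun i => (hi i).1.comp (contDiff_fst (E := E) (F := EuclideanSpace ℝ (Fin k)))
    refine ContDiff.add (e0.of_le hone) (ContDiff.sum fun i _ => ContDiff.smul ?_ ((ei i).of_le hone))
    fun_prop
  · exact (ContDiffOn.bump_smul f hopen hf (P.contDiffOn_coordLagrangian x₀)).of_le hone
  · intro R
    refine ⟨K0 + ∑ i, |R| * K i, add_nonneg hK00 (Finset.sum_nonneg fun i _ =>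
      mul_nonneg (abs_nonneg _) (hK0' i)), fun v hv y y' => ?_⟩
    simp only
    rw [add_sub_add_comm, ← Finset.sum_sub_distrib, add_mul, Finset.sum_mul]
    refine (norm_add_le _ _).trans (add_le_add (hK0 _ _) ((norm_sum_le _ _).trans
      (Finset.sum_le_sum fun i _ => ?_)))
    rw [← smul_sub, norm_smul, mul_assoc]
    exact mul_le_mul (((PiLp.norm_apply_le v i).trans hv).trans (le_abs_self R)) (hK i _ _)
      (norm_nonneg _) (abs_nonneg _)
  · intro v
    refine ⟨B0 + ∑ i, ‖v i‖ * B i, fun y => (norm_add_le _ _).trans (add_le_add (hB0 y)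
      ((norm_sum_le _ _).trans (Finset.sum_le_sum fun i _ => ?_)))⟩
    rw [norm_smul]
    exact mul_le_mul_of_nonneg_left (hB i y) (norm_nonneg _)
  · exact (Metric.ball_subset_ball (by linarith)).trans hrs
  · intro y hy v
    have hfy : f y = 1 := f.one_of_mem_closedBall (Metric.ball_subset_closedBall hy)
    simp only [hfy, one_smul]
    rw [coordVelocity_eq]
  · intro y hy v
    have hfy : f y = 1 := f.one_of_mem_closedBall (Metric.ball_subset_closedBall hy)
    simp only [hfy, one_smul]

end Problem

end OptimalControl

/-! ### Coordinate form of the dynamics and of subgradients of the cost to go -/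

namespace OptimalControl

namespace Problem

variable {E : Type*} [NormedAddCommGroup E] [NormedSpace ℝ E]
  {M : Type*} [TopologicalSpace M] [ChartedSpace E M] [IsManifold 𝓘(ℝ, E) ∞ M] {k : ℕ}
  {P : Problem E M k} {x : ℝ → M} {u : ℝ → EuclideanSpace ℝ (Fin k)} {x₀ : M} {a b ρ : ℝ}
  {F : E × EuclideanSpace ℝ (Fin k) → E} {l : E × EuclideanSpace ℝ (Fin k) → ℝ}

/-- The dynamics are given in a chart that varies with `t`; the chain rule for the transition map
brings them into the single chart at `x₀`. -/
theorem AdmissibleOn.ae_hasDerivAt_coord (h : P.AdmissibleOn a b x u)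
    (hsrc : ∀ t ∈ Icc a b, x t ∈ (extChartAt 𝓘(ℝ, E) x₀).source) :
    ∀ᵐ t, t ∈ Ioo a b → HasDerivAt (fun r => extChartAt 𝓘(ℝ, E) x₀ (x r))
      (P.coordVelocity x₀ (extChartAt 𝓘(ℝ, E) x₀ (x t), u t)) t := by
  filter_upwards [h.dynamics] with t h1 ht
  have ht' := Ioo_subset_Icc_self ht
  have hxt := hsrc t ht'
  have hcont : ContinuousAt x t := (h.continuous_path t ht').continuousAt (Icc_mem_nhds ht.1 ht.2)
  have h2 := (hasFDerivAt_coordChange (x t) x₀ (mem_extChartAt_source (x t)) hxt).comp_hasDerivAt t (h1 ht)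
  have e : P.coordVelocity x₀ (extChartAt 𝓘(ℝ, E) x₀ (x t), u t) =
      tangentCoordChange 𝓘(ℝ, E) (x t) x₀ (x t) (P.velocityVec (x t) (u t)) := by
    simp only [coordVelocity]
    rw [(extChartAt 𝓘(ℝ, E) x₀).left_inv hxt]
  rw [e]
  refine h2.congr_of_eventuallyEq ?_
  filter_upwards [hcont.preimage_mem_nhds (extChartAt_source_mem_nhds (I := 𝓘(ℝ, E)) (x t))] with r hr
  simp only [Function.comp_apply]
  rw [(extChartAt 𝓘(ℝ, E) (x t)).left_inv hr]

theorem admissibleOn_of_coord {y : ℝ → E} {K : ℝ≥0} (hu : BddMeasOn u a b)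
    (hy : LipschitzOnWith K y (Icc a b))
    (htgt : ∀ t ∈ Icc a b, y t ∈ (extChartAt 𝓘(ℝ, E) x₀).target)
    (hd : ∀ᵐ t, t ∈ Ioo a b → HasDerivAt y (P.coordVelocity x₀ (y t, u t)) t) :
    P.AdmissibleOn a b (fun t => (extChartAt 𝓘(ℝ, E) x₀).symm (y t)) u := by
  refine ⟨hu, (continuousOn_extChartAt_symm x₀).comp hy.continuousOn htgt, fun t ht => ?_, ?_⟩
  · have h1 := contDiffAt_coordChange x₀ ((extChartAt 𝓘(ℝ, E) x₀).symm (y t))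
      ((extChartAt 𝓘(ℝ, E) x₀).map_target (htgt t ht)) (mem_extChartAt_source _)
    rw [(extChartAt 𝓘(ℝ, E) x₀).right_inv (htgt t ht)] at h1
    obtain ⟨K', s, hs, h2⟩ := (h1.of_le (one_le_two.trans two_le_infty)).exists_lipschitzOnWith
    refine ⟨K' * K, y ⁻¹' s ∩ Icc a b, inter_mem ((hy.continuousOn t ht).preimage_mem_nhdsWithin hs)
      self_mem_nhdsWithin, ?_⟩
    exact h2.comp (hy.mono inter_subset_right) fun r hr => hr.1
  · filter_upwards [hd] with t h1 ht
    have ht' := Ioo_subset_Icc_self ht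
    have hsrc := (extChartAt 𝓘(ℝ, E) x₀).map_target (htgt t ht')
    have h2 := hasFDerivAt_coordChange x₀ ((extChartAt 𝓘(ℝ, E) x₀).symm (y t)) hsrc
      (mem_extChartAt_source _)
    rw [(extChartAt 𝓘(ℝ, E) x₀).right_inv (htgt t ht')] at h2
    have h3 := h2.comp_hasDerivAt t (h1 ht)
    have e : tangentCoordChange 𝓘(ℝ, E) x₀ ((extChartAt 𝓘(ℝ, E) x₀).symm (y t))
        ((extChartAt 𝓘(ℝ, E) x₀).symm (y t)) (P.coordVelocity x₀ (y t, u t)) =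
        P.velocityVec ((extChartAt 𝓘(ℝ, E) x₀).symm (y t)) (u t) :=
      DFunLike.congr_fun (tangentCoordChange_comp_inverse (mem_extChartAt_source _) hsrc) _
    rw [e] at h3
    exact h3

theorem preHamiltonian_cotangentLift (P : Problem E M k) (x₀ : M) (z : E × (E →L[ℝ] ℝ))
    (v : EuclideanSpace ℝ (Fin k)) :
    P.preHamiltonian (cotangentLift x₀ z) v =
      z.2 (P.coordVelocity x₀ (z.1, v)) - P.coordLagrangian x₀ (z.1, v) := rfl

/-- `-q` is a (viscosity) subgradient at `x(t)` of the optimal cost to go from time `t` to the end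
point of `x`, along the admissible pair `(x,u)`. -/
def IsSubgradientAt (P : Problem E M k) (x : ℝ → M) (u : ℝ → EuclideanSpace ℝ (Fin k)) (t : ℝ)
    (q : TangentSpace 𝓘(ℝ, E) (x t) →L[ℝ] ℝ) : Prop :=
  ∃ ψ : M → ℝ, HasMFDerivAt 𝓘(ℝ, E) 𝓘(ℝ, ℝ) ψ (x t) (-q) ∧
    ∀ᶠ w in 𝓝 (x t), ∀ z v, P.AdmissibleOn t 1 z v → z t = w → z 1 = x 1 →
      ψ w - ψ (x t) ≤ (∫ s in t..1, P.lagrangian (z s, v s)) - ∫ s in t..1, P.lagrangian (x s, u s)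

/-- The property `IsSubgradientAt` in the chart at `x₀`. -/
def IsCoordSubgradientAt (P : Problem E M k) (x : ℝ → M) (u : ℝ → EuclideanSpace ℝ (Fin k))
    (x₀ : M) (t : ℝ) (p : E →L[ℝ] ℝ) : Prop :=
  ∃ ψ : E → ℝ, HasFDerivAt ψ (-p) (extChartAt 𝓘(ℝ, E) x₀ (x t)) ∧
    ∀ᶠ e in 𝓝 (extChartAt 𝓘(ℝ, E) x₀ (x t)), ∀ z v, P.AdmissibleOn t 1 z v →
      z t = (extChartAt 𝓘(ℝ, E) x₀).symm e → z 1 = x 1 →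
      ψ e - ψ (extChartAt 𝓘(ℝ, E) x₀ (x t)) ≤
        (∫ s in t..1, P.lagrangian (z s, v s)) - ∫ s in t..1, P.lagrangian (x s, u s)

/-- Composing the test function with a chart changes the covector by the transition Jacobian.
Together with `IsCoordSubgradientAt.of_coord` this permits a change of chart between consecutive
time intervals. -/
theorem IsSubgradientAt.coord {t : ℝ} {q : TangentSpace 𝓘(ℝ, E) (x t) →L[ℝ] ℝ}
    (h : P.IsSubgradientAt x u t q) (hsrc : x t ∈ (extChartAt 𝓘(ℝ, E) x₀).source) :
    P.IsCoordSubgradientAt x u x₀ t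
      ((q : E →L[ℝ] ℝ) ∘L tangentCoordChange 𝓘(ℝ, E) x₀ (x t) (x t)) := by
  obtain ⟨ψ, hψ, hev⟩ := h
  have htgt := (extChartAt 𝓘(ℝ, E) x₀).map_source hsrc
  have e := (extChartAt 𝓘(ℝ, E) x₀).left_inv hsrc
  refine ⟨fun y => ψ ((extChartAt 𝓘(ℝ, E) x₀).symm y), ?_, ?_⟩
  · have h1 := hasMFDerivAt_extChartAt_symm_coord x₀ htgt
    rw [e] at h1
    rw [← e] at hψ
    have h2 := (hψ.comp _ h1).hasFDerivAt
    exact h2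
  · have hc := continuousAt_extChartAt_symm'' htgt
    rw [ContinuousAt, e] at hc
    filter_upwards [hc.eventually hev] with y hy
    simp only [e]
    exact hy

theorem IsCoordSubgradientAt.of_coord {t : ℝ} {p : E →L[ℝ] ℝ}
    (h : P.IsCoordSubgradientAt x u x₀ t p) (hsrc : x t ∈ (extChartAt 𝓘(ℝ, E) x₀).source) :
    P.IsSubgradientAt x u t
      (p ∘L tangentCoordChange 𝓘(ℝ, E) (x t) x₀ (x t) : E →L[ℝ] ℝ) := by
  obtain ⟨ψ, hψ, hev⟩ := h
  refine ⟨fun w => ψ (extChartAt 𝓘(ℝ, E) x₀ w), ?_, ?_⟩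
  · have h1 := hψ.hasMFDerivAt.comp (x t) (hasMFDerivAt_extChartAt_coord x₀ hsrc)
    exact h1
  · filter_upwards [(continuousAt_extChartAt' hsrc).eventually hev,
      (isOpen_extChartAt_source x₀).mem_nhds hsrc] with w hw hws z v hz hzt
    refine hw z v hz ?_
    rw [(extChartAt 𝓘(ℝ, E) x₀).left_inv hws, hzt]

end Problem

end OptimalControl

/-! ### Transport and maximality for subgradients on the manifold -/

namespace OptimalControl

namespace Problem

variable {E : Type*} [NormedAddCommGroup E] [NormedSpace ℝ E] [FiniteDimensional ℝ E]
  {M : Type*} [TopologicalSpace M] [ChartedSpace E M] [IsManifold 𝓘(ℝ, E) ∞ M] {k : ℕ}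
  {P : Problem E M k} {x : ℝ → M} {u : ℝ → EuclideanSpace ℝ (Fin k)} {x₀ : M} {a b ρ : ℝ}
  {F : E × EuclideanSpace ℝ (Fin k) → E} {l : E × EuclideanSpace ℝ (Fin k) → ℝ}

namespace IsLocalization

theorem bddMeasOn_F (hL : P.IsLocalization x₀ ρ F l) (hu : BddMeasOn u a b) {z : ℝ → E}
    (hz : ContinuousOn z (Icc a b)) : BddMeasOn (fun t => F (z t, u t)) a b := by
  have : ProperSpace E := FiniteDimensional.proper ℝ E
  exact ((BddMeasOn.of_continuousOn hz).prodMk hu).comp hL.contDiff_F.continuous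

theorem bddMeasOn_l (hL : P.IsLocalization x₀ ρ F l) (hu : BddMeasOn u a b) {z : ℝ → E}
    (hz : ContinuousOn z (Icc a b)) : BddMeasOn (fun t => l (z t, u t)) a b := by
  have : ProperSpace E := FiniteDimensional.proper ℝ E
  exact ((BddMeasOn.of_continuousOn hz).prodMk hu).comp hL.contDiff_l.continuous

theorem admissibleOn (hL : P.IsLocalization x₀ ρ F l) (hu : BddMeasOn u a b) {z : ℝ → E}
    (hzc : ContinuousOn z (Icc a b)) (hz : IsPrimitiveOn z (fun t => F (z t, u t)) a b)
    (hball : ∀ t ∈ Icc a b, z t ∈ Metric.ball (extChartAt 𝓘(ℝ, E) x₀ x₀) ρ) :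
    P.AdmissibleOn a b (fun t => (extChartAt 𝓘(ℝ, E) x₀).symm (z t)) u := by
  obtain ⟨K, hK⟩ := hz.exists_lipschitzOnWith (hL.bddMeasOn_F hu hzc)
  refine admissibleOn_of_coord hu hK (fun t ht => hL.ball_subset (hball t ht)) ?_
  filter_upwards [hz.ae_hasDerivAt (hL.bddMeasOn_F hu hzc)] with t h1 ht
  rw [← hL.eq_F _ (hball t (Ioo_subset_Icc_self ht))]
  exact h1 ht

theorem integral_eq (hL : P.IsLocalization x₀ ρ F l) (hab : a ≤ b) {z : ℝ → E}
    (hball : ∀ t ∈ Icc a b, z t ∈ Metric.ball (extChartAt 𝓘(ℝ, E) x₀ x₀) ρ) :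
    ∫ t in a..b, P.lagrangian ((extChartAt 𝓘(ℝ, E) x₀).symm (z t), u t) =
      ∫ t in a..b, l (z t, u t) := by
  refine intervalIntegral.integral_congr fun t ht => ?_
  rw [uIcc_of_le hab] at ht
  exact (hL.eq_l _ (hball t ht) _).symm

theorem isPrimitiveOn_coord (hL : P.IsLocalization x₀ ρ F l) (h : P.AdmissibleOn a b x u)
    (hsrc : ∀ t ∈ Icc a b, x t ∈ (extChartAt 𝓘(ℝ, E) x₀).source)
    (hball : ∀ t ∈ Icc a b, extChartAt 𝓘(ℝ, E) x₀ (x t) ∈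
      Metric.ball (extChartAt 𝓘(ℝ, E) x₀ x₀) ρ) {K : ℝ≥0}
    (hK : LipschitzOnWith K (fun r => extChartAt 𝓘(ℝ, E) x₀ (x r)) (Icc a b)) :
    IsPrimitiveOn (fun r => extChartAt 𝓘(ℝ, E) x₀ (x r))
      (fun t => F (extChartAt 𝓘(ℝ, E) x₀ (x t), u t)) a b := by
  refine isPrimitiveOn_of_lipschitzOnWith hK (hL.bddMeasOn_F h.control hK.continuousOn) ?_
  filter_upwards [h.ae_hasDerivAt_coord hsrc] with t h1 ht
  rw [hL.eq_F _ (hball t (Ioo_subset_Icc_self ht))]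
  exact h1 ht

end IsLocalization

/-- Dynamic programming: a competitor starting at time `b` is extended backwards to time `a` with
the original control. The inequality at `a` applies to the concatenation; subtracting the cost of
the added piece leaves a test function at `b`, differentiated by `hasFDerivAt_transport`. -/
theorem IsCoordSubgradientAt.transport [SecondCountableTopology M]
    (hL : P.IsLocalization x₀ ρ F l) (h : P.AdmissibleOn 0 1 x u)
    (ha0 : 0 ≤ a) (hab : a ≤ b) (hb1 : b ≤ 1)
    (hsrc : ∀ t ∈ Icc a b, x t ∈ (extChartAt 𝓘(ℝ, E) x₀).source)
    (hball : ∀ t ∈ Icc a b, extChartAt 𝓘(ℝ, E) x₀ (x t) ∈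
      Metric.ball (extChartAt 𝓘(ℝ, E) x₀ x₀) (ρ / 2))
    (hyc : ContinuousOn (fun r => extChartAt 𝓘(ℝ, E) x₀ (x r)) (Icc a b))
    (hy : IsPrimitiveOn (fun r => extChartAt 𝓘(ℝ, E) x₀ (x r))
      (fun t => F (extChartAt 𝓘(ℝ, E) x₀ (x t), u t)) a b)
    {R K : ℝ} (hR : ∀ t ∈ Icc a b, ‖u t‖ ≤ R) (hK0 : 0 ≤ K)
    (hK : ∀ v, ‖v‖ ≤ R → ∀ y y', ‖F (y, v) - F (y', v)‖ ≤ K * ‖y - y'‖)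
    (hshort : K * (b - a) ≤ 1 / 2) {p : ℝ → E →L[ℝ] ℝ} (hpc : ContinuousOn p (Icc a b))
    (hp : IsPrimitiveOn p
      (fun t => adjointField F l (p t, (extChartAt 𝓘(ℝ, E) x₀ (x t), u t))) a b)
    (hsub : P.IsCoordSubgradientAt x u x₀ a (p a)) : P.IsCoordSubgradientAt x u x₀ b (p b) := by
  have : ProperSpace E := FiniteDimensional.proper ℝ E
  have hb : b ∈ Icc a b := ⟨hab, le_rfl⟩
  have ha : a ∈ Icc a b := ⟨le_rfl, hab⟩
  have hu : BddMeasOn u a b := h.control.mono ha0 hb1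
  have hρ := hL.pos
  set y : ℝ → E := fun r => extChartAt 𝓘(ℝ, E) x₀ (x r) with hydef
  choose Y hYc hYb hY using fun w : E => exists_isPrimitiveOn (G := F) hL.contDiff_F.continuous hu
    hR hK0 hK hshort hb w
  obtain ⟨ψ, hψ, hev⟩ := hsub
  have hYcl : ∀ w, ∀ t ∈ Icc a b, ‖Y w t - y t‖ ≤ 2 * ‖w - y b‖ := fun w t ht => by
    have := norm_sub_le_of_isPrimitiveOn (G := F) hL.contDiff_F.continuous hu hR hK0 hK hshort hb
      (hYc w).continuousOn hyc (hY w) hy ht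
    rwa [hYb] at this
  have hYx : ∀ t ∈ Icc a b, Y (y b) t = y t := fun t ht => by
    simpa [sub_eq_zero] using hYcl (y b) t ht
  have hder := hasFDerivAt_transport hL.contDiff_F hL.contDiff_l hab hu hR hK0 hK hshort hyc hy hpc
    hp hYc hYb hY hψ
  refine ⟨_, hder, ?_⟩
  have htend : Tendsto (fun w => Y w a) (𝓝 (y b)) (𝓝 (y a)) := by
    rw [tendsto_iff_norm_sub_tendsto_zero]
    refine squeeze_zero (fun _ => norm_nonneg _) (fun w => hYcl w a ha) ?_
    have : Tendsto (fun w => 2 * ‖w - y b‖) (𝓝 (y b)) (𝓝 (2 * ‖y b - y b‖)) := by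
      apply Continuous.tendsto; fun_prop
    simpa using this
  have hyx : ∀ t ∈ Icc a b, (extChartAt 𝓘(ℝ, E) x₀).symm (y t) = x t := fun t ht =>
    (extChartAt 𝓘(ℝ, E) x₀).left_inv (hsrc t ht)
  have hIx : ∫ t in a..b, P.lagrangian (x t, u t) = ∫ t in a..b, l (y t, u t) := by
    rw [← hL.integral_eq hab fun t ht => Metric.ball_subset_ball (by linarith) (hball t ht)]
    refine intervalIntegral.integral_congr fun t ht => ?_
    rw [uIcc_of_le hab] at ht
    rw [hyx t ht]
  have hIY : ∫ t in a..b, l (Y (y b) t, u t) = ∫ t in a..b, l (y t, u t) := by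
    refine intervalIntegral.integral_congr fun t ht => ?_
    rw [uIcc_of_le hab] at ht
    rw [hYx t ht]
  have hLx := h.bddMeasOn_lagrangian
  have hsplit : ∫ t in a..1, P.lagrangian (x t, u t) =
      (∫ t in a..b, P.lagrangian (x t, u t)) + ∫ t in b..1, P.lagrangian (x t, u t) :=
    (intervalIntegral.integral_add_adjacent_intervals
      (hLx.intervalIntegrable ⟨ha0, hab.trans hb1⟩ ⟨ha0.trans hab, hb1⟩)
      (hLx.intervalIntegrable ⟨ha0.trans hab, hb1⟩ ⟨by norm_num, le_rfl⟩)).symm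
  -- Within `ρ / 4` of `y b`, the curve `Y e` stays within `ρ / 2` of `y`, hence in the localization
  -- ball.
  filter_upwards [htend.eventually hev, Metric.ball_mem_nhds (y b) (show 0 < ρ / 4 by positivity)]
    with e h1 h2 z v hz hzb hz1
  rw [Metric.mem_ball, dist_eq_norm] at h2
  have hYball : ∀ t ∈ Icc a b, Y e t ∈ Metric.ball (extChartAt 𝓘(ℝ, E) x₀ x₀) ρ := fun t ht => by
    have h3 := hYcl e t ht
    have h4 := hball t ht
    rw [Metric.mem_ball] at h4 ⊢
    calc dist (Y e t) _ ≤ dist (Y e t) (y t) + dist (y t) _ := dist_triangle _ _ _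
      _ < ρ := by rw [dist_eq_norm]; linarith
  have hYadm := hL.admissibleOn hu (hYc e).continuousOn (hY e) hYball
  have hjoin : (extChartAt 𝓘(ℝ, E) x₀).symm (Y e b) = z b := by rw [hYb, hzb]
  -- If `b = 1` the glued path takes its final value from the first piece, which explains the case
  -- split.
  have h5 := h1 _ _ (AdmissibleOn.glue hab hb1 hYadm hz hjoin) (by simp [hab]) (by
    split_ifs with h6
    · have : b = 1 := le_antisymm hb1 h6
      subst this
      rw [hjoin, hz1]
    · exact hz1)
  rw [AdmissibleOn.integral_glue hab hb1 hYadm hz hjoin, hL.integral_eq hab hYball, hsplit, hIx] at h5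
  rw [hIY, hYx a ha]
  linarith

/-- The competitor starts displaced at time `t`, uses the control `v` briefly and then rejoins `x`.
The comparison is legitimate because the subgradient inequality covers every starting point near `x
t`. -/
theorem IsCoordSubgradientAt.maximality [SecondCountableTopology M]
    (hL : P.IsLocalization x₀ ρ F l) (h : P.AdmissibleOn 0 1 x u) (ha0 : 0 ≤ a) (hb1 : b ≤ 1)
    (hsrc : ∀ t ∈ Icc a b, x t ∈ (extChartAt 𝓘(ℝ, E) x₀).source)
    (hball : ∀ t ∈ Icc a b, extChartAt 𝓘(ℝ, E) x₀ (x t) ∈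
      Metric.ball (extChartAt 𝓘(ℝ, E) x₀ x₀) (ρ / 2))
    (hyc : ContinuousOn (fun r => extChartAt 𝓘(ℝ, E) x₀ (x r)) (Icc a b))
    {t : ℝ} (ht : t ∈ Ioo a b)
    (hd : HasDerivAt (fun r => extChartAt 𝓘(ℝ, E) x₀ (x r))
      (F (extChartAt 𝓘(ℝ, E) x₀ (x t), u t)) t)
    (hJ : HasDerivAt (fun r => ∫ s in a..r, l (extChartAt 𝓘(ℝ, E) x₀ (x s), u s))
      (l (extChartAt 𝓘(ℝ, E) x₀ (x t), u t)) t)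
    {p : E →L[ℝ] ℝ} (hsub : P.IsCoordSubgradientAt x u x₀ t p) (v : EuclideanSpace ℝ (Fin k)) :
    p (F (extChartAt 𝓘(ℝ, E) x₀ (x t), v)) - l (extChartAt 𝓘(ℝ, E) x₀ (x t), v) ≤
      p (F (extChartAt 𝓘(ℝ, E) x₀ (x t), u t)) - l (extChartAt 𝓘(ℝ, E) x₀ (x t), u t) := by
  have : ProperSpace E := FiniteDimensional.proper ℝ E
  have hρ := hL.pos
  set y : ℝ → E := fun r => extChartAt 𝓘(ℝ, E) x₀ (x r) with hydef
  have hu : BddMeasOn u a b := h.control.mono ha0 hb1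
  have hly := hL.bddMeasOn_l hu hyc
  have hLx := h.bddMeasOn_lagrangian
  obtain ⟨K, hK0, hK⟩ := hL.lipschitz ‖v‖
  obtain ⟨B, hB⟩ := hL.bounded v
  obtain ⟨ψ, hψ, hev⟩ := hsub
  obtain ⟨ρ', hρ', hev'⟩ := Metric.eventually_nhds_iff.1 hev
  have ht' := Ioo_subset_Icc_self ht
  -- `ρ'` keeps the displaced start where the subgradient inequality holds; `ρ / 2` keeps the needle
  -- inside the localization ball.
  refine maximality_of_needle (ρ := min ρ' (ρ / 2)) hL.contDiff_F.continuous
    hL.contDiff_l.continuous hK0 (hK v le_rfl) hB hd hJ hψ (by positivity) ?_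
  have hsmall : ∀ᶠ r in 𝓝[>] (0 : ℝ), r < b - t :=
    nhdsWithin_le_nhds (Iio_mem_nhds (by linarith [ht.2]))
  filter_upwards [hsmall, self_mem_nhdsWithin] with r hrb (hr0 : 0 < r) z hzc hze hzp hzρ
  have htr : t ≤ t + r := by linarith
  have hr1 : t + r ≤ 1 := by linarith
  have hrmem : t + r ∈ Icc a b := ⟨by linarith [ht.1], by linarith⟩
  have hzball : ∀ s ∈ Icc t (t + r), z s ∈ Metric.ball (extChartAt 𝓘(ℝ, E) x₀ x₀) ρ :=
    fun s hs => by
      have h3 := (hzρ s hs).trans_le (min_le_right _ _)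
      have h4 := hball t ht'
      rw [Metric.mem_ball] at h4 ⊢
      calc dist (z s) _ ≤ dist (z s) (y t) + dist (y t) _ := dist_triangle _ _ _
        _ < ρ := by rw [dist_eq_norm]; linarith
  have hc : BddMeasOn (fun _ : ℝ => v) t (t + r) := BddMeasOn.of_continuousOn continuousOn_const
  have hzadm := hL.admissibleOn hc hzc.continuousOn hzp hzball
  have hxadm : P.AdmissibleOn (t + r) 1 x u := h.mono (by linarith [ht.1]) le_rfl
  have hjoin : (extChartAt 𝓘(ℝ, E) x₀).symm (z (t + r)) = x (t + r) := by
    rw [hze]; exact (extChartAt 𝓘(ℝ, E) x₀).left_inv (hsrc _ hrmem)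
  have h5 := hev' (y := z t) (by
    rw [dist_eq_norm]
    exact (hzρ t ⟨le_rfl, htr⟩).trans_le (min_le_left _ _)) _ _
    (AdmissibleOn.glue htr hr1 hzadm hxadm hjoin) (by simp [hr0.le]) (by
      split_ifs with h6
      · have : t + r = 1 := le_antisymm hr1 h6
        rw [← this, hjoin]
      · rfl)
  rw [AdmissibleOn.integral_glue htr hr1 hzadm hxadm hjoin, hL.integral_eq htr hzball] at h5
  have hta0 : t ∈ Icc (0 : ℝ) 1 := ⟨ha0.trans ht'.1, ht'.2.trans hb1⟩
  have htr0 : t + r ∈ Icc (0 : ℝ) 1 := ⟨ha0.trans hrmem.1, hr1⟩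
  have hsplit : ∫ s in t..1, P.lagrangian (x s, u s) =
      (∫ s in t..(t + r), P.lagrangian (x s, u s)) + ∫ s in (t + r)..1, P.lagrangian (x s, u s) :=
    (intervalIntegral.integral_add_adjacent_intervals (hLx.intervalIntegrable hta0 htr0)
      (hLx.intervalIntegrable htr0 ⟨by norm_num, le_rfl⟩)).symm
  have hIx : ∫ s in t..(t + r), P.lagrangian (x s, u s) = ∫ s in t..(t + r), l (y s, u s) := by
    have hsub' : ∀ s ∈ Icc t (t + r), s ∈ Icc a b := fun s hs => ⟨ht'.1.trans hs.1, hs.2.trans hrmem.2⟩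
    rw [← hL.integral_eq htr fun s hs => Metric.ball_subset_ball (by linarith) (hball s (hsub' s hs))]
    refine intervalIntegral.integral_congr fun s hs => ?_
    rw [uIcc_of_le htr] at hs
    rw [(extChartAt 𝓘(ℝ, E) x₀).left_inv (hsrc s (hsub' s hs))]
  have haa : a ∈ Icc a b := ⟨le_rfl, ht'.1.trans ht'.2⟩
  rw [intervalIntegral.integral_interval_sub_left (hly.intervalIntegrable haa hrmem)
    (hly.intervalIntegrable haa ht'), ← hIx]
  rw [hsplit] at h5
  linarith

end Problem

end OptimalControl

/-! ### Gluing trajectories of the Hamiltonian vector field -/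

namespace OptimalControl

section HamiltonianCurves

variable {E : Type*} [NormedAddCommGroup E] [NormedSpace ℝ E]
  {M : Type*} [TopologicalSpace M] [ChartedSpace E M] [IsManifold 𝓘(ℝ, E) ∞ M]
  {H : CotangentBundle E M → ℝ} {c c' : ℝ → CotangentBundle E M} {a b d : ℝ}

/-- `c` is a trajectory on `[a,b]` of the Hamiltonian vector field of `H`. -/
def IsHamiltonianOn (H : CotangentBundle E M → ℝ) (c : ℝ → CotangentBundle E M) (a b : ℝ) : Prop :=
  ∀ t ∈ Icc a b, ∃ w : TangentSpace (𝓘(ℝ, E).prod 𝓘(ℝ, E →L[ℝ] ℝ)) (c t),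
    IsHamiltonianVector H (c t) w ∧
    HasMFDerivWithinAt 𝓘(ℝ, ℝ) (𝓘(ℝ, E).prod 𝓘(ℝ, E →L[ℝ] ℝ)) c (Icc a b) t
      ((1 : ℝ →L[ℝ] ℝ).smulRight w)

/-- Nondegeneracy of the symplectic form. It forces the one-sided derivatives of two trajectories
meeting at a point to agree. -/
theorem IsHamiltonianVector.unique {p : CotangentBundle E M}
    {w w' : TangentSpace (𝓘(ℝ, E).prod 𝓘(ℝ, E →L[ℝ] ℝ)) p} (h : IsHamiltonianVector H p w)
    (h' : IsHamiltonianVector H p w') : w = w' := by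
  obtain ⟨v, π⟩ : E × (E →L[ℝ] ℝ) := w
  obtain ⟨v', π'⟩ : E × (E →L[ℝ] ℝ) := w'
  have key : ∀ e : E, ∀ ϖ : E →L[ℝ] ℝ, ϖ v - π e = ϖ v' - π' e := fun e ϖ =>
    (h (e, ϖ)).trans (h' (e, ϖ)).symm
  have h1 : v = v' := (SeparatingDual.eq_iff_forall_dual_eq (R := ℝ)).2 fun ϖ => by simpa using key 0 ϖ
  have h2 : π = π' := by
    ext e
    simpa using key e 0
  exact Prod.ext h1 h2

theorem exists_hamiltonian_congr {s s' : Set ℝ} {t : ℝ} (ht : c t = c' t)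
    (hc : c =ᶠ[𝓝[s'] t] c') (hs : s ∈ 𝓝[s'] t)
    (h : ∃ w : TangentSpace (𝓘(ℝ, E).prod 𝓘(ℝ, E →L[ℝ] ℝ)) (c' t),
      IsHamiltonianVector H (c' t) w ∧
      HasMFDerivWithinAt 𝓘(ℝ, ℝ) (𝓘(ℝ, E).prod 𝓘(ℝ, E →L[ℝ] ℝ)) c' s t
        ((1 : ℝ →L[ℝ] ℝ).smulRight w)) :
    ∃ w : TangentSpace (𝓘(ℝ, E).prod 𝓘(ℝ, E →L[ℝ] ℝ)) (c t),
      IsHamiltonianVector H (c t) w ∧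
      HasMFDerivWithinAt 𝓘(ℝ, ℝ) (𝓘(ℝ, E).prod 𝓘(ℝ, E →L[ℝ] ℝ)) c s' t
        ((1 : ℝ →L[ℝ] ℝ).smulRight w) := by
  obtain ⟨w, h1, h2⟩ := h
  have h3 := (h2.mono_of_mem_nhdsWithin hs).congr_of_eventuallyEq hc ht
  refine ⟨w, ?_, h3⟩
  rw [ht]
  exact h1

theorem IsHamiltonianOn.glue (hab : a ≤ b) (hbd : b ≤ d) (h : IsHamiltonianOn H c a b)
    (h' : IsHamiltonianOn H c' b d) (hb : c b = c' b) :
    IsHamiltonianOn H (fun t => if t ≤ b then c t else c' t) a d := by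
  set z : ℝ → CotangentBundle E M := fun t => if t ≤ b then c t else c' t with hz
  have hzl : ∀ t, t ≤ b → z t = c t := fun t ht => if_pos ht
  have hzr : ∀ t, b ≤ t → z t = c' t := fun t ht => by
    rcases ht.eq_or_lt with rfl | hlt
    · rw [hzl _ le_rfl, hb]
    · exact if_neg (not_le.2 hlt)
  intro t ht
  rcases lt_trichotomy t b with htb | rfl | htb
  · refine exists_hamiltonian_congr (s := Icc a b) (hzl t htb.le) ?_ ?_ (h t ⟨ht.1, htb.le⟩)
    · filter_upwards [nhdsWithin_le_nhds (Iio_mem_nhds htb)] with r hr using hzl r (le_of_lt hr)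
    · filter_upwards [nhdsWithin_le_nhds (Iio_mem_nhds htb), self_mem_nhdsWithin] with r hr hr'
      exact ⟨hr'.1, le_of_lt hr⟩
  · have hl := exists_hamiltonian_congr (s := Icc a t) (s' := Icc a t) (hzl t le_rfl)
      (eventually_of_mem self_mem_nhdsWithin fun r hr => hzl r hr.2) self_mem_nhdsWithin
      (h t ⟨hab, le_rfl⟩)
    have hr := exists_hamiltonian_congr (s := Icc t d) (s' := Icc t d) (hzr t le_rfl)
      (eventually_of_mem self_mem_nhdsWithin fun r hr => hzr r hr.1) self_mem_nhdsWithin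
      (h' t ⟨le_rfl, hbd⟩)
    obtain ⟨w, h1, h2⟩ := hl
    obtain ⟨w', h1', h2'⟩ := hr
    obtain rfl := h1.unique h1'
    refine ⟨w, h1, ?_⟩
    have := h2.union h2'
    rwa [Icc_union_Icc_eq_Icc hab hbd] at this
  · refine exists_hamiltonian_congr (s := Icc b d) (hzr t htb.le) ?_ ?_ (h' t ⟨htb.le, ht.2⟩)
    · filter_upwards [nhdsWithin_le_nhds (Ioi_mem_nhds htb)] with r hr using hzr r (le_of_lt hr)
    · filter_upwards [nhdsWithin_le_nhds (Ioi_mem_nhds htb), self_mem_nhdsWithin] with r hr hr'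
      exact ⟨le_of_lt hr, hr'.2⟩

end HamiltonianCurves

namespace Problem

variable {E : Type*} [NormedAddCommGroup E] [NormedSpace ℝ E]
  {M : Type*} [TopologicalSpace M] [ChartedSpace E M] [IsManifold 𝓘(ℝ, E) ∞ M] {k : ℕ}
  {P : Problem E M k} {x : ℝ → M} {u : ℝ → EuclideanSpace ℝ (Fin k)} {x₀ : M} {a b ρ : ℝ}
  {F : E × EuclideanSpace ℝ (Fin k) → E} {l : E × EuclideanSpace ℝ (Fin k) → ℝ}

theorem HamiltonianIsC2.preHamiltonian_le (hH : P.HamiltonianIsC2) (p : CotangentBundle E M)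
    (v : EuclideanSpace ℝ (Fin k)) : P.preHamiltonian p v ≤ P.hamiltonian p := by
  obtain ⟨v₀, h₀⟩ := hH.1 p
  exact le_ciSup (f := fun v => P.preHamiltonian p v) ⟨_, by rintro _ ⟨v, rfl⟩; exact h₀ v⟩ v

theorem HamiltonianIsC2.contDiffAt_coord (hH : P.HamiltonianIsC2) (x₀ : M) {z : E × (E →L[ℝ] ℝ)}
    (hz : z.1 ∈ (extChartAt 𝓘(ℝ, E) x₀).target) :
    ContDiffAt ℝ 2 (fun z => P.hamiltonian (cotangentLift x₀ z)) z :=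
  ((hH.2.comp_contMDiffOn (contMDiffOn_cotangentLift x₀)).contMDiffAt
    (((isOpen_extChartAt_target x₀).prod isOpen_univ).mem_nhds ⟨hz, trivial⟩)).contDiffAt

/-- The covector with coordinates `π` in the chart at `x₀`. -/
noncomputable def coordCovector (x₀ x : M) (π : E →L[ℝ] ℝ) : TangentSpace 𝓘(ℝ, E) x →L[ℝ] ℝ :=
  (π ∘L tangentCoordChange 𝓘(ℝ, E) x x₀ x : E →L[ℝ] ℝ)

theorem totalSpace_mk_coordCovector {y : M} (hy : y ∈ (extChartAt 𝓘(ℝ, E) x₀).source)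
    (π : E →L[ℝ] ℝ) : (⟨y, coordCovector x₀ y π⟩ : CotangentBundle E M) =
      cotangentLift x₀ (extChartAt 𝓘(ℝ, E) x₀ y, π) := by
  unfold cotangentLift coordCovector
  simp only
  rw [(extChartAt 𝓘(ℝ, E) x₀).left_inv hy]

end Problem

end OptimalControl

/-! ### The Hamiltonian lift of a minimizer -/

namespace OptimalControl

namespace Problem

variable {E : Type*} [NormedAddCommGroup E] [NormedSpace ℝ E] [FiniteDimensional ℝ E]
  {M : Type*} [TopologicalSpace M] [ChartedSpace E M] [IsManifold 𝓘(ℝ, E) ∞ M] {k : ℕ}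
  {P : Problem E M k} {x : ℝ → M} {u : ℝ → EuclideanSpace ℝ (Fin k)} {x₀ : M} {a b ρ : ℝ}
  {F : E × EuclideanSpace ℝ (Fin k) → E} {l : E × EuclideanSpace ℝ (Fin k) → ℝ}

/-- Transport of a subgradient along a piece of an admissible path contained in a chart. -/
theorem exists_isHamiltonianOn_of_chart [SecondCountableTopology M] (hH : P.HamiltonianIsC2)
    (hL : P.IsLocalization x₀ ρ F l) (h : P.AdmissibleOn 0 1 x u)
    (ha0 : 0 ≤ a) (hab : a ≤ b) (hb1 : b ≤ 1)
    (hsrc : ∀ t ∈ Icc a b, x t ∈ (extChartAt 𝓘(ℝ, E) x₀).source)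
    (hball : ∀ t ∈ Icc a b, extChartAt 𝓘(ℝ, E) x₀ (x t) ∈
      Metric.ball (extChartAt 𝓘(ℝ, E) x₀ x₀) (ρ / 2)) {C : ℝ≥0}
    (hlip : LipschitzOnWith C (fun r => extChartAt 𝓘(ℝ, E) x₀ (x r)) (Icc a b))
    {R K : ℝ} (hR : ∀ t ∈ Icc a b, ‖(extChartAt 𝓘(ℝ, E) x₀ (x t), u t)‖ ≤ R) (hK0 : 0 ≤ K)
    (hK : ∀ v, ‖v‖ ≤ R → ∀ y y', ‖F (y, v) - F (y', v)‖ ≤ K * ‖y - y'‖)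
    (hshort : K * (b - a) ≤ 1 / 2) {q : TangentSpace 𝓘(ℝ, E) (x a) →L[ℝ] ℝ}
    (hq : P.IsSubgradientAt x u a q) :
    ∃ Q : ∀ t, TangentSpace 𝓘(ℝ, E) (x t) →L[ℝ] ℝ, Q a = q ∧ P.IsSubgradientAt x u b (Q b) ∧
      IsHamiltonianOn P.hamiltonian (fun r => ⟨x r, Q r⟩) a b := by
  have : ProperSpace E := FiniteDimensional.proper ℝ E
  have : FiniteDimensional ℝ (E →L[ℝ] ℝ) := inferInstance
  have : ProperSpace (E →L[ℝ] ℝ) := FiniteDimensional.proper ℝ _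
  have hρ := hL.pos
  set y : ℝ → E := fun r => extChartAt 𝓘(ℝ, E) x₀ (x r) with hydef
  have haI : a ∈ Icc a b := ⟨le_rfl, hab⟩
  have hball' : ∀ t ∈ Icc a b, y t ∈ Metric.ball (extChartAt 𝓘(ℝ, E) x₀ x₀) ρ :=
    fun t ht => Metric.ball_subset_ball (by linarith) (hball t ht)
  have hab' : P.AdmissibleOn a b x u := h.mono ha0 hb1
  have hu := hab'.control
  have hyc : ContinuousOn y (Icc a b) := hlip.continuousOn
  have hy := hL.isPrimitiveOn_coord hab' hsrc hball' hlip
  have hFb := hL.bddMeasOn_F hu hyc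
  have hlb := hL.bddMeasOn_l hu hyc
  have hc : BddMeasOn (fun t => (y t, u t)) a b := (BddMeasOn.of_continuousOn hyc).prodMk hu
  have hRu : ∀ t ∈ Icc a b, ‖u t‖ ≤ R := fun t ht => (norm_snd_le _).trans (hR t ht)
  have hGK : ∀ z : E × EuclideanSpace ℝ (Fin k), ‖z‖ ≤ R → ∀ p p',
      ‖adjointField F l (p, z) - adjointField F l (p', z)‖ ≤ K * ‖p - p'‖ := fun z hz p p' =>
    norm_adjointField_sub_le hK0 hL.contDiff_F (hK z.2 ((norm_snd_le z).trans hz)) z.1 p p'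
  obtain ⟨p, hpc, hpa, hp⟩ := exists_isPrimitiveOn (G := adjointField F l)
    (continuous_adjointField hL.contDiff_F hL.contDiff_l) hc hR hK0 hGK hshort haI
    ((q : E →L[ℝ] ℝ) ∘L tangentCoordChange 𝓘(ℝ, E) x₀ (x a) (x a))
  have hpb : BddMeasOn (fun t => adjointField F l (p t, (y t, u t))) a b :=
    ((BddMeasOn.of_continuousOn hpc.continuousOn).prodMk hc).comp
      (continuous_adjointField hL.contDiff_F hL.contDiff_l)
  -- Transport is applied on each `[a, t]`, since maximality is needed at almost every intermediate
  -- time and not only at `b`.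
  have hsub : ∀ t ∈ Icc a b, P.IsCoordSubgradientAt x u x₀ t (p t) := fun t ht => by
    have hs : ∀ s ∈ Icc a t, s ∈ Icc a b := fun s hs => ⟨hs.1, hs.2.trans ht.2⟩
    refine IsCoordSubgradientAt.transport hL h ha0 ht.1 (ht.2.trans hb1)
      (fun s h' => hsrc s (hs s h')) (fun s h' => hball s (hs s h'))
      (hyc.mono fun s h' => hs s h') (hy.mono hFb le_rfl ht.1 ht.2)
      (fun s h' => hRu s (hs s h')) hK0 hK
      ((mul_le_mul_of_nonneg_left (by linarith [ht.2]) hK0).trans hshort) hpc.continuousOn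
      (hp.mono hpb le_rfl ht.1 ht.2) ?_
    rw [hpa]
    exact hq.coord (hsrc a haI)
  set Hc : E × (E →L[ℝ] ℝ) → ℝ := fun z => P.hamiltonian (cotangentLift x₀ z) with hHc
  have hHd : ∀ t ∈ Icc a b, ContDiffAt ℝ 2 Hc (y t, p t) := fun t ht =>
    hH.contDiffAt_coord x₀ ((extChartAt 𝓘(ℝ, E) x₀).map_source (hsrc t ht))
  have hfd : ContinuousOn (fun t => fderiv ℝ Hc (y t, p t)) (Icc a b) := fun t ht => by
    have h1 : ContinuousAt (fderiv ℝ Hc) (y t, p t) :=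
      ((hHd t ht).fderiv_right (m := 0) (by norm_num)).continuousAt
    exact h1.comp_continuousWithinAt (f := fun t => (y t, p t))
      ((hyc t ht).prodMk hpc.continuousWithinAt)
  have hJ := (isPrimitiveOn_integral (fun t => l (y t, u t)) a b).ae_hasDerivAt hlb
  have hae : ∀ᵐ t, t ∈ Ioo a b → ∀ w π, fderiv ℝ Hc (y t, p t) (w, π) =
      π (F (y t, u t)) - adjointField F l (p t, (y t, u t)) w := by
    filter_upwards [hy.ae_hasDerivAt hFb, hJ] with t h1 h2 ht
    have ht' := Ioo_subset_Icc_self ht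
    have hmax := IsCoordSubgradientAt.maximality hL h ha0 hb1 hsrc hball hyc ht (h1 ht) (h2 ht)
      (hsub t ht')
    have hpre : ∀ z : E × (E →L[ℝ] ℝ), z.1 ∈ Metric.ball (extChartAt 𝓘(ℝ, E) x₀ x₀) ρ → ∀ v,
        P.preHamiltonian (cotangentLift x₀ z) v = z.2 (F (z.1, v)) - l (z.1, v) := fun z hz v => by
      rw [preHamiltonian_cotangentLift, hL.eq_F _ hz, hL.eq_l _ hz]
    refine fderiv_eq_of_maximality hL.contDiff_F hL.contDiff_l
      ((hHd t ht').differentiableAt two_ne_zero) ?_ ?_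
    · filter_upwards [continuousAt_fst.eventually (Metric.isOpen_ball.mem_nhds (hball' t ht'))]
        with z hz
      rw [← hpre z hz]
      exact hH.preHamiltonian_le _ _
    · refine le_antisymm (ciSup_le fun v => ?_) ?_
      · rw [hpre _ (hball' t ht')]
        exact hmax v
      · rw [← hpre (y t, p t) (hball' t ht')]
        exact hH.preHamiltonian_le _ _
  refine ⟨fun t => coordCovector x₀ (x t) (p t), ?_, ?_, fun t ht => ?_⟩
  · simp only [coordCovector]
    rw [hpa]
    ext e
    exact congrArg (q : E →L[ℝ] ℝ) (DFunLike.congr_fun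
      (tangentCoordChange_comp_inverse (mem_extChartAt_source (x a)) (hsrc a haI)) e)
  · exact (hsub b ⟨hab, le_rfl⟩).of_coord (hsrc b ⟨hab, le_rfl⟩)
  · obtain ⟨w, π, h1, h2, h3⟩ := exists_hasDerivWithinAt_hamilton hy hp hfd hae ht
    exact exists_isHamiltonianVector (hH.2.mdifferentiable two_ne_zero) (x₀ := x₀)
      (c := fun r => (y r, p r)) (h1.prodMk h2) ht
      ((extChartAt 𝓘(ℝ, E) x₀).map_source (hsrc t ht))
      (fun r hr => totalSpace_mk_coordCovector (hsrc r hr) (p r)) h3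

/-- Near `t₀` one localization and one set of constants serve all subintervals; compactness of `[0,
1]` can then provide a uniform step. -/
theorem exists_transport_radius [SecondCountableTopology M] (hH : P.HamiltonianIsC2)
    (h : P.AdmissibleOn 0 1 x u) {t₀ : ℝ} (ht₀ : t₀ ∈ Icc (0 : ℝ) 1) :
    ∃ δ > 0, ∀ a b : ℝ, 0 ≤ a → a ≤ b → b ≤ 1 → |a - t₀| < δ → |b - t₀| < δ →
      ∀ q : TangentSpace 𝓘(ℝ, E) (x a) →L[ℝ] ℝ, P.IsSubgradientAt x u a q →
      ∃ Q : ∀ t, TangentSpace 𝓘(ℝ, E) (x t) →L[ℝ] ℝ, Q a = q ∧ P.IsSubgradientAt x u b (Q b) ∧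
        IsHamiltonianOn P.hamiltonian (fun r => ⟨x r, Q r⟩) a b := by
  obtain ⟨ρ, F, l, hL⟩ := P.exists_isLocalization (x t₀)
  have hρ := hL.pos
  obtain ⟨C, s, hs, hC⟩ := h.lipschitz_path t₀ ht₀
  obtain ⟨R, hR⟩ := h.control.2
  -- The bound must hold for the pair `(y t, u t)`, which is the time-dependent parameter of the
  -- adjoint equation.
  set R' := max R (‖extChartAt 𝓘(ℝ, E) (x t₀) (x t₀)‖ + ρ) with hR'
  obtain ⟨K, hK0, hK⟩ := hL.lipschitz R'
  have h1 : ∀ᶠ r in 𝓝[Icc 0 1] t₀, r ∈ s ∧ x r ∈ (extChartAt 𝓘(ℝ, E) (x t₀)).source ∧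
      extChartAt 𝓘(ℝ, E) (x t₀) (x r) ∈
        Metric.ball (extChartAt 𝓘(ℝ, E) (x t₀) (x t₀)) (ρ / 2) := by
    have hx := h.continuous_path t₀ ht₀
    refine (eventually_mem_set.2 hs).and ((hx.eventually
      ((isOpen_extChartAt_source (x t₀)).mem_nhds (mem_extChartAt_source (x t₀)))).and ?_)
    exact ((continuousAt_extChartAt (x t₀)).tendsto.comp hx).eventually
      (Metric.ball_mem_nhds _ (by positivity))
  obtain ⟨δ, hδ, hδ'⟩ := Metric.eventually_nhds_iff.1 (eventually_nhdsWithin_iff.1 h1)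
  -- Then `b - a ≤ 2 / (4 * (K + 1))`, which gives `K * (b - a) ≤ 1 / 2`; `K + 1` avoids dividing by
  -- zero.
  refine ⟨min δ (1 / (4 * (K + 1))), by positivity, fun a b ha hab hb had hbd q hq => ?_⟩
  have hmem : ∀ r ∈ Icc a b, r ∈ s ∧ x r ∈ (extChartAt 𝓘(ℝ, E) (x t₀)).source ∧
      extChartAt 𝓘(ℝ, E) (x t₀) (x r) ∈
        Metric.ball (extChartAt 𝓘(ℝ, E) (x t₀) (x t₀)) (ρ / 2) := fun r hr => by
    refine hδ' ?_ ⟨ha.trans hr.1, hr.2.trans hb⟩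
    rw [Real.dist_eq]
    have ha' := abs_lt.1 (had.trans_le (min_le_left _ _))
    have hb' := abs_lt.1 (hbd.trans_le (min_le_left _ _))
    rw [abs_lt]
    constructor <;> linarith [hr.1, hr.2]
  refine exists_isHamiltonianOn_of_chart hH hL h ha hab hb (fun t ht => (hmem t ht).2.1)
    (fun t ht => (hmem t ht).2.2) (hC.mono fun t ht => (hmem t ht).1) (R := R')
    (fun t ht => ?_) hK0 hK ?_ hq
  · refine max_le ?_ ((hR t ⟨ha.trans ht.1, ht.2.trans hb⟩).trans (le_max_left _ _))
    have h2 := (hmem t ht).2.2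
    rw [Metric.mem_ball, dist_eq_norm] at h2
    refine le_trans ?_ (le_max_right _ _)
    simp only
    linarith [norm_le_norm_add_norm_sub' (extChartAt 𝓘(ℝ, E) (x t₀) (x t))
      (extChartAt 𝓘(ℝ, E) (x t₀) (x t₀))]
  · have ha' := abs_lt.1 (had.trans_le (min_le_right _ _))
    have hb' := abs_lt.1 (hbd.trans_le (min_le_right _ _))
    have h3 : b - a ≤ 2 * (1 / (4 * (K + 1))) := by linarith
    calc K * (b - a) ≤ (K + 1) * (2 * (1 / (4 * (K + 1)))) := by
          apply mul_le_mul (by linarith) h3 (by linarith) (by linarith)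
      _ = 1 / 2 := by field_simp; norm_num

theorem exists_hamiltonian_lift [SecondCountableTopology M] (hH : P.HamiltonianIsC2)
    (h : P.AdmissibleOn 0 1 x u) {q : TangentSpace 𝓘(ℝ, E) (x 0) →L[ℝ] ℝ}
    (hq : P.IsSubgradientAt x u 0 q) :
    ∃ p : ℝ → CotangentBundle E M, (∀ t, (p t).1 = x t) ∧
      IsHamiltonianTrajectory P.hamiltonian p := by
  choose! δ hδ hstep using fun t₀ (ht₀ : t₀ ∈ Icc (0 : ℝ) 1) => exists_transport_radius hH h ht₀
  obtain ⟨η, hη, hη'⟩ := lebesgue_number_lemma_of_metric (s := Icc (0 : ℝ) 1)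
    (c := fun i : Icc (0 : ℝ) 1 => Metric.ball (i : ℝ) (δ i)) isCompact_Icc
    (fun i => Metric.isOpen_ball)
    fun t ht => mem_iUnion.2 ⟨⟨t, ht⟩, Metric.mem_ball_self (hδ t ht)⟩
  have hshort : ∀ a b : ℝ, 0 ≤ a → a ≤ b → b ≤ 1 → b - a < η →
      ∀ q : TangentSpace 𝓘(ℝ, E) (x a) →L[ℝ] ℝ, P.IsSubgradientAt x u a q →
      ∃ Q : ∀ t, TangentSpace 𝓘(ℝ, E) (x t) →L[ℝ] ℝ, Q a = q ∧ P.IsSubgradientAt x u b (Q b) ∧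
        IsHamiltonianOn P.hamiltonian (fun r => ⟨x r, Q r⟩) a b := by
    intro a b ha hab hb hba q hq
    obtain ⟨i, hi⟩ := hη' a ⟨ha, hab.trans hb⟩
    refine hstep i i.2 a b ha hab hb ?_ ?_ q hq
    · exact hi (Metric.mem_ball_self hη)
    · exact hi (by rw [Metric.mem_ball, Real.dist_eq, abs_of_nonneg (by linarith)]; exact hba)
  -- Steps of length `η / 2`, truncated at time `1`, stay below the Lebesgue number; the final
  -- covector of each piece starts the next.
  have key : ∀ n : ℕ, ∃ Q : ∀ t, TangentSpace 𝓘(ℝ, E) (x t) →L[ℝ] ℝ,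
      P.IsSubgradientAt x u (min (n * (η / 2)) 1) (Q (min (n * (η / 2)) 1)) ∧
      IsHamiltonianOn P.hamiltonian (fun r => ⟨x r, Q r⟩) 0 (min (n * (η / 2)) 1) := by
    intro n
    induction n with
    | zero =>
      obtain ⟨Q, -, h2, h3⟩ := hshort 0 0 le_rfl le_rfl zero_le_one (by simpa using hη) q hq
      have : min (((0 : ℕ) : ℝ) * (η / 2)) 1 = 0 := by simp
      rw [this]
      exact ⟨Q, h2, h3⟩
    | succ n ih =>
      obtain ⟨Q, h2, h3⟩ := ih
      set a := min ((n : ℝ) * (η / 2)) 1 with ha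
      set b := min (((n + 1 : ℕ) : ℝ) * (η / 2)) 1 with hb
      have ha0 : 0 ≤ a := le_min (by positivity) zero_le_one
      have hab : a ≤ b := min_le_min_right _ (by push_cast; nlinarith)
      have hba : b - a < η := by
        have : b ≤ a + η / 2 := by
          rw [ha, hb, min_add_add_right (n * (η / 2)) 1 (η / 2)|>.symm]
          exact min_le_min (by push_cast; linarith) (by linarith)
        linarith
      obtain ⟨Q', h4, h5, h6⟩ := hshort a b ha0 hab (min_le_right _ _) hba _ h2
      have hg := h3.glue ha0 hab h6 (by rw [h4])
      refine ⟨fun t => if t ≤ a then Q t else Q' t, ?_, ?_⟩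
      · simp only
        split_ifs with hle
        · have e : b = a := le_antisymm hle hab
          have : Q b = Q' b := by rw [e]; exact h4.symm
          rw [this]; exact h5
        · exact h5
      · convert hg using 2 with r
        split_ifs with hr <;> simp [hr]
  obtain ⟨n, hn⟩ := exists_nat_gt (1 / (η / 2))
  obtain ⟨Q, -, h3⟩ := key n
  have : min ((n : ℝ) * (η / 2)) 1 = 1 := min_eq_right (by
    rw [div_lt_iff₀ (by positivity)] at hn; exact hn.le)
  rw [this] at h3
  exact ⟨_, fun t => rfl, h3⟩

/-- A minimizer whose initial point is a point of subdifferentiability of the cost is normal. -/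
theorem IsMinimizer.isNormalMinimizer [SecondCountableTopology M] (hH : P.HamiltonianIsC2)
    {y z : M} (h : P.IsMinimizer x y z) {ψ : M → ℝ} (hψ : MDifferentiableAt 𝓘(ℝ, E) 𝓘(ℝ, ℝ) ψ y)
    (hle : ∀ᶠ w in 𝓝 y, ((ψ w - ψ y : ℝ) : EReal) + P.cost y z ≤ P.cost w z) :
    P.IsNormalMinimizer x y z := by
  refine ⟨h, ?_⟩
  obtain ⟨rfl, rfl, u, hu, hc⟩ := h
  have hu' := P.isAdmissible_iff.1 hu
  let D : E →L[ℝ] ℝ := mfderiv 𝓘(ℝ, E) 𝓘(ℝ, ℝ) ψ (x 0)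
  -- The action of any competitor from `w` is at least the cost from `w`, while the minimizer's
  -- action equals its cost; hence `ψ` is a test function for the cost to go at time `0`.
  obtain ⟨p, hp, hp'⟩ := exists_hamiltonian_lift hH hu'
    (q := (-D : E →L[ℝ] ℝ)) ⟨ψ, hψ.hasMFDerivAt.congr_mfderiv (neg_neg D).symm, by
      filter_upwards [hle] with w hw ζ v hζ hζ0 hζ1
      have h1 : P.cost w (x 1) ≤ (P.action ζ v : ℝ) :=
        iInf_le_of_le ζ (iInf_le_of_le v (iInf_le_of_le ⟨P.isAdmissible_iff.2 hζ, hζ0, hζ1⟩ le_rfl))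
      rw [← hc] at hw
      have h2 := hw.trans h1
      rw [← EReal.coe_add, EReal.coe_le_coe_iff] at h2
      unfold action at h2
      linarith⟩
  exact ⟨p, fun t _ => hp t, hp'⟩

end Problem

end OptimalControl

/-! ### Cyclical monotonicity of optimal plans -/

namespace OptimalControl

section CyclicalMonotonicity

variable {X Y : Type*} [MeasurableSpace X] [MeasurableSpace Y]

theorem map_finsetSum {ι : Type*} {f : X → Y} (hf : Measurable f) (s : Finset ι)
    (m : ι → Measure X) : (∑ i ∈ s, m i).map f = ∑ i ∈ s, (m i).map f := by
  simp only [← Measure.mapₗ_apply_of_measurable hf, map_sum]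

/-- The marginals of a redistribution `ρ + λ ∑ αᵢ₊₁ ⊗ βᵢ` do not depend on the permutation. -/
theorem map_add_smul_sum_prod {ι : Type*} [Fintype ι] (ρ : Measure (X × Y)) (c : ℝ≥0∞)
    (m : ι → Measure (X × Y)) [∀ i, IsProbabilityMeasure (m i)] (σ : Equiv.Perm ι) :
    (ρ + c • ∑ i, ((m (σ i)).map Prod.fst).prod ((m i).map Prod.snd)).map Prod.fst =
        (ρ + c • ∑ i, m i).map Prod.fst ∧
      (ρ + c • ∑ i, ((m (σ i)).map Prod.fst).prod ((m i).map Prod.snd)).map Prod.snd =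
        (ρ + c • ∑ i, m i).map Prod.snd := by
  have h1 : ∀ i, IsProbabilityMeasure ((m i).map Prod.fst) := fun i =>
    Measure.isProbabilityMeasure_map measurable_fst.aemeasurable
  have h2 : ∀ i, IsProbabilityMeasure ((m i).map Prod.snd) := fun i =>
    Measure.isProbabilityMeasure_map measurable_snd.aemeasurable
  constructor
  · simp only [Measure.map_add _ _ measurable_fst, Measure.map_smul,
      map_finsetSum measurable_fst, Measure.map_fst_prod, measure_univ, one_smul]
    rw [Equiv.sum_comp σ fun i => (m i).map Prod.fst]
  · simp only [Measure.map_add _ _ measurable_snd, Measure.map_smul,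
      map_finsetSum measurable_snd, Measure.map_snd_prod, measure_univ, one_smul]

variable [TopologicalSpace X] [TopologicalSpace Y] [SecondCountableTopology Y]
  [BorelSpace X] [BorelSpace Y]

/-- The support of an optimal plan is cyclically monotone. -/
theorem sum_le_sum_perm_of_optimal {C : X × Y → ℝ} (hC : Continuous C) {b : ℝ}
    (hb : ∀ z, b ≤ C z) {γ : Measure (X × Y)} [IsProbabilityMeasure γ] (hint : Integrable C γ)
    (hopt : ∀ γ' : Measure (X × Y), γ'.map Prod.fst = γ.map Prod.fst →
      γ'.map Prod.snd = γ.map Prod.snd → Integrable C γ' → ∫ z, C z ∂γ ≤ ∫ z, C z ∂γ')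
    {ι : Type*} [Fintype ι] {z : ι → X × Y} (hz : ∀ i, z i ∈ γ.support) (σ : Equiv.Perm ι) :
    ∑ i, C (z i) ≤ ∑ i, C ((z (σ i)).1, (z i).2) := by
  by_contra! hlt
  have hne : Nonempty ι := by
    by_contra hι
    rw [not_nonempty_iff] at hι
    simp at hlt
  set n : ℝ := (Fintype.card ι : ℝ) with hn
  have hn0 : 0 < n := by rw [hn]; exact_mod_cast Fintype.card_pos
  set δ := ∑ i, C (z i) - ∑ i, C ((z (σ i)).1, (z i).2) with hδ
  have hδ0 : 0 < δ := sub_pos.2 hlt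
  -- The `2 * n` errors add up to `δ / 2`, less than the assumed gain `δ`.
  set ε := δ / (4 * n) with hε
  have hε0 : 0 < ε := by positivity
  have h1 : ∀ i, ∃ U V, IsOpen U ∧ (z i).1 ∈ U ∧ IsOpen V ∧ (z i).2 ∈ V ∧
      U ×ˢ V ⊆ {w | C (z i) - ε < C w} := fun i => mem_nhds_prod_iff'.1
    (hC.continuousAt.eventually (lt_mem_nhds (by linarith)))
  have h2 : ∀ i, ∃ U V, IsOpen U ∧ (z (σ i)).1 ∈ U ∧ IsOpen V ∧ (z i).2 ∈ V ∧
      U ×ˢ V ⊆ {w | C w < C ((z (σ i)).1, (z i).2) + ε} := fun i => mem_nhds_prod_iff'.1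
    (hC.continuousAt.eventually (gt_mem_nhds (by linarith)))
  choose A B hA hzA hB hzB hAB using h1
  choose A' B' hA' hzA' hB' hzB' hAB' using h2
  -- The first coordinate of `z i` occurs in the original pair `i` and in the rematched pair `σ.symm
  -- i`; its neighbourhood must serve both.
  set U : ι → Set X := fun i => A i ∩ A' (σ.symm i) with hU
  set V : ι → Set Y := fun i => B i ∩ B' i with hV
  have hUo : ∀ i, IsOpen (U i) := fun i => (hA i).inter (hA' _)
  have hVo : ∀ i, IsOpen (V i) := fun i => (hB i).inter (hB' _)
  have hzU : ∀ i, (z i).1 ∈ U i := fun i => ⟨hzA i, by simpa using hzA' (σ.symm i)⟩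
  have hzV : ∀ i, (z i).2 ∈ V i := fun i => ⟨hzB i, hzB' i⟩
  have hpos : ∀ i, γ (U i ×ˢ V i) ≠ 0 := fun i =>
    (Measure.mem_support_iff_forall _ |>.1 (hz i) _ (((hUo i).prod (hVo i)).mem_nhds
      ⟨hzU i, hzV i⟩)).ne'
  have hms : ∀ i, MeasurableSet (U i ×ˢ V i) := fun i =>
    (hUo i).measurableSet.prod (hVo i).measurableSet
  set m : ι → Measure (X × Y) := fun i => ProbabilityTheory.cond γ (U i ×ˢ V i) with hm
  have hmP : ∀ i, IsProbabilityMeasure (m i) := fun i =>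
    ProbabilityTheory.cond_isProbabilityMeasure (hpos i)
  have hmU : ∀ i, ∀ᵐ w ∂(m i), w ∈ U i ×ˢ V i := fun i => ProbabilityTheory.ae_cond_mem (hms i)
  have hmγ : ∀ i, m i ≤ (γ (U i ×ˢ V i))⁻¹ • γ := fun i => by
    simp only [hm, ProbabilityTheory.cond]
    gcongr
    exact Measure.restrict_le_self
  -- Each normalized restriction is at most `(γ (U i ×ˢ V i))⁻¹ • γ`, so dividing their sum by `S`
  -- gives a measure below `γ` that can be removed and rematched.
  set S : ℝ≥0∞ := ∑ i, (γ (U i ×ˢ V i))⁻¹ with hS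
  have hStop : S ≠ ⊤ := ENNReal.sum_ne_top.2 fun i _ => ENNReal.inv_ne_top.2 (hpos i)
  have hS0 : S ≠ 0 := by
    obtain ⟨i⟩ := hne
    have h3 : (γ (U i ×ˢ V i))⁻¹ ≤ S :=
      Finset.single_le_sum (f := fun i => (γ (U i ×ˢ V i))⁻¹) (fun _ _ => zero_le) (Finset.mem_univ i)
    intro h4
    rw [h4, nonpos_iff_eq_zero, ENNReal.inv_eq_zero] at h3
    exact measure_ne_top _ _ h3
  set κ : Measure (X × Y) := S⁻¹ • ∑ i, m i with hκ
  have hκγ : κ ≤ γ := by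
    calc κ ≤ S⁻¹ • ∑ i, (γ (U i ×ˢ V i))⁻¹ • γ := by
          rw [hκ]; gcongr with i; exact hmγ i
      _ = γ := by
          rw [← Finset.sum_smul, smul_smul, ENNReal.inv_mul_cancel hS0 hStop, one_smul]
  have : IsFiniteMeasure κ := isFiniteMeasure_of_le γ hκγ
  set ρ := γ - κ with hρ
  have hγ : ρ + κ = γ := Measure.sub_add_cancel_of_le hκγ
  set m' : ι → Measure (X × Y) := fun i => ((m (σ i)).map Prod.fst).prod ((m i).map Prod.snd) with hm'
  have hP1 : ∀ i, IsProbabilityMeasure ((m i).map Prod.fst) := fun i =>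
    Measure.isProbabilityMeasure_map measurable_fst.aemeasurable
  have hP2 : ∀ i, IsProbabilityMeasure ((m i).map Prod.snd) := fun i =>
    Measure.isProbabilityMeasure_map measurable_snd.aemeasurable
  have hm'U : ∀ i, ∀ᵐ w ∂(m' i), w ∈ U (σ i) ×ˢ V i := fun i => by
    have h3 : ∀ᵐ a ∂((m (σ i)).map Prod.fst), a ∈ U (σ i) :=
      (ae_map_iff measurable_fst.aemeasurable (hUo _).measurableSet).2
        ((hmU (σ i)).mono fun w hw => hw.1)
    have h4 : ∀ᵐ a ∂((m i).map Prod.snd), a ∈ V i :=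
      (ae_map_iff measurable_snd.aemeasurable (hVo _).measurableSet).2
        ((hmU i).mono fun w hw => hw.2)
    filter_upwards [Measure.quasiMeasurePreserving_fst.ae h3,
      Measure.quasiMeasurePreserving_snd.ae h4] with w h5 h6 using ⟨h5, h6⟩
  obtain ⟨e1, e2⟩ := map_add_smul_sum_prod ρ S⁻¹ m σ
  rw [← hκ, hγ] at e1 e2
  have hCm : ∀ η : Measure (X × Y), AEStronglyMeasurable C η := fun η =>
    hC.aestronglyMeasurable
  have hintm : ∀ i, Integrable C (m i) := fun i =>
    (hint.smul_measure (ENNReal.inv_ne_top.2 (hpos i))).mono_measure (hmγ i)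
  have hup : ∀ i, ∀ᵐ w ∂(m' i), C w ≤ C ((z (σ i)).1, (z i).2) + ε := fun i => by
    filter_upwards [hm'U i] with w hw
    exact le_of_lt (hAB' i ⟨by simpa using hw.1.2, hw.2.2⟩)
  have hintm' : ∀ i, Integrable C (m' i) := fun i => by
    refine Integrable.of_bound (hCm _) (max |b| |C ((z (σ i)).1, (z i).2) + ε|) ?_
    filter_upwards [hup i] with w hw
    exact abs_le_max_abs_abs (hb w) hw
  have hSi : S⁻¹ ≠ ⊤ := ENNReal.inv_ne_top.2 hS0
  have hintρ : Integrable C ρ := hint.mono_measure Measure.sub_le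
  have hsum : Integrable C (∑ i, m i) := integrable_finsetSum_measure.2 fun i _ => hintm i
  have hsum' : Integrable C (∑ i, m' i) := integrable_finsetSum_measure.2 fun i _ => hintm' i
  have key := hopt _ e1 e2 (hintρ.add_measure (hsum'.smul_measure hSi))
  have e3 : ∫ w, C w ∂γ = ∫ w, C w ∂ρ + S⁻¹.toReal * ∑ i, ∫ w, C w ∂(m i) := by
    conv_lhs => rw [← hγ]
    rw [integral_add_measure hintρ (hsum.smul_measure hSi), integral_smul_measure,
      integral_finsetSum_measure fun i _ => hintm i, smul_eq_mul]
  rw [integral_add_measure hintρ (hsum'.smul_measure hSi), integral_smul_measure,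
      integral_finsetSum_measure fun i _ => hintm' i, smul_eq_mul, e3] at key
  have hSpos : 0 < S⁻¹.toReal := ENNReal.toReal_pos (ENNReal.inv_ne_zero.2 hStop) hSi
  have key' : ∑ i, ∫ w, C w ∂(m i) ≤ ∑ i, ∫ w, C w ∂(m' i) :=
    le_of_mul_le_mul_left (by linarith) hSpos
  have l1 : ∀ i, C (z i) - ε ≤ ∫ w, C w ∂(m i) := fun i => by
    have : ∫ _, (C (z i) - ε) ∂(m i) ≤ ∫ w, C w ∂(m i) := by
      refine integral_mono_ae (integrable_const _) (hintm i) ?_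
      filter_upwards [hmU i] with w hw
      exact le_of_lt (hAB i ⟨hw.1.1, hw.2.1⟩)
    simpa using this
  have l2 : ∀ i, ∫ w, C w ∂(m' i) ≤ C ((z (σ i)).1, (z i).2) + ε := fun i => by
    have : ∫ w, C w ∂(m' i) ≤ ∫ _, (C ((z (σ i)).1, (z i).2) + ε) ∂(m' i) :=
      integral_mono_ae (hintm' i) (integrable_const _) (hup i)
    simpa using this
  have l3 := (Finset.sum_le_sum fun i (_ : i ∈ Finset.univ) => l1 i).trans
    (key'.trans (Finset.sum_le_sum fun i _ => l2 i))
  rw [Finset.sum_sub_distrib, Finset.sum_add_distrib, Finset.sum_const, nsmul_eq_mul,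
    Finset.card_univ, ← hn] at l3
  have e4 : n * ε = δ / 4 := by rw [hε]; field_simp
  linarith

end CyclicalMonotonicity

/-! ### Potentials from nonnegative cycles -/

section Potential

/-- Nonnegative cycles yield a potential. -/
theorem exists_potential {α : Type*} (D : α → α → ℝ)
    (hD : ∀ (n : ℕ) (v : ℕ → α), v n = v 0 → 0 ≤ ∑ i ∈ Finset.range n, D (v i) (v (i + 1))) :
    ∃ f : α → ℝ, ∀ x z, f z ≤ f x + D x z := by
  rcases isEmpty_or_nonempty α with _ | ⟨⟨x₀⟩⟩
  · exact ⟨fun _ => 0, fun x => isEmptyElim x⟩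
  -- The potential at `z` is the least cost of a chain from the base point `x₀` to `z`.
  let S : α → Set ℝ := fun z => {r | ∃ (n : ℕ) (v : ℕ → α), v 0 = x₀ ∧ v n = z ∧
    r = ∑ i ∈ Finset.range n, D (v i) (v (i + 1))}
  have hext : ∀ x z, ∀ r ∈ S x, r + D x z ∈ S z := by
    rintro x z _ ⟨n, v, h0, h1, rfl⟩
    refine ⟨n + 1, Function.update v (n + 1) z, by simp [h0], by simp, ?_⟩
    rw [Finset.sum_range_succ]
    congr 1
    · refine Finset.sum_congr rfl fun i hi => ?_
      rw [Finset.mem_range] at hi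
      rw [Function.update_of_ne (by omega), Function.update_of_ne (by omega)]
    · rw [Function.update_of_ne (by omega), Function.update_self, h1]
  have hcycle : ∀ r ∈ S x₀, 0 ≤ r := by
    rintro _ ⟨n, v, h0, h1, rfl⟩
    exact hD n v (h1.trans h0.symm)
  -- Closing a chain by the edge from `z` back to `x₀` gives a nonnegative cycle.
  have hbdd : ∀ z, BddBelow (S z) := fun z =>
    ⟨-D z x₀, fun r hr => by linarith [hcycle _ (hext z x₀ r hr)]⟩
  have hne : ∀ z, (S z).Nonempty := fun z =>
    ⟨0 + D x₀ z, hext x₀ z 0 ⟨0, fun _ => x₀, rfl, rfl, by simp⟩⟩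
  refine ⟨fun z => sInf (S z), fun x z => ?_⟩
  rw [← sub_le_iff_le_add]
  refine le_csInf (hne x) fun r hr => ?_
  linarith [csInf_le (hbdd z) (hext x z r hr)]

/-- A closed chain becomes a sum over a cyclic permutation, the form to which cyclical monotonicity
applies. -/
theorem sum_range_eq_sum_finRotate {α : Type*} (D : α → α → ℝ) {n : ℕ} {v : ℕ → α}
    (hv : v (n + 1) = v 0) : ∑ i ∈ Finset.range (n + 1), D (v i) (v (i + 1)) =
      ∑ i : Fin (n + 1), D (v i) (v (finRotate (n + 1) i)) := by
  rw [Finset.sum_range]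
  refine Finset.sum_congr rfl fun i _ => ?_
  rcases Fin.eq_castSucc_or_eq_last i with ⟨j, rfl⟩ | rfl
  · rw [finRotate_apply]
    simp
  · rw [finRotate_last]
    simp [hv]

end Potential

end OptimalControl

/-! ### Finite plan costs and the Kantorovich potential -/

namespace OptimalControl

section PlanCost

variable {M : Type*} [MeasurableSpace M]

/-- The lower bound makes the negative part finite, so a plan cost below `⊤` forces the positive
part to be finite as well. -/
theorem integrable_of_planCost_lt_top {C : M × M → ℝ} {γ : Measure (M × M)} [IsFiniteMeasure γ]
    (hC : AEStronglyMeasurable C γ) {b : ℝ} (hb : ∀ z, b ≤ C z)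
    (h : planCost (fun x y => (C (x, y) : EReal)) γ < ⊤) : Integrable C γ := by
  have h1 : ∫⁻ z, ENNReal.ofReal (-C z) ∂γ ≠ ⊤ := by
    refine ne_top_of_le_ne_top (b := ∫⁻ _, ENNReal.ofReal (-b) ∂γ) ?_
      (lintegral_mono fun z => ENNReal.ofReal_le_ofReal (neg_le_neg (hb z)))
    rw [lintegral_const]
    exact ENNReal.mul_ne_top ENNReal.ofReal_ne_top (measure_ne_top _ _)
  have h2 : ∫⁻ z, ENNReal.ofReal (C z) ∂γ ≠ ⊤ := by
    intro h3
    refine h.ne ?_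
    unfold planCost
    simp only [Prod.mk.eta, ← EReal.coe_neg, EReal.real_coe_toENNReal]
    rw [h3, ← ENNReal.ofReal_toReal h1]
    simp
  refine ⟨hC, ?_⟩
  rw [hasFiniteIntegral_iff_norm]
  refine lt_of_le_of_lt (lintegral_mono (g := fun z => ENNReal.ofReal (C z) + ENNReal.ofReal (-C z))
    fun z => ?_) ?_
  · rcases le_total 0 (C z) with h3 | h3
    · rw [Real.norm_of_nonneg h3]; exact le_self_add
    · rw [Real.norm_of_nonpos h3]; exact le_add_self
  · rw [lintegral_add_left' (hC.aemeasurable.ennreal_ofReal)]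
    exact (ENNReal.add_ne_top.2 ⟨h2, h1⟩).lt_top

theorem planCost_eq_integral {C : M × M → ℝ} {γ : Measure (M × M)} (hC : Integrable C γ) :
    planCost (fun x y => (C (x, y) : EReal)) γ = (∫ z, C z ∂γ : ℝ) := by
  have h1 : ∫⁻ z, ENNReal.ofReal (-C z) ∂γ ≠ ⊤ := hC.neg.lintegral_lt_top.ne
  have h2 : ∫⁻ z, ENNReal.ofReal (C z) ∂γ ≠ ⊤ := hC.lintegral_lt_top.ne
  rw [integral_eq_lintegral_pos_part_sub_lintegral_neg_part hC]
  unfold planCost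
  simp only [Prod.mk.eta, ← EReal.coe_neg, EReal.real_coe_toENNReal]
  rw [EReal.coe_sub]
  congr 1
  · exact (EReal.coe_ennreal_toReal h2).symm
  · exact (EReal.coe_ennreal_toReal h1).symm

end PlanCost

section KantorovichPotential

variable {M : Type*} [TopologicalSpace M] [SecondCountableTopology M] [MeasurableSpace M]
  [BorelSpace M]

theorem mem_support_map_graph {μ : Measure M} {φ : M → M} (hφm : AEMeasurable φ μ) {x : M}
    (hx : x ∈ μ.support) (hφ : ContinuousAt φ x) :
    (x, φ x) ∈ (μ.map fun x => (x, φ x)).support := by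
  rw [Measure.mem_support_iff_forall]
  intro U hU
  obtain ⟨V, hVU, hV, hxV⟩ := mem_nhds_iff.1 hU
  have h1 : (fun x => (x, φ x)) ⁻¹' V ∈ 𝓝 x :=
    (continuousAt_id.prodMk hφ).preimage_mem_nhds (hV.mem_nhds hxV)
  calc 0 < μ ((fun x => (x, φ x)) ⁻¹' V) := (Measure.mem_support_iff_forall x).1 hx _ h1
    _ = (μ.map fun x => (x, φ x)) V :=
      (Measure.map_apply_of_aemeasurable (aemeasurable_id.prodMk hφm) hV.measurableSet).symm
    _ ≤ (μ.map fun x => (x, φ x)) U := measure_mono hVU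

/-- A Kantorovich potential for an optimal plan induced by a continuous map. -/
theorem exists_kantorovich_potential {C : M × M → ℝ} (hC : Continuous C) {b : ℝ}
    (hb : ∀ z, b ≤ C z) {μ ν : Measure M} [IsProbabilityMeasure μ]
    (hfin : kantorovichCost (fun x y => (C (x, y) : EReal)) μ ν < ⊤) {φ : M → M}
    (hφ : ∀ x ∈ μ.support, ContinuousAt φ x)
    (hopt : IsOptimalPlan (fun x y => (C (x, y) : EReal)) μ ν (μ.map fun x => (x, φ x))) :
    ∃ f : M → ℝ, (∀ x ∈ μ.support, ∀ z ∈ μ.support, f z ≤ f x + (C (z, φ x) - C (x, φ x))) ∧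
      ContinuousOn f μ.support := by
  obtain ⟨⟨hp1, hp2⟩, hcost⟩ := hopt
  set γ := μ.map fun x => (x, φ x) with hγ
  -- A pushforward by a map that is not almost everywhere measurable is `0` by convention. The first
  -- marginal excludes this, so measurability of `φ` comes from optimality.
  have hγ0 : γ ≠ 0 := by
    intro h0
    rw [h0, Measure.map_zero] at hp1
    exact IsProbabilityMeasure.ne_zero μ hp1.symm
  have hm : AEMeasurable (fun x => (x, φ x)) μ := AEMeasurable.of_map_ne_zero hγ0
  have hφm : AEMeasurable φ μ := measurable_snd.comp_aemeasurable hm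
  have : IsProbabilityMeasure γ := Measure.isProbabilityMeasure_map hm
  have hint : Integrable C γ := integrable_of_planCost_lt_top hC.aestronglyMeasurable hb
    (by rw [hcost]; exact hfin)
  have hmin : ∀ γ' : Measure (M × M), γ'.map Prod.fst = γ.map Prod.fst →
      γ'.map Prod.snd = γ.map Prod.snd → Integrable C γ' → ∫ z, C z ∂γ ≤ ∫ z, C z ∂γ' := by
    intro γ' h1 h2 h3
    have h4 : planCost (fun x y => (C (x, y) : EReal)) γ ≤
        planCost (fun x y => (C (x, y) : EReal)) γ' := by
      rw [hcost]
      exact iInf₂_le γ' ⟨h1.trans hp1, h2.trans hp2⟩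
    rwa [planCost_eq_integral hint, planCost_eq_integral h3, EReal.coe_le_coe_iff] at h4
  let D : μ.support → μ.support → ℝ := fun x z => C (z, φ x) - C (x, φ x)
  obtain ⟨f, hf⟩ := exists_potential D fun n v hv => by
    rcases n with _ | n
    · simp
    · rw [sum_range_eq_sum_finRotate D hv, Finset.sum_sub_distrib, sub_nonneg]
      exact sum_le_sum_perm_of_optimal hC hb hint hmin (ι := Fin (n + 1))
        (z := fun i => ((v i : M), φ (v i)))
        (fun i => mem_support_map_graph hφm (v i).2 (hφ _ (v i).2)) (finRotate (n + 1))
  classical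
  refine ⟨fun x => if hx : x ∈ μ.support then f ⟨x, hx⟩ else 0, fun x hx z hz => ?_, ?_⟩
  · simpa only [dif_pos hx, dif_pos hz] using hf ⟨x, hx⟩ ⟨z, hz⟩
  · rw [continuousOn_iff_continuous_domRestrict]
    have e : μ.support.domRestrict (fun x => if hx : x ∈ μ.support then f ⟨x, hx⟩ else 0) = f := by
      ext x; simp [x.2]
    rw [e, continuous_iff_continuousAt]
    intro x
    have c1 : Tendsto (fun z : μ.support => D x z) (𝓝 x) (𝓝 (D x x)) := by
      have : Continuous fun z : μ.support => D x z := by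
        simp only [D]; fun_prop
      exact this.tendsto x
    have c2 : Tendsto (fun z : μ.support => D z x) (𝓝 x) (𝓝 (D x x)) := by
      have h1 : ContinuousAt (fun z : μ.support => φ z) x :=
        (hφ x x.2).comp continuousAt_subtype_val
      have h2 : ContinuousAt (fun z : μ.support => C (x, φ z)) x :=
        hC.continuousAt.comp (continuousAt_const.prodMk h1)
      have h3 : ContinuousAt (fun z : μ.support => C (z, φ z)) x :=
        hC.continuousAt.comp (continuousAt_subtype_val.prodMk h1)
      exact h2.sub h3
    have e0 : D x x = 0 := sub_self _
    rw [e0] at c1 c2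
    -- Exchanging the two points in the potential inequality squeezes `f z - f x` between `-D z x`
    -- and `D x z`, which both tend to zero; the lower bound uses continuity of `φ`.
    refine tendsto_of_tendsto_of_tendsto_of_le_of_le (g := fun z => f x - D z x)
      (h := fun z => f x + D x z) ?_ ?_ (fun z => ?_) (fun z => hf x z)
    · simpa using tendsto_const_nhds.sub c2
    · simpa using tendsto_const_nhds.add c1
    · have := hf z x
      simp only
      linarith

end KantorovichPotential

/-! ### Smooth functions touching a continuous function from below -/

section Touching

variable {E : Type*} [NormedAddCommGroup E] [NormedSpace ℝ E] [FiniteDimensional ℝ E]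

/-- A continuous function has smooth lower touching functions at points near any given point. -/
theorem exists_touching_coord {g : E → ℝ} {N : Set E} {e : E} (hN : N ∈ 𝓝 e)
    (hg : ContinuousOn g N) : ∃ y ∈ N, ∃ θ : E → ℝ, Differentiable ℝ θ ∧
      ∀ᶠ w in 𝓝 y, w ∈ N ∧ θ w - θ y ≤ g w - g y := by
  -- Euclidean balls are used because the given norm on `E` need not have a differentiable square.
  obtain ⟨r, hr, hrN⟩ := Euclidean.nhds_basis_closedBall.mem_iff.1 hN
  have hcpt : IsCompact (Euclidean.closedBall e r) := Euclidean.isCompact_closedBall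
  have hne : (Euclidean.closedBall e r).Nonempty :=
    ⟨e, Euclidean.ball_subset_closedBall (Euclidean.mem_ball_self hr)⟩
  obtain ⟨y₀, -, hy₀⟩ := hcpt.exists_isMinOn hne (hg.mono hrN)
  -- On the bounding sphere the penalty `A * r ^ 2` exceeds `g e - g y₀`, so the minimum of `g - θ`
  -- is attained inside the ball.
  set A := (|g e - g y₀| + 1) / r ^ 2 with hA
  let θ : E → ℝ := fun w => -(A * ‖toEuclidean w - toEuclidean e‖ ^ 2)
  have hθ : Differentiable ℝ θ := by
    have h1 : Differentiable ℝ fun w : E => toEuclidean w - toEuclidean e :=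
      (toEuclidean (E := E)).differentiable.sub_const _
    exact ((h1.norm_sq ℝ).const_mul A).neg
  obtain ⟨y, hy, hmin⟩ := hcpt.exists_isMinOn hne (f := fun w => g w - θ w)
    ((hg.mono hrN).sub hθ.continuous.continuousOn)
  have heB : e ∈ Euclidean.closedBall e r := Euclidean.ball_subset_closedBall (Euclidean.mem_ball_self hr)
  have h2 : g y - θ y ≤ g e - θ e := hmin heB
  have h3 : g y₀ ≤ g y := hy₀ hy
  have hyb : y ∈ Euclidean.ball e r := by
    refine lt_of_le_of_ne (show Euclidean.dist y e ≤ r from hy) fun h4 => ?_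
    have h5 : ‖toEuclidean y - toEuclidean e‖ = r := by
      rw [← dist_eq_norm]; exact h4
    simp only [θ, h5, sub_self, norm_zero] at h2
    have h6 : A * r ^ 2 = |g e - g y₀| + 1 := by rw [hA]; field_simp
    have := le_abs_self (g e - g y₀)
    rw [h6] at h2
    norm_num at h2
    linarith
  refine ⟨y, hrN hy, θ, hθ, ?_⟩
  filter_upwards [Euclidean.isOpen_ball.mem_nhds hyb] with w hw
  have hw' := Euclidean.ball_subset_closedBall hw
  have h7 : g y - θ y ≤ g w - θ w := hmin hw'
  exact ⟨hrN hw', by linarith⟩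

theorem exists_touching {M : Type*} [TopologicalSpace M] [ChartedSpace E M]
    [IsManifold 𝓘(ℝ, E) ∞ M] {f : M → ℝ} {N : Set M} {x₀ : M} (hN : N ∈ 𝓝 x₀)
    (hf : ContinuousOn f N) : ∃ x ∈ N, ∃ ψ : M → ℝ, MDifferentiableAt 𝓘(ℝ, E) 𝓘(ℝ, ℝ) ψ x ∧
      ∀ᶠ w in 𝓝 x, w ∈ N ∧ ψ w - ψ x ≤ f w - f x := by
  let χ := extChartAt 𝓘(ℝ, E) x₀
  have hx₀ : x₀ ∈ χ.source := mem_extChartAt_source x₀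
  have h1 : χ.target ∩ χ.symm ⁻¹' N ∈ 𝓝 (χ x₀) := by
    refine inter_mem ((isOpen_extChartAt_target x₀).mem_nhds (χ.map_source hx₀)) ?_
    refine (continuousAt_extChartAt_symm x₀).preimage_mem_nhds ?_
    rwa [extChartAt_to_inv]
  obtain ⟨y, ⟨hyt, hyN⟩, θ, hθ, hev⟩ := exists_touching_coord (g := f ∘ χ.symm) h1
    (hf.comp ((continuousOn_extChartAt_symm x₀).mono inter_subset_left) fun y hy => hy.2)
  have hxs : χ.symm y ∈ χ.source := χ.map_target hyt
  have hχy : χ (χ.symm y) = y := χ.right_inv hyt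
  refine ⟨χ.symm y, hyN, fun w => θ (χ w), ?_, ?_⟩
  · exact (hθ (χ (χ.symm y))).mdifferentiableAt.comp (χ.symm y)
      ((contMDiffAt_extChartAt' (n := 1) (by simpa [χ] using hxs)).mdifferentiableAt one_ne_zero)
  · have hcont : Tendsto χ (𝓝 (χ.symm y)) (𝓝 y) := by
      have := continuousAt_extChartAt' (I := 𝓘(ℝ, E)) hxs
      rwa [ContinuousAt, show extChartAt 𝓘(ℝ, E) x₀ (χ.symm y) = y from hχy] at this
    filter_upwards [hcont.eventually hev, (isOpen_extChartAt_source x₀).mem_nhds hxs] with w hw hws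
    have e : χ.symm (χ w) = w := χ.left_inv hws
    obtain ⟨⟨-, h2⟩, h3⟩ := hw
    simp only [mem_preimage, Function.comp_apply, e] at h2 h3
    rw [hχy]
    exact ⟨h2, h3⟩

end Touching

/-! ### Density of the points whose minimizers are normal -/

namespace Problem

variable {E : Type*} [NormedAddCommGroup E] [NormedSpace ℝ E]
  {M : Type*} [TopologicalSpace M]
  [ChartedSpace E M] [IsManifold 𝓘(ℝ, E) ∞ M] {k : ℕ} {P : Problem E M k}

theorem CompleteCost.exists_real_cost (h : P.CompleteCost) (a b : M) : ∃ r : ℝ, P.cost a b = r := by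
  obtain ⟨x, -, -, u, -, h1⟩ := h a b
  exact ⟨_, h1.symm⟩

/-- If `φ` induces an optimal plan, then for all `x` in a dense subset of the support, every
minimizer from `x` to `φ x` is normal. -/
theorem support_subset_closure_normal [FiniteDimensional ℝ E] [SecondCountableTopology M]
    [MeasurableSpace M] [BorelSpace M] (hH : P.HamiltonianIsC2)
    (hcomplete : P.CompleteCost) (hcont : Continuous (fun z : M × M => P.cost z.1 z.2))
    (hbdd : ∃ b : ℝ, ∀ x y : M, (b : EReal) ≤ P.cost x y) {μ ν : Measure M}
    [IsProbabilityMeasure μ] (hfinite : kantorovichCost P.cost μ ν < ⊤)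
    (hsupp : μ.support = closure (interior μ.support)) {φ : M → M}
    (hφ : ∀ x ∈ μ.support, ContinuousAt φ x)
    (hopt : IsOptimalPlan P.cost μ ν (μ.map fun x => (x, φ x))) :
    μ.support ⊆ closure {x ∈ μ.support | ∀ γ : ℝ → M, P.IsMinimizer γ x (φ x) →
      P.IsNormalMinimizer γ x (φ x)} := by
  choose c hc using hcomplete.exists_real_cost
  have hcost : P.cost = fun x y => (c x y : EReal) := by
    funext x y; exact hc x y
  obtain ⟨b, hb⟩ := hbdd
  have hC : Continuous fun z : M × M => c z.1 z.2 := by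
    rw [← EReal.continuous_coe_iff]
    simpa only [hcost] using hcont
  have hb' : ∀ z : M × M, b ≤ c z.1 z.2 := fun z => by
    have := hb z.1 z.2
    rwa [hc, EReal.coe_le_coe_iff] at this
  rw [hcost] at hfinite hopt
  obtain ⟨f, hf, hfc⟩ := exists_kantorovich_potential (C := fun z : M × M => c z.1 z.2) hC hb'
    hfinite hφ hopt
  have key : interior μ.support ⊆ closure {x ∈ μ.support | ∀ γ : ℝ → M,
      P.IsMinimizer γ x (φ x) → P.IsNormalMinimizer γ x (φ x)} := by
    intro x₀ hx₀
    rw [mem_closure_iff_nhds]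
    intro N hN
    obtain ⟨x, ⟨hxN, hxS⟩, ψ, hψ, hev⟩ := exists_touching (E := E)
      (inter_mem hN (mem_interior_iff_mem_nhds.1 hx₀)) (hfc.mono inter_subset_right)
    refine ⟨x, hxN, hxS, fun γ hγ => hγ.isNormalMinimizer hH hψ ?_⟩
    filter_upwards [hev] with w hw
    obtain ⟨⟨-, hwS⟩, h1⟩ := hw
    -- Since `ψ` lies below `f` and increments of `f` lie below those of `c(·, φ x)`, the function
    -- `ψ` supports the cost from below at `x`.
    have h2 := hf x hxS w hwS
    rw [hc, hc, ← EReal.coe_add, EReal.coe_le_coe_iff]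
    simp only at h2
    linarith
  calc μ.support = closure (interior μ.support) := hsupp
    _ ⊆ _ := closure_minimal key isClosed_closure

end Problem

end OptimalControl

theorem theorem7p2
    {E : Type*} [NormedAddCommGroup E] [NormedSpace ℝ E] [FiniteDimensional ℝ E]
    {M : Type*} [TopologicalSpace M] [T2Space M] [SecondCountableTopology M] [ConnectedSpace M]
    [ChartedSpace E M] [IsManifold 𝓘(ℝ, E) ∞ M] [MeasurableSpace M] [BorelSpace M]
    {k : ℕ} (P : OptimalControl.Problem E M k)
    (hH : P.HamiltonianIsC2)
    (hcomplete : P.CompleteCost)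
    (hcont : Continuous (fun z : M × M => P.cost z.1 z.2))
    (hbdd : ∃ b : ℝ, ∀ x y : M, (b : EReal) ≤ P.cost x y)
    (μ ν : Measure M) [IsProbabilityMeasure μ] [IsProbabilityMeasure ν]
    (hfinite : OptimalControl.kantorovichCost P.cost μ ν < ⊤)
    (hsupp : μ.support = closure (interior μ.support)) :
    (∀ φ : M → M, Continuous φ →
      OptimalControl.IsOptimalPlan P.cost μ ν (μ.map (fun x => (x, φ x))) →
      μ.support ⊆ closure
        {x ∈ μ.support | ∃ γ : ℝ → M, P.IsNormalMinimizer γ x (φ x)}) ∧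
    (∀ (W : Set M) (Φ : ℝ → M → M), P.IsStrictlyAbnormalFlow W Φ → μ.support ⊆ W →
      ¬ OptimalControl.IsOptimalPlan P.cost μ ν (μ.map (fun x => (x, Φ 1 x)))) := by
  refine ⟨fun φ hφ hopt => ?_, fun W Φ hΦ hW hopt => ?_⟩
  · refine (OptimalControl.Problem.support_subset_closure_normal hH hcomplete hcont hbdd hfinite
      hsupp (fun x _ => hφ.continuousAt) hopt).trans (closure_mono fun x hx => ⟨hx.1, ?_⟩)
    obtain ⟨γ, hγ⟩ := hcomplete x (φ x)
    exact ⟨γ, hx.2 γ hγ⟩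
  -- `Φ 1` is controlled only on `W`; continuity at points of the support suffices because `W` is
  -- open.
  · have hcΦ : ContinuousOn (Φ 1) W := hΦ.continuous.comp (f := fun x => ((1 : ℝ), x))
      (by fun_prop) fun x hx => ⟨⟨zero_le_one, le_rfl⟩, hx⟩
    have hsub := OptimalControl.Problem.support_subset_closure_normal hH hcomplete hcont hbdd
      hfinite hsupp (fun x hx => hcΦ.continuousAt (hΦ.isOpen.mem_nhds (hW hx))) hopt
    -- Density in a nonempty support provides a point where all minimizers are normal, in particular
    -- the trajectory of the flow.
    obtain ⟨x₀, hx₀⟩ := Measure.nonempty_support (IsProbabilityMeasure.ne_zero μ)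
    obtain ⟨x, hx⟩ := closure_nonempty_iff.1 ⟨x₀, hsub hx₀⟩
    have h := hΦ.strictlyAbnormal x (hW hx.1)
    exact h.2 (hx.2 _ h.1)
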